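/- Let $2\le n\le 13$ and let $E^{(n,1)}$ be $\mathbb{R}^{n+1}$ with the scalar product of the quadratic form $f(x)=-3x_0^2+x_1^2+\dots+x_n^2$. Let $\mathfrak C=\{v: f(v)<0,\ v_0>0\}$, let $\mathbb{H}^n=\mathfrak C/\mathbb{R}^+$ be the vector model of hyperbolic $n$-space, whose isometries are the orthogonal transformations of $E^{(n,1)}$ preserving $\mathfrak C$, and let $\Theta_n$ be the group of those isometries that preserve the lattice $\mathbb{Z}^{n+1}$. Let $\Gamma\le\Theta_n$ be the subgroup generated by all reflections in $\Theta_n$, let $P$ be a $\Gamma$-cell (the closure of a connected component of the complement in $\mathbb{H}^n$ of the mirrors of the reflections in $\Gamma$), and let $\mathrm{Sym}\,P$ be the group of isometries of $\mathbb{H}^n$ mapping $P$ onto itself. The Coxeter scheme of $P$ is the graph whose vertices are the codimension-one faces of $P$, where two faces are joined by an edge labelled $m$ if they meet at the dihedral angle $\pi/m$ (no edge if $m=2$), by a heavy edge if their hyperplanes are parallel (angle zero), and by a dashed edge if their hyperplanes diverge; its symmetries are the permutations of its vertices that preserve the types of all edges. An ideal vertex of $P$ is a vertex of $P$ on the boundary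 at infinity of $\mathbb{H}^n$. Two ideal vertices are called symmetric if some element of $\mathrm{Sym}\,P$ takes one to the other. Then: 1. $\mathrm{Sym}\,P$ is trivial for $2\le n\le 9$, and $\mathrm{Sym}\,P\cong\mathbb{Z}/2$ for $10\le n\le 12$. 2. For $n=9$, $P$ has exactly two ideal vertices, and they are not symmetric to one another. 3. For $n=10$, $P$ has exactly three ideal vertices: one pair of symmetric vertices, and one vertex not symmetric to any other. 4. For $n=11$, $P$ has exactly five ideal vertices, which can be grouped into two pairs of symmetric vertices and one vertex not symmetric to any other. 5. For $n=12$, $P$ has exactly six ideal vertices, which can be grouped into two pairs of symmetric vertices and two vertices, each not symmetric to any other. 6. For $n=13$, $P$ has exactly thirteen ideal vertices, which can be grouped into six pairs of symmetric vertices and one vertex not symmetric to any other (vertices of different pairs may also be symmetric). The symmetry group of the Coxeter scheme of $P$ is generated by two commuting elements of order two and is isomorphic to $\mathbb{Z}/2\times\mathbb{Z}/2$; also $\mathrm{Sym}\,P\cong\mathbb{Z}/2\times\mathbb{Z}/2$. 7. In all cases $\Theta_n=\Gamma\rtimes\mathrm{Sym}\,P$; thus, if $\Theta_n=\Gamma\rtimes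 H$ with $H\le\mathrm{Sym}\,P$, then $H=\mathrm{Sym}\,P$. -/

import Mathlib

namespace HypRefl

/-- The vector space `E^{(n,1)}` with coordinates `x_0, x_1, …, x_n`. -/
abbrev V (n : ℕ) : Type := Fin (n + 1) → ℝ

/-- The scalar product of the quadratic form `-3 x_0² + x_1² + … + x_n²`. -/
def form {n : ℕ} (x y : V n) : ℝ :=
  -3 * (x 0 * y 0) + ∑ i : Fin n, x i.succ * y i.succ

/-- The open convex cone `ℭ`: one of the two halves of the set of vectors of negative square. -/
def cone (n : ℕ) : Set (V n) := {v | form v v < 0 ∧ 0 < v 0}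

/-- Hyperbolic space `ℍⁿ`: each ray in `ℭ` is represented by its unique vector of square `-1`. -/
def hyp (n : ℕ) : Set (V n) := {v | v ∈ cone n ∧ form v v = -1}

/-- The motions of `ℍⁿ`: the orthogonal transformations of `E^{(n,1)}` which preserve `ℭ`. -/
def Isom (n : ℕ) : Subgroup (V n ≃ₗ[ℝ] V n) where
  carrier := {g | (∀ x y, form (g x) (g y) = form x y) ∧ ∀ v, g v ∈ cone n ↔ v ∈ cone n}
  mul_mem' := by
    rintro a b ⟨ha, ha'⟩ ⟨hb, hb'⟩
    refine ⟨fun x y => ?_, fun v => ?_⟩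
    · rw [LinearEquiv.mul_apply, LinearEquiv.mul_apply, ha, hb]
    · rw [LinearEquiv.mul_apply, ha', hb']
  one_mem' := ⟨fun _ _ => rfl, fun _ => Iff.rfl⟩
  inv_mem' := by
    rintro a ⟨ha, ha'⟩
    have key : ∀ v, a (a⁻¹ v) = v := fun v => a.apply_symm_apply v
    refine ⟨fun x y => ?_, fun v => ?_⟩
    · rw [← ha, key, key]
    · rw [← ha', key]

/-- The integral lattice `ℤ v_0 ⊕ … ⊕ ℤ v_n`. -/
def lattice (n : ℕ) : Set (V n) := {v | ∀ i, ∃ m : ℤ, v i = m}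

/-- `Θ_n`: the motions of `ℍⁿ` given by integral automorphisms of the quadratic form. -/
def Theta (n : ℕ) : Subgroup (V n ≃ₗ[ℝ] V n) where
  carrier := {g | g ∈ Isom n ∧ ∀ v, g v ∈ lattice n ↔ v ∈ lattice n}
  mul_mem' := by
    rintro a b ⟨ha, ha'⟩ ⟨hb, hb'⟩
    refine ⟨mul_mem ha hb, fun v => ?_⟩
    rw [LinearEquiv.mul_apply, ha', hb']
  one_mem' := ⟨one_mem _, fun _ => Iff.rfl⟩
  inv_mem' := by
    rintro a ⟨ha, ha'⟩
    have key : ∀ v, a (a⁻¹ v) = v := fun v => a.apply_symm_apply v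
    refine ⟨inv_mem ha, fun v => ?_⟩
    rw [← ha', key]

/-- `g` is the reflection `R_e` in the hyperplane `Π_e` orthogonal to the vector `e`
of positive square. -/
def IsReflectionIn {n : ℕ} (g : V n ≃ₗ[ℝ] V n) (e : V n) : Prop :=
  0 < form e e ∧ ∀ v, g v = v - (2 * form e v / form e e) • e

/-- `Γ`: the subgroup of `Θ_n` generated by all reflections contained in `Θ_n`. -/
def Gam (n : ℕ) : Subgroup (V n ≃ₗ[ℝ] V n) :=
  Subgroup.closure {g | g ∈ Theta n ∧ ∃ e, IsReflectionIn g e}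

/-- The points of `ℍⁿ` which lie on no mirror of a reflection in `Γ`. -/
def mirrorComplement (n : ℕ) : Set (V n) :=
  {x | x ∈ hyp n ∧ ∀ g ∈ Gam n, ∀ e, IsReflectionIn g e → form e x ≠ 0}

/-- `P` is a `Γ`-cell: the closure of a connected component of the complement in `ℍⁿ` of the
mirrors of `Γ`.  (The closure is taken in `E^{(n,1)}`, in which `ℍⁿ` is closed.) -/
def IsCell (n : ℕ) (P : Set (V n)) : Prop :=
  ∃ x ∈ mirrorComplement n, P = closure (connectedComponentIn (mirrorComplement n) x)

/-- `Sym P`: the motions of `ℍⁿ` which map `P` onto itself. -/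
def Sym {n : ℕ} (P : Set (V n)) : Subgroup (V n ≃ₗ[ℝ] V n) where
  carrier := {g | g ∈ Isom n ∧ ∀ v, g v ∈ P ↔ v ∈ P}
  mul_mem' := by
    rintro a b ⟨ha, ha'⟩ ⟨hb, hb'⟩
    refine ⟨mul_mem ha hb, fun v => ?_⟩
    rw [LinearEquiv.mul_apply, ha', hb']
  one_mem' := ⟨one_mem _, fun _ => Iff.rfl⟩
  inv_mem' := by
    rintro a ⟨ha, ha'⟩
    have key : ∀ v, a (a⁻¹ v) = v := fun v => a.apply_symm_apply v
    refine ⟨inv_mem ha, fun v => ?_⟩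
    rw [← ha', key]

/-- `G = N ⋊ K` (internal semidirect product) for subgroups `G`, `N`, `K` of one group:
`N` is a normal subgroup of `G` and `K` is a subgroup of `G` complementary to it. -/
def IsSemidirect {A : Type*} [Group A] (G N K : Subgroup A) : Prop :=
  N ≤ G ∧ K ≤ G ∧ (N.subgroupOf G).Normal ∧ (N.subgroupOf G).IsComplement' (K.subgroupOf G)

/-- The outward unit normals of the faces of codimension one of `P`: `P` lies in the halfspace
`(e, ·) ≤ 0`, and `P ∩ Π_e` spans the hyperplane `Π_e`. -/
def faceNormals {n : ℕ} (P : Set (V n)) : Set (V n) :=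
  {e | form e e = 1 ∧ (∀ y ∈ P, form e y ≤ 0) ∧
    ∀ v, form e v = 0 → v ∈ Submodule.span ℝ {y | y ∈ P ∧ form e y = 0}}

/-- The types of edges of a Coxeter scheme: `angle m` is an edge labelled `m`, for a dihedral angle
`π / m` (no line if `m = 2`); `cusp` is a heavy line, for a dihedral angle zero; `dashed` is a
dashed line, for divergent faces. -/
inductive Edge : Type
  | angle (m : ℕ)
  | cusp
  | dashed

/-- The hyperplanes with outward unit normals `e`, `e'` are joined by an edge of the given type.
(This never holds for `e = e'`, where the scalar product is `1`.) -/
def HasEdge {n : ℕ} (e e' : V n) : Edge → Prop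
  | Edge.angle m => 2 ≤ m ∧ form e e' = -Real.cos (Real.pi / m)
  | Edge.cusp => form e e' = -1
  | Edge.dashed => form e e' < -1

/-- The symmetry group of the Coxeter scheme of `P`: the permutations of its vertices (the faces of
codimension one of `P`) which preserve the types of all edges. -/
def SchemeSym {n : ℕ} (P : Set (V n)) : Subgroup (Equiv.Perm (faceNormals P)) where
  carrier := {s | ∀ a b : faceNormals P, ∀ k : Edge,
    HasEdge (s a : V n) (s b : V n) k ↔ HasEdge (a : V n) (b : V n) k}
  mul_mem' := by
    intro s t hs ht a b k
    rw [Equiv.Perm.mul_apply, Equiv.Perm.mul_apply, hs, ht]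
  one_mem' := fun _ _ _ => Iff.rfl
  inv_mem' := by
    intro s hs a b k
    have key : ∀ v, s (s⁻¹ v) = v := fun v => s.apply_symm_apply v
    rw [← hs, key, key]

/-- The points at infinity of `ℍⁿ`, i.e. the isotropic rays in the closure of `ℭ`; each is
represented by its unique vector with `x_0 = 1`. -/
def boundary (n : ℕ) : Set (V n) := {q | form q q = 0 ∧ q 0 = 1}

/-- The ideal vertices of `P`: the points at infinity `q` of `P` (the ray of `q` is a limit of rays
through points of `P`) which are vertices, i.e. the hyperplanes of the faces of codimension one
through `q` meet in the line of `q` only. -/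
def idealVertices {n : ℕ} (P : Set (V n)) : Set (V n) :=
  {q | q ∈ boundary n ∧ q ∈ closure {v | ∃ c : ℝ, 0 < c ∧ ∃ y ∈ P, v = c • y} ∧
    ∀ v, (∀ e ∈ faceNormals P, form e q = 0 → form e v = 0) → ∃ c : ℝ, v = c • q}

/-- Two points at infinity are symmetric: some element of `Sym P` takes the ray of `q` to the ray
of `q'`. -/
def Symmetric {n : ℕ} (P : Set (V n)) (q q' : V n) : Prop :=
  ∃ g ∈ Sym P, ∃ c : ℝ, 0 < c ∧ g q = c • q'

/-- The ideal vertices of `P` can be grouped into `p` disjoint pairs of symmetric vertices and `s`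
further vertices, each of which is symmetric to no other ideal vertex. -/
def GroupedInto {n : ℕ} (P : Set (V n)) (p s : ℕ) : Prop :=
  ∃ f : (Fin p × Bool) ⊕ Fin s ≃ idealVertices P,
    (∀ i, Symmetric P (f (Sum.inl (i, false)) : V n) (f (Sum.inl (i, true)) : V n)) ∧
    ∀ j, ∀ q ∈ idealVertices P, Symmetric P (f (Sum.inr j) : V n) q → q = f (Sum.inr j)

/-- The group `ℤ/2`, written multiplicatively. -/
abbrev C2 : Type := Multiplicative (ZMod 2)

end HypRefl

/-!
The proof runs Vinberg's algorithm for the form `-3 x_0² + x_1² + ⋯ + x_n²` with the base point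
`(1, 0, …, 0)`, and replaces the appeal to the finiteness of the volume of the resulting polyhedron
by elementary arguments about the cone over it.

A reflection in `Θ_n` is the reflection in a root, that is an integral vector of square `1`, `2`
or `6` with the crystallographic condition (`exists_root_of_reflection`).  The simple roots are the
`n` simple roots `-v_i + v_{i+1}`, `-v_n` of the stabilizer of the base point, and a finite list
`extraRoots n`.  Two facts about them are verified by computation.

* Order: a root in the chamber of the stabilizer whose mirror is no farther from the base point than
  that of a simple root `e` has nonpositive scalar product with `e`, or is `e` (`orderCheck`).
* Light cone: the cone `fundCone n` cut out by the simple roots lies in the closed light cone.  Its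
  generators are found by the double description method, whose correctness needs only that each face
  has a listed generator on it (`IsDD`).

They imply that no root changes sign on `fundCone n` (`IsRoot.sign`), by descent on `r_0` for a root
`r` with `r_0 > 0`.  Moving `r` into the chamber only increases its values on the cone.  As
`fundCone n` contains no vector of positive square, `r` then has positive scalar product with some
`e` in `extraRoots n`, and the reflection in `e` decreases `r_0`.  If the first coordinate becomes
negative, then by the order condition the mirror of `e` was the closer one, and the halfspaces of `r`
and `e` are nested.

Hence the simple roots form a system in the sense of `IsSimpleSystem`, from which the general theory
follows: the reflections in the simple roots generate `Γ` (`Gam_eq_simpleGroup`), every cell is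
a translate of the cell of the simple roots by an element of `Γ` (`exists_of_isCell`), and only the
identity of `Γ` preserves a cell (`eq_one_of_mem_Gam`), which gives `Θ_n = Γ ⋊ Sym P`
(`isSemidirect`).

The faces of the cell are the mirrors of the simple roots (`faceNormals_eq`).  The symmetries of the
Coxeter scheme are enumerated by a search over partial permutations.  All of them preserve the scalar
products of the simple roots, and the simple roots generate the lattice, so each is
induced by a unique element of `Θ_n`; thus `Sym P` is the symmetry group of the scheme
(`exists_symEquiv`).  The ideal vertices are the isotropic rays of the cone (`idealVertices_eq`).
Those are extreme, hence occur among the generators produced by the double description method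
(`exists_gen_of_isotropic`), and the symmetries are followed on them.
-/

open Set Filter Topology

namespace HypRefl

/-! ### The Lorentzian scalar product -/

section Form

variable {n : ℕ}

lemma form_comm (x y : V n) : form x y = form y x := by
  simp only [form, mul_comm]

lemma form_add_left (x y z : V n) : form (x + y) z = form x z + form y z := by
  simp only [form, Pi.add_apply, add_mul, Finset.sum_add_distrib]; ring

lemma form_smul_left (c : ℝ) (x y : V n) : form (c • x) y = c * form x y := by
  simp only [form, Pi.smul_apply, smul_eq_mul, mul_assoc, mul_add, Finset.mul_sum]; ring

lemma form_add_right (x y z : V n) : form x (y + z) = form x y + form x z := by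
  rw [form_comm, form_add_left, form_comm y, form_comm z]

lemma form_smul_right (c : ℝ) (x y : V n) : form x (c • y) = c * form x y := by
  rw [form_comm, form_smul_left, form_comm]

lemma form_neg_left (x y : V n) : form (-x) y = -form x y := by
  rw [← neg_one_smul ℝ, form_smul_left]; ring

lemma form_neg_right (x y : V n) : form x (-y) = -form x y := by
  rw [form_comm, form_neg_left, form_comm]

lemma form_sub_left (x y z : V n) : form (x - y) z = form x z - form y z := by
  rw [sub_eq_add_neg, form_add_left, form_neg_left]; ring

lemma form_sub_right (x y z : V n) : form x (y - z) = form x y - form x z := by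
  rw [form_comm, form_sub_left, form_comm y, form_comm z]

@[simp] lemma form_zero_left (y : V n) : form 0 y = 0 := by simp [form]

@[simp] lemma form_zero_right (x : V n) : form x 0 = 0 := by simp [form]

/-- The linear functional `form x`. -/
def formL (x : V n) : V n →ₗ[ℝ] ℝ where
  toFun := form x
  map_add' := form_add_right x
  map_smul' c y := form_smul_right c x y

lemma form_sum_right {ι : Type*} (s : Finset ι) (x : V n) (y : ι → V n) :
    form x (∑ i ∈ s, y i) = ∑ i ∈ s, form x (y i) :=
  map_sum (formL x) y s

@[fun_prop] lemma continuous_form {X : Type*} [TopologicalSpace X] {a b : X → V n}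
    (ha : Continuous a) (hb : Continuous b) : Continuous fun t => form (a t) (b t) := by
  unfold form; fun_prop

lemma form_nondegenerate {x : V n} (h : ∀ y, form x y = 0) : x = 0 := by
  classical
  funext i
  refine Fin.cases ?_ (fun j => ?_) i
  · simpa [form] using h (Pi.single 0 1)
  · have := h (Pi.single j.succ 1)
    simpa [form, Pi.single_apply, Fin.succ_inj] using this

/-- The closure of the cone `ℭ`. -/
def fcone (n : ℕ) : Set (V n) := {v | form v v ≤ 0 ∧ 0 ≤ v 0}

lemma cone_subset_fcone {v : V n} (h : v ∈ cone n) : v ∈ fcone n := ⟨h.1.le, h.2.le⟩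

lemma form_self (x : V n) : form x x = -3 * x 0 ^ 2 + ∑ i : Fin n, x i.succ ^ 2 := by
  simp only [form, sq]

lemma cauchy_tail (x y : V n) : (∑ i : Fin n, x i.succ * y i.succ) ^ 2 ≤
    (∑ i : Fin n, x i.succ ^ 2) * ∑ i : Fin n, y i.succ ^ 2 :=
  Finset.sum_mul_sq_le_sq_mul_sq _ _ _

lemma eq_zero_of_form_self_nonpos {z : V n} (h0 : z 0 = 0) (h : form z z ≤ 0) : z = 0 := by
  rw [form_self, h0] at h
  have hs : ∑ i : Fin n, z i.succ ^ 2 = 0 :=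
    le_antisymm (by linarith) (Finset.sum_nonneg fun i _ => sq_nonneg _)
  rw [Finset.sum_eq_zero_iff_of_nonneg fun i _ => sq_nonneg _] at hs
  funext i
  refine Fin.cases h0 (fun j => ?_) i
  simpa using hs j (Finset.mem_univ j)

lemma fcone_pos {y : V n} (h : y ∈ fcone n) (hy : y ≠ 0) : 0 < y 0 := by
  rcases h.2.lt_or_eq with h' | h'
  · exact h'
  · exact absurd (eq_zero_of_form_self_nonpos h'.symm h.1) hy

lemma form_nonpos {x y : V n} (hx : x ∈ fcone n) (hy : y ∈ fcone n) : form x y ≤ 0 := by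
  have h1 := hx.1
  have h2 := hy.1
  rw [form_self] at h1 h2
  have hc := cauchy_tail x y
  have hp : 0 ≤ 3 * (x 0 * y 0) := by have := mul_nonneg hx.2 hy.2; linarith
  have hle : (∑ i : Fin n, x i.succ * y i.succ) ^ 2 ≤ (3 * (x 0 * y 0)) ^ 2 := by
    refine hc.trans ?_
    calc _ ≤ (3 * x 0 ^ 2) * (3 * y 0 ^ 2) :=
          mul_le_mul (by linarith) (by linarith) (Finset.sum_nonneg fun i _ => sq_nonneg _)
            (by positivity)
      _ = _ := by ring
  have := abs_le_of_sq_le_sq hle hp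
  unfold form
  linarith [le_abs_self (∑ i : Fin n, x i.succ * y i.succ)]

lemma form_neg_of_mem {x y : V n} (hx : x ∈ cone n) (hy : y ∈ fcone n) (h : y ≠ 0) :
    form x y < 0 := by
  have hy0 := fcone_pos hy h
  have h1 := hx.1
  have h2 := hy.1
  rw [form_self] at h1 h2
  have hc := cauchy_tail x y
  have hp : 0 ≤ 3 * (x 0 * y 0) := by have := mul_nonneg hx.2.le hy.2; linarith
  have hlt : (∑ i : Fin n, x i.succ * y i.succ) ^ 2 < (3 * (x 0 * y 0)) ^ 2 := by
    refine hc.trans_lt ?_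
    calc _ ≤ (∑ i : Fin n, x i.succ ^ 2) * (3 * y 0 ^ 2) :=
          mul_le_mul_of_nonneg_left (by linarith) (Finset.sum_nonneg fun i _ => sq_nonneg _)
      _ < (3 * x 0 ^ 2) * (3 * y 0 ^ 2) :=
          mul_lt_mul_of_pos_right (by linarith) (by positivity)
      _ = _ := by ring
  have := abs_lt_of_sq_lt_sq hlt hp
  unfold form
  linarith [le_abs_self (∑ i : Fin n, x i.succ * y i.succ)]

lemma cone_ne_zero {x : V n} (hx : x ∈ cone n) : x ≠ 0 := by
  rintro rfl
  simpa using hx.2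

/-- A vector of nonpositive square orthogonal to an isotropic vector `q` is proportional to `q`. -/
lemma eq_smul_of_form_eq_zero {q y : V n} (hq : form q q = 0) (hq0 : q 0 ≠ 0)
    (h : form q y = 0) (hy : form y y ≤ 0) : y = (y 0 / q 0) • q := by
  have : y - (y 0 / q 0) • q = 0 := by
    apply eq_zero_of_form_self_nonpos
    · simp [div_mul_cancel₀ _ hq0]
    · simp only [form_sub_left, form_sub_right, form_smul_left, form_smul_right, hq, h,
        form_comm y q]
      linarith
  exact sub_eq_zero.mp this

lemma mem_cone_of_form_neg {u v : V n} (hv : v ∈ fcone n) (hu : form u u < 0)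
    (h : form u v < 0) : u ∈ cone n := by
  refine ⟨hu, ?_⟩
  by_contra h0
  have : -u ∈ fcone n := ⟨by rw [form_neg_left, form_neg_right]; linarith,
    by simpa using h0⟩
  have := form_nonpos this hv
  rw [form_neg_left] at this
  linarith

lemma smul_mem_cone {x : V n} (hx : x ∈ cone n) {c : ℝ} (hc : 0 < c) : c • x ∈ cone n := by
  refine ⟨?_, ?_⟩
  · rw [form_smul_left, form_smul_right]
    have := hx.1
    have h2 : 0 < c * c := mul_pos hc hc
    nlinarith
  · simpa using mul_pos hc hx.2

lemma smul_mem_fcone {x : V n} (hx : x ∈ fcone n) {c : ℝ} (hc : 0 ≤ c) : c • x ∈ fcone n := by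
  refine ⟨?_, ?_⟩
  · rw [form_smul_left, form_smul_right]
    exact mul_nonpos_of_nonneg_of_nonpos hc (mul_nonpos_of_nonneg_of_nonpos hc hx.1)
  · simpa using mul_nonneg hc hx.2

lemma add_mem_cone {x y : V n} (hx : x ∈ cone n) (hy : y ∈ fcone n) : x + y ∈ cone n := by
  refine ⟨?_, ?_⟩
  · have := form_nonpos (cone_subset_fcone hx) hy
    simp only [form_add_left, form_add_right, form_comm y x]
    linarith [hx.1, hy.1]
  · exact add_pos_of_pos_of_nonneg hx.2 hy.2

lemma add_mem_fcone {x y : V n} (hx : x ∈ fcone n) (hy : y ∈ fcone n) : x + y ∈ fcone n := by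
  refine ⟨?_, add_nonneg hx.2 hy.2⟩
  have := form_nonpos hx hy
  simp only [form_add_left, form_add_right, form_comm y x]
  linarith [hx.1, hy.1]

lemma isOpen_cone : IsOpen (cone n) :=
  (isOpen_lt (f := fun v : V n => form v v) (by fun_prop) continuous_const).inter
    (isOpen_lt (g := fun v : V n => v 0) continuous_const (by fun_prop))

/-- The point of `ℍⁿ` on the ray of a vector of the cone `ℭ`. -/
noncomputable def toHyp (x : V n) : V n := (Real.sqrt (-form x x))⁻¹ • x

lemma sqrt_pos_of_mem_cone {x : V n} (hx : x ∈ cone n) : 0 < Real.sqrt (-form x x) :=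
  Real.sqrt_pos.mpr (by linarith [hx.1])

lemma toHyp_mem {x : V n} (hx : x ∈ cone n) : toHyp x ∈ hyp n := by
  have h := sqrt_pos_of_mem_cone hx
  refine ⟨smul_mem_cone hx (inv_pos.mpr h), ?_⟩
  rw [toHyp, form_smul_left, form_smul_right]
  have h2 := Real.mul_self_sqrt (show 0 ≤ -form x x by linarith [hx.1])
  field_simp
  nlinarith

lemma toHyp_of_mem_hyp {x : V n} (hx : x ∈ hyp n) : toHyp x = x := by
  simp [toHyp, hx.2]

lemma continuousOn_toHyp : ContinuousOn (toHyp : V n → V n) (cone n) := by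
  unfold toHyp
  have hc : Continuous fun x : V n => Real.sqrt (-form x x) := by fun_prop
  refine ContinuousOn.smul (hc.continuousOn.inv₀ fun x hx => ?_) continuousOn_id
  exact (sqrt_pos_of_mem_cone hx).ne'

end Form

/-! ### Reflections -/

section Reflection

variable {n : ℕ}

/-- The reflection in the hyperplane orthogonal to `e`; the identity if `e` is isotropic. -/
noncomputable def refl (e : V n) : V n ≃ₗ[ℝ] V n :=
  LinearEquiv.ofInvolutive
    { toFun := fun v => v - (2 * form e v / form e e) • e
      map_add' := fun x y => by
        rw [form_add_right, mul_add, add_div, add_smul]; abel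
      map_smul' := fun c x => by
        rw [form_smul_right, RingHom.id_apply, smul_sub, smul_smul]; congr 2; ring }
    (fun v => by
      simp only [LinearMap.coe_mk, AddHom.coe_mk, form_sub_right, form_smul_right]
      by_cases h : form e e = 0
      · simp [h]
      · rw [sub_sub, ← add_smul]
        have : 2 * form e v / form e e +
          2 * (form e v - 2 * form e v / form e e * form e e) / form e e = 0 := by
            field_simp; ring
        rw [this]; simp)

lemma refl_apply (e v : V n) : refl e v = v - (2 * form e v / form e e) • e := rfl

lemma IsReflectionIn.eq_refl {g : V n ≃ₗ[ℝ] V n} {e : V n} (h : IsReflectionIn g e) :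
    g = refl e := LinearEquiv.ext fun v => (h.2 v).trans (refl_apply e v).symm

lemma isReflectionIn_refl {e : V n} (h : 0 < form e e) : IsReflectionIn (refl e) e :=
  ⟨h, refl_apply e⟩

lemma refl_mul_self (e : V n) : refl e * refl e = 1 := by
  ext1 v
  exact (refl e).symm_apply_apply v

lemma form_refl {e : V n} (h : 0 < form e e) (x y : V n) :
    form (refl e x) (refl e y) = form x y := by
  simp only [refl_apply, form_sub_left, form_sub_right, form_smul_left, form_smul_right,
    form_comm x e]
  field_simp
  ring

lemma form_refl_left {e : V n} (h : 0 < form e e) (x y : V n) :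
    form (refl e x) y = form x (refl e y) := by
  conv_rhs => rw [← form_refl h]
  rw [show refl e (refl e y) = y from (refl e).symm_apply_apply y]

lemma refl_self {e : V n} (h : 0 < form e e) : refl e e = -e := by
  rw [refl_apply, mul_div_assoc, div_self h.ne', mul_one, two_smul]; abel

lemma refl_smul {c : ℝ} (hc : c ≠ 0) (e : V n) : refl (c • e) = refl e := by
  ext1 v
  simp only [refl_apply, form_smul_left, form_smul_right, smul_smul]
  by_cases h : form e e = 0
  · simp [h]
  · congr 2; field_simp

lemma refl_mem_Isom {e : V n} (h : 0 < form e e) : refl e ∈ Isom n := by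
  have key : ∀ v ∈ cone n, refl e v ∈ cone n := fun v hv => by
    refine mem_cone_of_form_neg (cone_subset_fcone hv) (by rw [form_refl h]; exact hv.1) ?_
    rw [refl_apply, form_sub_left, form_smul_left]
    have : 0 ≤ 2 * form e v / form e e * form e v := by
      rw [div_mul_eq_mul_div, mul_assoc, ← sq]; positivity
    linarith [hv.1]
  refine ⟨form_refl h, fun v => ⟨fun hv => ?_, key v⟩⟩
  have := key _ hv
  rwa [show refl e (refl e v) = v from (refl e).symm_apply_apply v] at this

lemma Isom_form {g : V n ≃ₗ[ℝ] V n} (hg : g ∈ Isom n) (x y : V n) :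
    form (g x) (g y) = form x y := hg.1 x y

lemma Isom_form_left {g : V n ≃ₗ[ℝ] V n} (hg : g ∈ Isom n) (x y : V n) :
    form (g x) y = form x (g⁻¹ y) := by
  rw [← Isom_form hg x (g⁻¹ y)]
  exact congrArg _ (g.apply_symm_apply y).symm

lemma refl_conj {g : V n ≃ₗ[ℝ] V n} (hg : g ∈ Isom n) (e : V n) :
    g * refl e * g⁻¹ = refl (g e) := by
  ext1 v
  rw [LinearEquiv.mul_apply, LinearEquiv.mul_apply, refl_apply, refl_apply, map_sub, map_smul,
    Isom_form hg, Isom_form_left hg, show g (g⁻¹ v) = v from g.apply_symm_apply v]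

lemma Gam_le_Theta : Gam n ≤ Theta n := (Subgroup.closure_le _).mpr fun _ h => h.1

lemma Isom_hyp {g : V n ≃ₗ[ℝ] V n} (hg : g ∈ Isom n) (x : V n) : g x ∈ hyp n ↔ x ∈ hyp n := by
  simp only [hyp, mem_ofPred_eq, hg.2, hg.1]

lemma Gam_conj {g h : V n ≃ₗ[ℝ] V n} (hg : g ∈ Theta n) (hh : h ∈ Gam n) :
    g * h * g⁻¹ ∈ Gam n := by
  induction hh using Subgroup.closure_induction with
  | mem x hx =>
    obtain ⟨hx, e, he⟩ := hx
    refine Subgroup.subset_closure ⟨mul_mem (mul_mem hg hx) (inv_mem hg), g e, ?_⟩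
    rw [he.eq_refl, refl_conj hg.1]
    exact isReflectionIn_refl (by rw [Isom_form hg.1]; exact he.1)
  | one => simp
  | mul x y _ _ hx hy =>
    have := mul_mem hx hy
    simpa [mul_assoc] using this
  | inv x _ hx =>
    have := inv_mem hx
    simpa [mul_assoc] using this

end Reflection

/-! ### Vectors with natural coordinates -/

/-- The scalar product of two lists of natural numbers. -/
def tdot : List ℕ → List ℕ → ℕ
  | a :: as, b :: bs => a * b + tdot as bs
  | _, _ => 0

/-- The vector with coordinate `x_0 = p.1` whose other coordinates are listed in `p.2`,
padded with zeros. -/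
def nvec (n : ℕ) (p : ℕ × List ℕ) : V n :=
  Fin.cons (p.1 : ℝ) fun i : Fin n => (p.2.getD i 0 : ℝ)

lemma sum_getD_mul (n : ℕ) (as bs : List ℕ) (h : as.length ≤ n) :
    ∑ i : Fin n, (as.getD i 0 : ℝ) * (bs.getD i 0 : ℝ) = tdot as bs := by
  induction n generalizing as bs with
  | zero =>
    obtain rfl : as = [] := List.length_eq_zero_iff.mp (by omega)
    simp [tdot]
  | succ n ih =>
    rw [Fin.sum_univ_succ]
    cases as with
    | nil => simp [tdot]
    | cons a as =>
      cases bs with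
      | nil => simp [tdot]
      | cons b bs =>
        have := ih as bs (by simpa using h)
        simp only [Fin.val_succ, Fin.val_zero, List.getD_cons_zero, List.getD_cons_succ, tdot]
        rw [this]; push_cast; ring

lemma form_nvec {n : ℕ} (p q : ℕ × List ℕ) (h : p.2.length ≤ n) :
    form (nvec n p) (nvec n q) = (tdot p.2 q.2 : ℝ) - 3 * (p.1 * q.1 : ℝ) := by
  rw [← sum_getD_mul n _ _ h]
  simp only [form, nvec, Fin.cons_zero, Fin.cons_succ]
  ring

lemma nvec_ne_zero {n : ℕ} {p : ℕ × List ℕ} (h : 0 < p.1) : nvec n p ≠ 0 := fun h0 => by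
  have := congrFun h0 0
  simp only [nvec, Fin.cons_zero, Pi.zero_apply, Nat.cast_eq_zero] at this
  omega

lemma nvec_mem_lattice {n : ℕ} (p : ℕ × List ℕ) : nvec n p ∈ lattice n := fun i =>
  Fin.cases ⟨p.1, by simp [nvec]⟩ (fun j => ⟨(p.2.getD j 0 : ℕ), by simp [nvec]⟩) i

/-! ### Generators of a polyhedral cone -/

section Polyhedral

variable {n : ℕ}

/-- The polyhedral cone cut out by the halfspaces `(a, ·) ≤ 0`, `a ∈ A`. -/
def polyCone (A : List (V n)) : Set (V n) := {x | ∀ a ∈ A, form a x ≤ 0}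

/-- Every hyperplane of the family `A` through `x` passes through `u`.  For `x` in the polyhedral
cone of `A` this says that `u` lies on the smallest face containing `x`. -/
def Covers (A : List (V n)) (u x : V n) : Prop := ∀ a ∈ A, form a x = 0 → form a u = 0

lemma add_mem_polyCone {A : List (V n)} {x y : V n} (hx : x ∈ polyCone A) (hy : y ∈ polyCone A) :
    x + y ∈ polyCone A := fun a ha => by
  rw [form_add_right]; linarith [hx a ha, hy a ha]

lemma smul_mem_polyCone {A : List (V n)} {x : V n} (hx : x ∈ polyCone A) {c : ℝ} (hc : 0 ≤ c) :
    c • x ∈ polyCone A := fun a ha => by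
  rw [form_smul_right]; exact mul_nonpos_of_nonneg_of_nonpos hc (hx a ha)

/-- A positive multiple of a vector `u ≠ 0` on the smallest face containing `x` can be subtracted
from `x` in such a way that the result stays in the cone and lies on a smaller face. -/
lemma exists_sub_smul_mem {A : List (V n)} (hA : ∀ x, (∀ a ∈ A, form a x = 0) → x = 0)
    {x u : V n} (hx : x ∈ polyCone A) (hu : u ∈ polyCone A) (hu0 : u ≠ 0) (hc : Covers A u x) :
    ∃ t : ℝ, 0 < t ∧ x - t • u ∈ polyCone A ∧ ∃ a ∈ A, form a x ≠ 0 ∧ form a (x - t • u) = 0 := by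
  classical
  set B := A.toFinset.filter fun a => form a u < 0 with hB
  have hne : B.Nonempty := by
    by_contra h
    rw [Finset.not_nonempty_iff_eq_empty, Finset.filter_eq_empty_iff] at h
    exact hu0 (hA u fun a ha => le_antisymm (hu a ha) (not_lt.mp (h (List.mem_toFinset.mpr ha))))
  obtain ⟨b, hb, hmin⟩ := B.exists_min_image (fun a => form a x / form a u) hne
  have hmem : ∀ a, a ∈ B ↔ a ∈ A ∧ form a u < 0 := fun a => by simp [hB]
  obtain ⟨hbA, hbu⟩ := (hmem b).mp hb
  have hbx : form b x < 0 := lt_of_le_of_ne (hx b hbA) fun h => hbu.ne (hc b hbA h)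
  refine ⟨form b x / form b u, div_pos_of_neg_of_neg hbx hbu, fun a ha => ?_, b, hbA, hbx.ne, ?_⟩
  · rw [form_sub_right, form_smul_right]
    rcases (hu a ha).lt_or_eq with h | h
    · have h1 := hmin a ((hmem a).mpr ⟨ha, h⟩)
      have h2 := mul_le_mul_of_nonpos_right h1 h.le
      rw [div_mul_cancel₀ _ h.ne] at h2
      linarith
    · rw [h]; linarith [hx a ha]
  · rw [form_sub_right, form_smul_right, div_mul_cancel₀ _ hbu.ne, sub_self]

/-- If every nonzero vector of a pointed polyhedral cone has a member of `G` on its smallest face,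
then the cone is generated by `G`. -/
lemma polyCone_induction {A : List (V n)} (hA : ∀ x, (∀ a ∈ A, form a x = 0) → x = 0)
    {G : Set (V n)} (hG : ∀ u ∈ G, u ∈ polyCone A ∧ u ≠ 0)
    (hcov : ∀ x ∈ polyCone A, x ≠ 0 → ∃ u ∈ G, Covers A u x)
    {Q : V n → Prop} (h0 : Q 0)
    (hadd : ∀ x ∈ polyCone A, Q x → ∀ u ∈ G, ∀ t : ℝ, 0 < t → Q (x + t • u)) :
    ∀ x ∈ polyCone A, Q x := by
  classical
  have key : ∀ k : ℕ, ∀ x ∈ polyCone A,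
      (A.toFinset.filter fun a => form a x ≠ 0).card = k → Q x := by
    intro k
    induction k using Nat.strong_induction_on with
    | _ k ih =>
      intro x hx hk
      by_cases hx0 : x = 0
      · rwa [hx0]
      obtain ⟨u, huG, hu⟩ := hcov x hx hx0
      obtain ⟨t, ht, hmem, b, hbA, hbx, hb0⟩ := exists_sub_smul_mem hA hx (hG u huG).1 (hG u huG).2 hu
      have hlt : (A.toFinset.filter fun a => form a (x - t • u) ≠ 0).card < k := by
        rw [← hk]
        apply Finset.card_lt_card
        refine ⟨fun a ha => ?_, fun h => ?_⟩
        · simp only [Finset.mem_filter, List.mem_toFinset] at ha ⊢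
          refine ⟨ha.1, fun h => ha.2 ?_⟩
          rw [form_sub_right, form_smul_right, h, hu a ha.1 h]; simp
        · have := h (Finset.mem_filter.mpr ⟨List.mem_toFinset.mpr hbA, hbx⟩)
          exact (Finset.mem_filter.mp this).2 hb0
      have := hadd _ hmem (ih _ hlt _ hmem rfl) u huG t ht
      rwa [sub_add_cancel] at this
  exact fun x hx => key _ x hx rfl

lemma covers_add_left {A : List (V n)} {x y u : V n} (hx : x ∈ polyCone A) (hy : y ∈ polyCone A)
    (h : Covers A u x) : Covers A u (x + y) := fun a ha h0 => h a ha <| by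
  rw [form_add_right] at h0
  linarith [hx a ha, hy a ha]

end Polyhedral

/-! ### The double description method -/

/-- A generator of a polyhedral cone: its coordinates, and the set of the bounding hyperplanes
passing through it, encoded by the binary digits of `mask`. -/
structure Gen where
  /-- The set of the bounding hyperplanes through the generator. -/
  mask : ℕ
  /-- The coordinates of the generator. -/
  ray : ℕ × List ℕ

/-- The positive part of the scalar product of `l` with a generator. -/
def above (l : ℕ × List ℕ) (g : Gen) : ℕ := tdot l.2 g.ray.2 - 3 * (l.1 * g.ray.1)

/-- The negative part of the scalar product of `l` with a generator. -/
def below (l : ℕ × List ℕ) (g : Gen) : ℕ := 3 * (l.1 * g.ray.1) - tdot l.2 g.ray.2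

/-- The point of the hyperplane orthogonal to `l` on the segment between `p` and `m`. -/
def comb (l : ℕ × List ℕ) (p m : Gen) : Gen :=
  ⟨2 * (p.mask &&& m.mask) + 1, below l m * p.ray.1 + above l p * m.ray.1,
    List.zipWith (fun x y => below l m * x + above l p * y) p.ray.2 m.ray.2⟩

/-- All hyperplanes of the set `J` pass through the generator `u`. -/
def coversMask (J : ℕ) (u : Gen) : Bool := Nat.beq (u.mask &&& J) J

/-- Adds to `acc` the points `comb l p m` for the listed pairs `(p, m)`, leaving out those pairs
for which the smallest face containing `p` and `m` already has a member of the list on it. -/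
def insertPairs (l : ℕ × List ℕ) : List (Gen × Gen) → List Gen → List Gen
  | [], acc => acc
  | (p, m) :: ps, acc =>
    bif acc.any (coversMask (2 * (p.mask &&& m.mask) + 1)) then insertPairs l ps acc
    else insertPairs l ps (comb l p m :: acc)

/-- One step of the double description method: generators of the intersection of the cone
generated by `G` with the halfspace `(l, ·) ≤ 0`. -/
def ddStep (G : List Gen) (l : ℕ × List ℕ) : List Gen :=
  let M := G.filter fun g => Nat.blt 0 (below l g)
  let P := G.filter fun g => Nat.blt 0 (above l g)
  let Z := G.filter fun g => Nat.beq (tdot l.2 g.ray.2) (3 * (l.1 * g.ray.1))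
  M.map (fun g => ⟨2 * g.mask, g.ray⟩) ++
    insertPairs l (P.flatMap fun p => M.map fun m => (p, m))
      (Z.map fun g => ⟨2 * g.mask + 1, g.ray⟩)

section DoubleDescription

variable {n : ℕ}

/-- The mask of the generator `g` records the hyperplanes of the family `A` passing through it. -/
def MaskSpec (A : List (V n)) (g : Gen) : Prop :=
  ∀ k a, A[k]? = some a → (g.mask.testBit k = true ↔ form a (nvec n g.ray) = 0)

/-- `G` is a system of generators of the pointed cone `polyCone A`. -/
structure IsDD (A : List (V n)) (G : List Gen) : Prop where
  pointed : ∀ x, (∀ a ∈ A, form a x = 0) → x = 0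
  mem : ∀ g ∈ G, nvec n g.ray ∈ polyCone A
  pos : ∀ g ∈ G, 0 < g.ray.1
  len : ∀ g ∈ G, g.ray.2.length = n
  mask : ∀ g ∈ G, MaskSpec A g
  cover : ∀ x ∈ polyCone A, x ≠ 0 → ∃ g ∈ G, Covers A (nvec n g.ray) x

lemma IsDD.induction {A : List (V n)} {G : List Gen} (h : IsDD A G) {Q : V n → Prop} (h0 : Q 0)
    (hadd : ∀ x ∈ polyCone A, Q x → ∀ g ∈ G, ∀ t : ℝ, 0 < t → Q (x + t • nvec n g.ray)) :
    ∀ x ∈ polyCone A, Q x := by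
  refine polyCone_induction h.pointed (G := {u | ∃ g ∈ G, u = nvec n g.ray}) ?_ ?_ h0 ?_
  · rintro _ ⟨g, hg, rfl⟩
    exact ⟨h.mem g hg, nvec_ne_zero (h.pos g hg)⟩
  · intro x hx hx0
    obtain ⟨g, hg, hc⟩ := h.cover x hx hx0
    exact ⟨_, ⟨g, hg, rfl⟩, hc⟩
  · rintro x hx hQ _ ⟨g, hg, rfl⟩ t ht
    exact hadd x hx hQ g hg t ht

/-- If a functional is negative at a point of the cone, then it is negative at a generator on the
smallest face containing the point. -/
lemma IsDD.exists_neg {A : List (V n)} {G : List Gen} (h : IsDD A G) (f : V n →ₗ[ℝ] ℝ) :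
    ∀ x ∈ polyCone A, f x < 0 → ∃ g ∈ G, Covers A (nvec n g.ray) x ∧ f (nvec n g.ray) < 0 := by
  refine h.induction (fun h0 => by simp at h0) fun x hx hQ g hg t ht hf => ?_
  have hg' := smul_mem_polyCone (h.mem g hg) ht.le
  by_cases hfx : f x < 0
  · obtain ⟨g', hg', hc, hneg⟩ := hQ hfx
    exact ⟨g', hg', covers_add_left hx (smul_mem_polyCone (h.mem g hg) ht.le) hc, hneg⟩
  · refine ⟨g, hg, ?_, ?_⟩
    · rw [add_comm]
      refine covers_add_left hg' hx fun a _ h0 => ?_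
      rw [form_smul_right] at h0
      exact (mul_eq_zero.mp h0).resolve_left ht.ne'
    · rw [map_add, map_smul, smul_eq_mul] at hf
      by_contra h1
      have := mul_nonneg ht.le (not_lt.mp h1)
      linarith

lemma form_eq_above {l : ℕ × List ℕ} (hl : l.2.length ≤ n) (g : Gen) (h : 0 < above l g) :
    form (nvec n l) (nvec n g.ray) = above l g := by
  rw [form_nvec _ _ hl, above, Nat.cast_sub (by unfold above at h; omega)]
  push_cast; ring

lemma form_eq_below {l : ℕ × List ℕ} (hl : l.2.length ≤ n) (g : Gen) (h : 0 < below l g) :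
    form (nvec n l) (nvec n g.ray) = -(below l g : ℝ) := by
  rw [form_nvec _ _ hl, below, Nat.cast_sub (by unfold below at h; omega)]
  push_cast; ring

lemma comb_ray (l : ℕ × List ℕ) (p m : Gen) (h : p.ray.2.length = m.ray.2.length) :
    nvec n (comb l p m).ray =
      (below l m : ℝ) • nvec n p.ray + (above l p : ℝ) • nvec n m.ray := by
  funext i
  refine Fin.cases ?_ (fun j => ?_) i
  · simp [nvec, comb]
  · simp only [nvec, comb, Fin.cons_succ, Pi.add_apply, Pi.smul_apply, smul_eq_mul]
    by_cases hj : (j : ℕ) < p.ray.2.length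
    · have hj' : (j : ℕ) < m.ray.2.length := h ▸ hj
      simp [List.getD_eq_getElem?_getD, hj, hj']
    · have hj' : ¬ (j : ℕ) < m.ray.2.length := h ▸ hj
      simp [List.getD_eq_getElem?_getD, hj, hj']

lemma subset_insertPairs (l : ℕ × List ℕ) (ps : List (Gen × Gen)) (acc : List Gen) :
    ∀ g ∈ acc, g ∈ insertPairs l ps acc := by
  induction ps generalizing acc with
  | nil => exact fun g hg => hg
  | cons pm ps ih =>
    intro g hg
    obtain ⟨p, m⟩ := pm
    rw [insertPairs]
    cases acc.any (coversMask (2 * (p.mask &&& m.mask) + 1))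
    · exact ih _ g (List.mem_cons_of_mem _ hg)
    · exact ih _ g hg

lemma mem_insertPairs (l : ℕ × List ℕ) (ps : List (Gen × Gen)) (acc : List Gen) :
    ∀ g ∈ insertPairs l ps acc, g ∈ acc ∨ ∃ pm ∈ ps, g = comb l pm.1 pm.2 := by
  induction ps generalizing acc with
  | nil => exact fun g hg => Or.inl hg
  | cons pm ps ih =>
    intro g hg
    obtain ⟨p, m⟩ := pm
    rw [insertPairs] at hg
    cases h : acc.any (coversMask (2 * (p.mask &&& m.mask) + 1)) <;> rw [h] at hg
    · rcases ih _ g hg with h1 | ⟨pm, h1, h2⟩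
      · rcases List.mem_cons.mp h1 with rfl | h1
        · exact Or.inr ⟨(p, m), List.mem_cons_self, rfl⟩
        · exact Or.inl h1
      · exact Or.inr ⟨pm, List.mem_cons_of_mem _ h1, h2⟩
    · rcases ih _ g hg with h1 | ⟨pm, h1, h2⟩
      · exact Or.inl h1
      · exact Or.inr ⟨pm, List.mem_cons_of_mem _ h1, h2⟩

lemma insertPairs_covers (l : ℕ × List ℕ) (ps : List (Gen × Gen)) (acc : List Gen) :
    ∀ pm ∈ ps, ∃ g ∈ insertPairs l ps acc,
      coversMask (2 * (pm.1.mask &&& pm.2.mask) + 1) g = true := by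
  induction ps generalizing acc with
  | nil => simp
  | cons pm ps ih =>
    intro pm' hpm'
    obtain ⟨p, m⟩ := pm
    rw [insertPairs]
    cases h : acc.any (coversMask (2 * (p.mask &&& m.mask) + 1))
    · rcases List.mem_cons.mp hpm' with rfl | h1
      · refine ⟨comb l p m, subset_insertPairs _ _ _ _ List.mem_cons_self, ?_⟩
        simp [coversMask, comb]
      · exact ih _ pm' h1
    · rcases List.mem_cons.mp hpm' with rfl | h1
      · obtain ⟨g, hg, hc⟩ := List.any_eq_true.mp h
        exact ⟨g, subset_insertPairs _ _ _ _ hg, hc⟩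
      · exact ih _ pm' h1

lemma coversMask_testBit {J : ℕ} {u : Gen} (h : coversMask J u = true) (k : ℕ)
    (hk : J.testBit k = true) : u.mask.testBit k = true := by
  have h1 : u.mask &&& J = J := Nat.eq_of_beq_eq_true h
  rw [← h1, Nat.testBit_and, Bool.and_eq_true] at hk
  exact hk.1

lemma testBit_two_mul_add_one_succ (m k : ℕ) :
    (2 * m + 1).testBit (k + 1) = m.testBit k := by
  rw [Nat.testBit_succ]; congr 1; omega

lemma testBit_two_mul_succ (m k : ℕ) : (2 * m).testBit (k + 1) = m.testBit k := by
  rw [Nat.testBit_succ]; congr 1; omega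

lemma maskSpec_cons_zero {A : List (V n)} {l : V n} {g : Gen} (h : MaskSpec A g)
    (hl : form l (nvec n g.ray) = 0) : MaskSpec (l :: A) ⟨2 * g.mask + 1, g.ray⟩ := by
  intro k a hk
  cases k with
  | zero =>
    obtain rfl : l = a := by simpa using hk
    simp [hl]
  | succ k =>
    rw [testBit_two_mul_add_one_succ]
    exact h k a (by simpa using hk)

lemma maskSpec_cons_ne {A : List (V n)} {l : V n} {g : Gen} (h : MaskSpec A g)
    (hl : form l (nvec n g.ray) ≠ 0) : MaskSpec (l :: A) ⟨2 * g.mask, g.ray⟩ := by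
  intro k a hk
  cases k with
  | zero =>
    obtain rfl : l = a := by simpa using hk
    simp [hl]
  | succ k =>
    rw [testBit_two_mul_succ]
    exact h k a (by simpa using hk)

lemma IsDD.step {A : List (V n)} {G : List Gen} (h : IsDD A G) {l : ℕ × List ℕ}
    (hl : l.2.length ≤ n) : IsDD (nvec n l :: A) (ddStep G l) := by
  set M := G.filter fun g => Nat.blt 0 (below l g) with hM
  set P := G.filter fun g => Nat.blt 0 (above l g) with hP
  set Z := G.filter fun g => Nat.beq (tdot l.2 g.ray.2) (3 * (l.1 * g.ray.1)) with hZ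
  set ps := P.flatMap fun p => M.map fun m => (p, m) with hps
  have blt_iff : ∀ k, Nat.blt 0 k = true ↔ 0 < k := fun k => by simp [Nat.blt_eq]
  have hMm : ∀ g, g ∈ M ↔ g ∈ G ∧ 0 < below l g := fun g => by
    rw [hM, List.mem_filter, blt_iff]
  have hPm : ∀ g, g ∈ P ↔ g ∈ G ∧ 0 < above l g := fun g => by
    rw [hP, List.mem_filter, blt_iff]
  have hZm : ∀ g, g ∈ Z ↔ g ∈ G ∧ form (nvec n l) (nvec n g.ray) = 0 := fun g => by
    rw [hZ, List.mem_filter, Nat.beq_eq, form_nvec _ _ hl, sub_eq_zero]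
    norm_cast
  have hpm : ∀ pm, pm ∈ ps ↔ pm.1 ∈ P ∧ pm.2 ∈ M := fun ⟨p, m⟩ => by simp [hps]
  have hMneg : ∀ g ∈ M, form (nvec n l) (nvec n g.ray) < 0 := fun g hg => by
    have := ((hMm g).mp hg).2
    rw [form_eq_below hl g this, neg_lt_zero]
    exact_mod_cast this
  -- every new generator is of one of three kinds
  have hcases : ∀ g ∈ ddStep G l, (∃ g' ∈ M, g = ⟨2 * g'.mask, g'.ray⟩) ∨
      (∃ g' ∈ Z, g = ⟨2 * g'.mask + 1, g'.ray⟩) ∨ ∃ p ∈ P, ∃ m ∈ M, g = comb l p m := by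
    intro g hg
    rcases List.mem_append.mp hg with h1 | h1
    · obtain ⟨g', h2, h3⟩ := List.mem_map.mp h1
      exact Or.inl ⟨g', h2, h3.symm⟩
    · rcases mem_insertPairs _ _ _ g h1 with h1 | ⟨pm, h1, h2⟩
      · obtain ⟨g', h2, h3⟩ := List.mem_map.mp h1
        exact Or.inr (Or.inl ⟨g', h2, h3.symm⟩)
      · exact Or.inr (Or.inr ⟨pm.1, ((hpm pm).mp h1).1, pm.2, ((hpm pm).mp h1).2, h2⟩)
  have hcombl : ∀ p ∈ P, ∀ m ∈ M, nvec n (comb l p m).ray =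
      (below l m : ℝ) • nvec n p.ray + (above l p : ℝ) • nvec n m.ray := fun p hp m hm =>
    comb_ray l p m ((h.len p ((hPm p).mp hp).1).trans (h.len m ((hMm m).mp hm).1).symm)
  have hcomb0 : ∀ p ∈ P, ∀ m ∈ M, form (nvec n l) (nvec n (comb l p m).ray) = 0 := by
    intro p hp m hm
    rw [hcombl p hp m hm, form_add_right, form_smul_right, form_smul_right,
      form_eq_above hl p ((hPm p).mp hp).2, form_eq_below hl m ((hMm m).mp hm).2]
    ring
  have hmem : ∀ g ∈ ddStep G l, nvec n g.ray ∈ polyCone (nvec n l :: A) := by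
    intro g hg a ha
    rcases hcases g hg with ⟨g', h1, rfl⟩ | ⟨g', h1, rfl⟩ | ⟨p, hp, m, hm, rfl⟩
    · rcases List.mem_cons.mp ha with rfl | ha
      · exact (hMneg g' h1).le
      · exact h.mem g' ((hMm g').mp h1).1 a ha
    · rcases List.mem_cons.mp ha with rfl | ha
      · exact ((hZm g').mp h1).2.le
      · exact h.mem g' ((hZm g').mp h1).1 a ha
    · rcases List.mem_cons.mp ha with rfl | ha
      · exact (hcomb0 p hp m hm).le
      · rw [hcombl p hp m hm]
        exact add_mem_polyCone (smul_mem_polyCone (h.mem p ((hPm p).mp hp).1) (Nat.cast_nonneg _))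
          (smul_mem_polyCone (h.mem m ((hMm m).mp hm).1) (Nat.cast_nonneg _)) a ha
  have hmask : ∀ g ∈ ddStep G l, MaskSpec (nvec n l :: A) g := by
    intro g hg
    rcases hcases g hg with ⟨g', h1, rfl⟩ | ⟨g', h1, rfl⟩ | ⟨p, hp, m, hm, rfl⟩
    · exact maskSpec_cons_ne (h.mask g' ((hMm g').mp h1).1) (hMneg g' h1).ne
    · exact maskSpec_cons_zero (h.mask g' ((hZm g').mp h1).1) ((hZm g').mp h1).2
    · refine maskSpec_cons_zero (g := ⟨p.mask &&& m.mask, (comb l p m).ray⟩) (fun k a hk => ?_)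
        (hcomb0 p hp m hm)
      have hpG := ((hPm p).mp hp).1
      have hmG := ((hMm m).mp hm).1
      have haA : a ∈ A := List.mem_of_getElem? hk
      have h1 : (0 : ℝ) < below l m := by exact_mod_cast ((hMm m).mp hm).2
      have h2 : (0 : ℝ) < above l p := by exact_mod_cast ((hPm p).mp hp).2
      have h3 := h.mem p hpG a haA
      have h4 := h.mem m hmG a haA
      rw [Nat.testBit_and, Bool.and_eq_true, h.mask p hpG k a hk, h.mask m hmG k a hk,
        hcombl p hp m hm, form_add_right, form_smul_right, form_smul_right]
      constructor
      · rintro ⟨h5, h6⟩; rw [h5, h6]; ring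
      · intro h5
        have h6 := mul_nonpos_of_nonneg_of_nonpos h1.le h3
        have h7 := mul_nonpos_of_nonneg_of_nonpos h2.le h4
        exact ⟨(mul_eq_zero.mp (by linarith)).resolve_left h1.ne',
          (mul_eq_zero.mp (by linarith)).resolve_left h2.ne'⟩
  -- a member of the list on the smallest face containing two generators of opposite signs
  have hpair : ∀ p ∈ P, ∀ m ∈ M, ∀ x, form (nvec n l) x = 0 → Covers A (nvec n p.ray) x →
      Covers A (nvec n m.ray) x → ∃ g ∈ ddStep G l, Covers (nvec n l :: A) (nvec n g.ray) x := by
    intro p hp m hm x hx hcp hcm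
    obtain ⟨g, hg, hc⟩ := insertPairs_covers l ps (Z.map fun g => ⟨2 * g.mask + 1, g.ray⟩) (p, m)
      ((hpm (p, m)).mpr ⟨hp, hm⟩)
    have hg' : g ∈ ddStep G l := List.mem_append.mpr (Or.inr hg)
    refine ⟨g, hg', fun a ha h0 => ?_⟩
    obtain ⟨k, hk, rfl⟩ := List.getElem_of_mem ha
    have hk' := List.getElem?_eq_getElem hk
    rw [← hmask g hg' k _ hk']
    apply coversMask_testBit hc
    cases k with
    | zero => simp
    | succ k =>
      rw [List.getElem?_cons_succ] at hk'
      have haA := List.mem_of_getElem? hk'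
      rw [testBit_two_mul_add_one_succ, Nat.testBit_and, Bool.and_eq_true,
        h.mask p ((hPm p).mp hp).1 k _ hk', h.mask m ((hMm m).mp hm).1 k _ hk']
      exact ⟨hcp _ haA h0, hcm _ haA h0⟩
  refine ⟨fun x hx => h.pointed x fun a ha => hx a (List.mem_cons_of_mem _ ha), hmem, ?_, ?_,
    hmask, ?_⟩
  · intro g hg
    rcases hcases g hg with ⟨g', h1, rfl⟩ | ⟨g', h1, rfl⟩ | ⟨p, hp, m, hm, rfl⟩
    · exact h.pos g' ((hMm g').mp h1).1
    · exact h.pos g' ((hZm g').mp h1).1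
    · have := Nat.mul_pos ((hMm m).mp hm).2 (h.pos p ((hPm p).mp hp).1)
      simp only [comb]; omega
  · intro g hg
    rcases hcases g hg with ⟨g', h1, rfl⟩ | ⟨g', h1, rfl⟩ | ⟨p, hp, m, hm, rfl⟩
    · exact h.len g' ((hMm g').mp h1).1
    · exact h.len g' ((hZm g').mp h1).1
    · simp [comb, h.len p ((hPm p).mp hp).1, h.len m ((hMm m).mp hm).1]
  · intro x hx hx0
    have hxA : x ∈ polyCone A := fun a ha => hx a (List.mem_cons_of_mem _ ha)
    have hxl : form (nvec n l) x ≤ 0 := hx _ List.mem_cons_self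
    rcases hxl.lt_or_eq with hneg | hzero
    · obtain ⟨g, hg, hc, hgneg⟩ := h.exists_neg (formL (nvec n l)) x hxA hneg
      have hgM : g ∈ M := by
        refine (hMm g).mpr ⟨hg, ?_⟩
        change form _ _ < 0 at hgneg
        rw [form_nvec _ _ hl, sub_neg] at hgneg
        have : tdot l.2 g.ray.2 < 3 * (l.1 * g.ray.1) := by exact_mod_cast hgneg
        unfold below; omega
      refine ⟨⟨2 * g.mask, g.ray⟩, List.mem_append.mpr (Or.inl (List.mem_map.mpr ⟨g, hgM, rfl⟩)),
        fun a ha h0 => ?_⟩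
      rcases List.mem_cons.mp ha with rfl | ha
      · exact absurd h0 hneg.ne
      · exact hc a ha h0
    · have hsub : ∀ g ∈ G, Covers A (nvec n g.ray) x → ∃ t : ℝ, 0 < t ∧
          x - t • nvec n g.ray ∈ polyCone A ∧ ∀ u, Covers A u (x - t • nvec n g.ray) →
            Covers A u x := by
        intro g hg hc
        obtain ⟨t, ht, hm, -⟩ := exists_sub_smul_mem h.pointed hxA (h.mem g hg)
          (nvec_ne_zero (h.pos g hg)) hc
        refine ⟨t, ht, hm, fun u hu => ?_⟩
        have := covers_add_left hm (smul_mem_polyCone (h.mem g hg) ht.le) hu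
        rwa [sub_add_cancel] at this
      have habove : ∀ g ∈ G, 0 < form (nvec n l) (nvec n g.ray) → g ∈ P := fun g hg hpos => by
        refine (hPm g).mpr ⟨hg, ?_⟩
        rw [form_nvec _ _ hl, sub_pos] at hpos
        have : 3 * (l.1 * g.ray.1) < tdot l.2 g.ray.2 := by exact_mod_cast hpos
        unfold above; omega
      have hbelow : ∀ g ∈ G, form (nvec n l) (nvec n g.ray) < 0 → g ∈ M := fun g hg hneg => by
        refine (hMm g).mpr ⟨hg, ?_⟩
        rw [form_nvec _ _ hl, sub_neg] at hneg
        have : tdot l.2 g.ray.2 < 3 * (l.1 * g.ray.1) := by exact_mod_cast hneg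
        unfold below; omega
      obtain ⟨g, hg, hc⟩ := h.cover x hxA hx0
      obtain ⟨t, ht, hm, hcov⟩ := hsub g hg hc
      rcases lt_trichotomy (form (nvec n l) (nvec n g.ray)) 0 with hs | hs | hs
      · obtain ⟨g', hg', hc', hneg'⟩ := h.exists_neg (-formL (nvec n l)) _ hm (by
          change -form _ _ < 0
          rw [form_sub_right, form_smul_right, hzero]
          have := mul_neg_of_pos_of_neg ht hs
          linarith)
        change -form _ _ < 0 at hneg'
        exact hpair g' (habove g' hg' (by linarith)) g (hbelow g hg hs) x hzero (hcov _ hc') hc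
      · refine ⟨⟨2 * g.mask + 1, g.ray⟩, List.mem_append.mpr (Or.inr
          (subset_insertPairs _ _ _ _ (List.mem_map.mpr ⟨g, (hZm g).mpr ⟨hg, hs⟩, rfl⟩))),
          fun a ha h0 => ?_⟩
        rcases List.mem_cons.mp ha with rfl | ha
        · exact hs
        · exact hc a ha h0
      · obtain ⟨g', hg', hc', hneg'⟩ := h.exists_neg (formL (nvec n l)) _ hm (by
          change form _ _ < 0
          rw [form_sub_right, form_smul_right, hzero]
          have := mul_pos ht hs
          linarith)
        exact hpair g (habove g hg hs) g' (hbelow g' hg' hneg') x hzero hc (hcov _ hc')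

end DoubleDescription

/-! ### Roots -/

section Roots

variable {n : ℕ}

/-- A root: an integral vector `r` of square `1`, `2` or `6` such that the reflection in the
hyperplane orthogonal to `r` preserves the lattice. -/
def IsRoot (r : V n) : Prop :=
  r ∈ lattice n ∧ (form r r = 1 ∨ form r r = 2 ∨ form r r = 6) ∧
    ∀ y ∈ lattice n, ∃ m : ℤ, 2 * form r y = m * form r r

lemma lattice_add {x y : V n} (hx : x ∈ lattice n) (hy : y ∈ lattice n) : x + y ∈ lattice n :=
  fun i => by
    obtain ⟨a, ha⟩ := hx i
    obtain ⟨b, hb⟩ := hy i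
    exact ⟨a + b, by rw [Pi.add_apply, ha, hb]; push_cast; rfl⟩

lemma lattice_smul {x : V n} (hx : x ∈ lattice n) (m : ℤ) : (m : ℝ) • x ∈ lattice n :=
  fun i => by
    obtain ⟨a, ha⟩ := hx i
    exact ⟨m * a, by rw [Pi.smul_apply, ha, smul_eq_mul]; push_cast; rfl⟩

lemma lattice_neg {x : V n} (hx : x ∈ lattice n) : -x ∈ lattice n := by
  simpa using lattice_smul hx (-1)

lemma lattice_sub {x y : V n} (hx : x ∈ lattice n) (hy : y ∈ lattice n) : x - y ∈ lattice n := by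
  rw [sub_eq_add_neg]; exact lattice_add hx (lattice_neg hy)

lemma single_mem_lattice (i : Fin (n + 1)) : (Pi.single i 1 : V n) ∈ lattice n := fun j => by
  by_cases h : j = i
  · subst h; exact ⟨1, by simp⟩
  · exact ⟨0, by simp [h]⟩

lemma form_mem_int {x y : V n} (hx : x ∈ lattice n) (hy : y ∈ lattice n) :
    ∃ m : ℤ, form x y = m := by
  choose a ha using hx
  choose b hb using hy
  refine ⟨-3 * (a 0 * b 0) + ∑ i : Fin n, a i.succ * b i.succ, ?_⟩
  simp only [form, ha, hb]
  push_cast; rfl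

lemma form_single_zero (r : V n) : form r (Pi.single 0 1) = -3 * r 0 := by simp [form]

lemma form_single_succ (r : V n) (i : Fin n) : form r (Pi.single i.succ 1) = r i.succ := by
  simp [form, Pi.single_apply, Fin.succ_inj]

namespace IsRoot

lemma pos {r : V n} (h : IsRoot r) : 0 < form r r := by
  rcases h.2.1 with h | h | h <;> rw [h] <;> norm_num

lemma neg {r : V n} (h : IsRoot r) : IsRoot (-r) := by
  have e : form (-r) (-r) = form r r := by rw [form_neg_left, form_neg_right, neg_neg]
  refine ⟨lattice_neg h.1, by rw [e]; exact h.2.1, fun y hy => ?_⟩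
  obtain ⟨m, hm⟩ := h.2.2 y hy
  exact ⟨-m, by rw [e, form_neg_left]; push_cast; linarith⟩

lemma map {g : V n ≃ₗ[ℝ] V n} (hg : g ∈ Theta n) {r : V n} (h : IsRoot r) : IsRoot (g r) := by
  have e : form (g r) (g r) = form r r := Isom_form hg.1 r r
  refine ⟨(hg.2 r).mpr h.1, by rw [e]; exact h.2.1, fun y hy => ?_⟩
  obtain ⟨m, hm⟩ := h.2.2 (g⁻¹ y) (((inv_mem hg : g⁻¹ ∈ Theta n).2 y).mpr hy)
  exact ⟨m, by rw [e, Isom_form_left hg.1, hm]⟩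

lemma refl_mem_Theta {r : V n} (h : IsRoot r) : refl r ∈ Theta n := by
  have key : ∀ v ∈ lattice n, refl r v ∈ lattice n := fun v hv => by
    obtain ⟨m, hm⟩ := h.2.2 v hv
    rw [refl_apply, hm, mul_div_assoc, div_self h.pos.ne', mul_one]
    exact lattice_sub hv (lattice_smul h.1 m)
  refine ⟨refl_mem_Isom h.pos, fun v => ⟨fun hv => ?_, key v⟩⟩
  have := key _ hv
  rwa [show refl r (refl r v) = v from (refl r).symm_apply_apply v] at this

lemma refl_mem_Gam {r : V n} (h : IsRoot r) : refl r ∈ Gam n :=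
  Subgroup.subset_closure ⟨h.refl_mem_Theta, r, isReflectionIn_refl h.pos⟩

/-- The coordinates other than `x_0` of a root of square `6` are divisible by `3`. -/
lemma three_dvd {r : V n} (h : IsRoot r) (h6 : form r r = 6) (i : Fin n) :
    ∃ m : ℤ, r i.succ = 3 * m := by
  obtain ⟨m, hm⟩ := h.2.2 _ (single_mem_lattice i.succ)
  rw [form_single_succ, h6] at hm
  exact ⟨m, by linarith⟩

end IsRoot

lemma isRoot_of_three_dvd {r : V n} (hl : r ∈ lattice n)
    (h : form r r = 1 ∨ form r r = 2 ∨ form r r = 6)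
    (h3 : form r r = 6 → ∀ i : Fin n, ∃ m : ℤ, r i.succ = 3 * m) : IsRoot r := by
  refine ⟨hl, h, fun y hy => ?_⟩
  obtain ⟨m, hm⟩ := form_mem_int hl hy
  rcases h with h | h | h
  · exact ⟨2 * m, by rw [h, hm]; push_cast; ring⟩
  · exact ⟨m, by rw [h, hm]; ring⟩
  · choose a ha using h3 h
    choose b hb using hy
    obtain ⟨c, hc⟩ := hl 0
    refine ⟨-(c * b 0) + ∑ i : Fin n, a i * b i.succ, ?_⟩
    rw [h]
    simp only [form, ha, hb, hc]
    push_cast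
    rw [mul_add, add_mul, Finset.mul_sum, Finset.sum_mul]
    congr 1
    · ring
    · exact Finset.sum_congr rfl fun i _ => by ring

/-- Every reflection in `Θ_n` is the reflection in a root: a primitive integral vector on its
axis. -/
lemma exists_root_of_reflection {g : V n ≃ₗ[ℝ] V n} (hg : g ∈ Theta n) {e : V n}
    (he : IsReflectionIn g e) : ∃ z : V n, IsRoot z ∧ ∃ c : ℝ, c ≠ 0 ∧ e = c • z := by
  classical
  have he0 : e ≠ 0 := by rintro rfl; simpa using he.1
  obtain ⟨i₀, hi₀⟩ := Function.ne_iff.mp he0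
  change e i₀ ≠ 0 at hi₀
  have hsub : ∀ y ∈ lattice n, (2 * form e y / form e e) • e ∈ lattice n := fun y hy => by
    have := lattice_sub hy ((hg.2 y).mpr hy)
    rwa [he.2, sub_sub_cancel] at this
  -- some nonzero multiple of `e` is integral
  have hex : ∃ k : ℕ, ∃ t : ℝ, t ≠ 0 ∧ t • e ∈ lattice n ∧ |t * e i₀| = k := by
    have : ∃ j, form e (Pi.single j 1) ≠ 0 := by
      by_contra hcon
      push Not at hcon
      apply he0
      funext i
      refine Fin.cases ?_ (fun j => ?_) i
      · have := hcon 0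
        rw [form_single_zero] at this
        simpa using this
      · have := hcon j.succ
        rwa [form_single_succ] at this
    obtain ⟨j, hj⟩ := this
    have hl := hsub _ (single_mem_lattice j)
    obtain ⟨m, hm⟩ := hl i₀
    refine ⟨m.natAbs, _, div_ne_zero (mul_ne_zero two_ne_zero hj) he.1.ne', hl, ?_⟩
    rw [Pi.smul_apply, smul_eq_mul] at hm
    rw [hm, Nat.cast_natAbs, Int.cast_abs]
  obtain ⟨t, ht, htl, htk⟩ := Nat.find_spec hex
  set k := Nat.find hex with hk
  -- by minimality, the integral vectors on the axis are the integral multiples of `t • e`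
  have hline : ∀ s : ℝ, s • e ∈ lattice n → ∃ m : ℤ, s = m * t := by
    intro s hs
    refine ⟨⌊s / t⌋, ?_⟩
    by_contra hne
    have h1 : (s - ⌊s / t⌋ * t) • e ∈ lattice n := by
      rw [sub_smul, mul_smul]; exact lattice_sub hs (lattice_smul htl _)
    obtain ⟨m, hm⟩ := h1 i₀
    rw [Pi.smul_apply, smul_eq_mul] at hm
    have h2 : k ≤ m.natAbs := Nat.find_le ⟨_, sub_ne_zero.mpr hne, h1, by
      rw [hm, Nat.cast_natAbs, Int.cast_abs]⟩
    have h3 : |(s - ⌊s / t⌋ * t) * e i₀| < |t * e i₀| := by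
      have : (s - ⌊s / t⌋ * t) = Int.fract (s / t) * t := by
        rw [Int.fract, sub_mul, div_mul_cancel₀ _ ht]
      rw [this, mul_assoc, abs_mul, abs_of_nonneg (Int.fract_nonneg _)]
      exact mul_lt_of_lt_one_left (abs_pos.mpr (mul_ne_zero ht hi₀)) (Int.fract_lt_one _)
    rw [hm, htk, ← Int.cast_abs, ← Nat.cast_natAbs] at h3
    have : m.natAbs < k := by exact_mod_cast h3
    omega
  set z := t • e with hz
  have hzz : form z z = t * t * form e e := by
    rw [hz, form_smul_left, form_smul_right]; ring
  have hzpos : 0 < form z z := by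
    rw [hzz]; exact mul_pos (mul_self_pos.mpr ht) he.1
  have hcrys : ∀ y ∈ lattice n, ∃ m : ℤ, 2 * form z y = m * form z z := fun y hy => by
    obtain ⟨m, hm⟩ := hline _ (hsub y hy)
    refine ⟨m, ?_⟩
    rw [hzz, hz, form_smul_left]
    have : 2 * form e y = m * t * form e e := by rw [← hm]; field_simp [he.1.ne']
    linear_combination t * this
  obtain ⟨N, hN⟩ := form_mem_int htl htl
  -- the vector `(6 / (z, z)) z` is integral, so that `(z, z)` divides `6`
  have h6 : ∃ m : ℤ, (6 : ℝ) = m * form z z := by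
    have : (6 / form z z) • z ∈ lattice n := fun i => by
      refine Fin.cases ?_ (fun j => ?_) i
      · obtain ⟨m, hm⟩ := hcrys _ (single_mem_lattice 0)
        rw [form_single_zero] at hm
        refine ⟨-m, ?_⟩
        rw [Pi.smul_apply, smul_eq_mul]
        push_cast
        field_simp
        linarith
      · obtain ⟨m, hm⟩ := hcrys _ (single_mem_lattice j.succ)
        rw [form_single_succ] at hm
        refine ⟨3 * m, ?_⟩
        rw [Pi.smul_apply, smul_eq_mul]
        push_cast
        field_simp
        linarith
    rw [hz, smul_smul] at this
    obtain ⟨m, hm⟩ := hline _ this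
    refine ⟨m, ?_⟩
    have := mul_right_cancel₀ ht hm
    rw [← hz] at this
    rw [← this, div_mul_cancel₀ _ hzpos.ne']
  obtain ⟨m, hm⟩ := h6
  have hNpos : 0 < N := by rw [hN] at hzpos; exact_mod_cast hzpos
  have hmN : m * N = 6 := by rw [hN] at hm; exact_mod_cast hm.symm
  have hdvd : N ∣ 6 := ⟨m, by rw [← hmN, mul_comm]⟩
  have hNle : N ≤ 6 := Int.le_of_dvd (by norm_num) hdvd
  refine ⟨z, ⟨htl, ?_, hcrys⟩, t⁻¹, inv_ne_zero ht, ?_⟩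
  · have h3 : N ≠ 3 := by
      rintro rfl
      have hd : ∀ j : Fin n, ∃ a : ℤ, z j.succ = 3 * a := fun j => by
        obtain ⟨a, ha⟩ := hcrys _ (single_mem_lattice j.succ)
        obtain ⟨b, hb⟩ := htl j.succ
        rw [form_single_succ, hN, hb] at ha
        have ha' : 2 * b = a * 3 := by exact_mod_cast ha
        exact ⟨b - a, by rw [hb]; push_cast; have : (2 * b : ℝ) = a * 3 := by exact_mod_cast ha'
                         linarith⟩
      choose a ha using hd
      obtain ⟨b, hb⟩ := htl 0
      rw [form_self, hb] at hN
      simp only [ha] at hN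
      have : -3 * b ^ 2 + ∑ i : Fin n, (3 * a i) ^ 2 = 3 := by exact_mod_cast hN
      have h9 : ∑ i : Fin n, (3 * a i) ^ 2 = 9 * ∑ i : Fin n, a i ^ 2 := by
        rw [Finset.mul_sum]; exact Finset.sum_congr rfl fun i _ => by ring
      rw [h9] at this
      have hb2 : b ^ 2 = 3 * (∑ i : Fin n, a i ^ 2) - 1 := by linarith
      have hmod : b ^ 2 % 3 = 2 := by omega
      rcases (by omega : b % 3 = 0 ∨ b % 3 = 1 ∨ b % 3 = 2) with h | h | h <;>
        simp [pow_two, Int.mul_emod, h] at hmod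
    rw [hN]
    interval_cases N
    · left; norm_num
    · right; left; norm_num
    · exact absurd rfl h3
    · omega
    · omega
    · right; right; norm_num
  · rw [hz, smul_smul, inv_mul_cancel₀ ht, one_smul]

end Roots

/-! ### The chamber of the stabilizer of the base point -/

section Chamber

variable {n : ℕ}

/-- The chamber `x_1 ≥ x_2 ≥ ⋯ ≥ x_n ≥ 0` of the group of permutations and sign changes of the
coordinates `x_1, …, x_n`. -/
def chamber (n : ℕ) : Set (V n) :=
  {x | Antitone (fun i : Fin n => x i.succ) ∧ ∀ i : Fin n, 0 ≤ x i.succ}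

/-- A root orthogonal to the base point `(1, 0, …, 0)` does not change sign on the chamber. -/
lemma IsRoot.sign_of_zero {r : V n} (h : IsRoot r) (h0 : r 0 = 0) :
    (∀ x ∈ chamber n, form r x ≤ 0) ∨ ∀ x ∈ chamber n, 0 ≤ form r x := by
  classical
  have hl := h.1
  choose z hz using hl
  have hform : ∀ x : V n, form r x = ∑ i : Fin n, (z i.succ : ℝ) * x i.succ := fun x => by
    simp [form, h0, hz]
  have hsum : ∑ i : Fin n, z i.succ ^ 2 = 1 ∨ ∑ i : Fin n, z i.succ ^ 2 = 2 := by
    have hs : form r r = ((∑ i : Fin n, z i.succ ^ 2 : ℤ) : ℝ) := by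
      rw [form_self, h0]; simp only [hz]; push_cast; ring
    rcases h.2.1 with h' | h' | h'
    · left; rw [h'] at hs; exact_mod_cast hs.symm
    · right; rw [h'] at hs; exact_mod_cast hs.symm
    · exfalso
      choose a ha using h.three_dvd h'
      have : ∀ i : Fin n, z i.succ = 3 * a i := fun i => by
        have := ha i; rw [hz] at this; exact_mod_cast this
      rw [h'] at hs
      have hs' : (6 : ℤ) = ∑ i : Fin n, z i.succ ^ 2 := by exact_mod_cast hs
      have h9 : ∑ i : Fin n, z i.succ ^ 2 = 9 * ∑ i : Fin n, a i ^ 2 := by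
        rw [Finset.mul_sum]; exact Finset.sum_congr rfl fun i _ => by rw [this]; ring
      omega
  obtain ⟨i, hi⟩ : ∃ i : Fin n, z i.succ ≠ 0 := by
    by_contra hcon
    push Not at hcon
    simp [hcon] at hsum
  have hi1 : 1 ≤ z i.succ ^ 2 := by have := sq_pos_of_ne_zero hi; omega
  have hsplit : ∀ f : Fin n → ℤ, ∑ j, f j = f i + ∑ j ∈ Finset.univ.erase i, f j := fun f =>
    (Finset.add_sum_erase _ _ (Finset.mem_univ i)).symm
  have hsplit' : ∀ f : Fin n → ℝ, ∑ j, f j = f i + ∑ j ∈ Finset.univ.erase i, f j := fun f =>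
    (Finset.add_sum_erase _ _ (Finset.mem_univ i)).symm
  rw [hsplit] at hsum
  by_cases hall : ∀ j ∈ Finset.univ.erase i, z j.succ = 0
  · have hf : ∀ x : V n, form r x = z i.succ * x i.succ := fun x => by
      rw [hform, hsplit', Finset.sum_eq_zero fun j hj => by simp [hall j hj], add_zero]
    rcases lt_or_gt_of_ne hi with hs | hs
    · left; intro x hx; rw [hf]
      exact mul_nonpos_of_nonpos_of_nonneg (by exact_mod_cast hs.le) (hx.2 i)
    · right; intro x hx; rw [hf]
      exact mul_nonneg (by exact_mod_cast hs.le) (hx.2 i)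
  · push Not at hall
    obtain ⟨j, hj, hjz⟩ := hall
    have hj1 : 1 ≤ z j.succ ^ 2 := by have := sq_pos_of_ne_zero hjz; omega
    rw [← Finset.add_sum_erase _ _ hj] at hsum
    have hrest : 0 ≤ ∑ k ∈ (Finset.univ.erase i).erase j, z k.succ ^ 2 :=
      Finset.sum_nonneg fun k _ => sq_nonneg _
    have hrest0 : ∑ k ∈ (Finset.univ.erase i).erase j, z k.succ ^ 2 = 0 := by omega
    rw [Finset.sum_eq_zero_iff_of_nonneg fun k _ => sq_nonneg _] at hrest0
    have hzi : z i.succ = 1 ∨ z i.succ = -1 := mul_self_eq_one_iff.mp (by rw [← sq]; omega)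
    have hzj : z j.succ = 1 ∨ z j.succ = -1 := mul_self_eq_one_iff.mp (by rw [← sq]; omega)
    have hf : ∀ x : V n, form r x = z i.succ * x i.succ + z j.succ * x j.succ := fun x => by
      rw [hform, hsplit', ← Finset.add_sum_erase _ _ hj, Finset.sum_eq_zero fun k hk => by
        have := hrest0 k hk
        rw [sq_eq_zero_iff] at this
        simp [this], add_zero]
    simp only [hf]
    -- the sign of the coordinate with the smaller index decides
    rcases le_total i j with hij | hij
    · rcases hzi with h1 | h1
      · right; intro x hx
        have := hx.1 hij
        have := hx.2 j
        simp only at *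
        rcases hzj with h2 | h2 <;> rw [h1, h2] <;> push_cast <;> linarith
      · left; intro x hx
        have := hx.1 hij
        have := hx.2 j
        simp only at *
        rcases hzj with h2 | h2 <;> rw [h1, h2] <;> push_cast <;> linarith
    · rcases hzj with h1 | h1
      · right; intro x hx
        have := hx.1 hij
        have := hx.2 i
        simp only at *
        rcases hzi with h2 | h2 <;> rw [h1, h2] <;> push_cast <;> linarith
      · left; intro x hx
        have := hx.1 hij
        have := hx.2 i
        simp only at *
        rcases hzi with h2 | h2 <;> rw [h1, h2] <;> push_cast <;> linarith

/-- Every root can be moved into the chamber by permutations and sign changes of the coordinates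
`x_1, …, x_n`; by the rearrangement inequality this does not decrease its scalar products with the
vectors of the chamber. -/
lemma IsRoot.exists_sorted {r : V n} (h : IsRoot r) : ∃ r' : V n, IsRoot r' ∧ r' 0 = r 0 ∧
    r' ∈ chamber n ∧ form r' r' = form r r ∧ ∀ x ∈ chamber n, form r x ≤ form r' x := by
  set f : Fin n → ℝ := fun i => -|r i.succ| with hf
  set σ := Tuple.sort f with hσ
  have hmono : Monotone (f ∘ σ) := Tuple.monotone_sort f
  set r' : V n := Fin.cons (r 0) fun i => |r (σ i).succ| with hr'
  have hnorm : form r' r' = form r r := by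
    rw [form_self, form_self]
    simp only [hr', Fin.cons_zero, Fin.cons_succ, sq_abs]
    rw [Equiv.sum_comp σ fun i => r i.succ ^ 2]
  have hanti : Antitone fun i : Fin n => r' i.succ := fun i j hij => by
    have := hmono hij
    simp only [hf, Function.comp, neg_le_neg_iff] at this
    simpa [hr'] using this
  refine ⟨r', isRoot_of_three_dvd (fun i => ?_) (by rw [hnorm]; exact h.2.1) (fun h6 i => ?_), rfl,
    ⟨hanti, fun i => by simp [hr']⟩, hnorm, fun x hx => ?_⟩
  · refine Fin.cases ?_ (fun j => ?_) i
    · exact h.1 0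
    · obtain ⟨m, hm⟩ := h.1 (σ j).succ
      exact ⟨|m|, by simp [hr', hm]⟩
  · obtain ⟨m, hm⟩ := h.three_dvd (hnorm ▸ h6) (σ i)
    exact ⟨|m|, by simp [hr', hm, abs_mul]⟩
  · have hmv : Monovary (fun i : Fin n => x i.succ) fun i : Fin n => r' i.succ :=
      hx.1.monovary hanti
    have := hmv.sum_mul_comp_perm_le_sum_mul (σ := σ⁻¹)
    simp only [form, hr', Fin.cons_zero, Fin.cons_succ] at this ⊢
    have h1 : ∑ i : Fin n, r i.succ * x i.succ ≤
        ∑ i : Fin n, x i.succ * |r (σ (σ⁻¹ i)).succ| := Finset.sum_le_sum fun i _ => by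
      rw [show σ (σ⁻¹ i) = i from σ.apply_symm_apply i, mul_comm (x i.succ)]
      exact mul_le_mul_of_nonneg_right (le_abs_self _) (hx.2 i)
    have h2 : ∑ i : Fin n, x i.succ * |r (σ i).succ| = ∑ i : Fin n, |r (σ i).succ| * x i.succ :=
      Finset.sum_congr rfl fun i _ => mul_comm _ _
    linarith

end Chamber

/-! ### The simple roots -/

/-- The list `t`, padded with zeros to the length `n`. -/
def padTo (n : ℕ) (t : List ℕ) : List ℕ := t ++ List.replicate (n - t.length) 0

/-- The simple root `(1, 3, 0, …, 0)`. -/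
def firstExtra (n : ℕ) : ℕ × List ℕ := (1, padTo n [3])

/-- The simple roots not orthogonal to the base point `(1, 0, …, 0)`, apart from the first one. -/
def extraTail (n : ℕ) : List (ℕ × List ℕ) :=
  ((if n = 4 then [(1, [1, 1, 1, 1])] else []) ++
  (if 5 ≤ n then [(1, List.replicate 5 1)] else []) ++
  (if n = 10 then [(2, 2 :: List.replicate 9 1)] else []) ++
  (if 11 ≤ n then [(2, 2 :: List.replicate 10 1)] else []) ++
  (if 13 ≤ n then [(2, List.replicate 13 1)] else []) ++
  (if 9 ≤ n then [(5, List.replicate 9 3)] else []) ++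
  (if 12 ≤ n then [(3, [3, 3] ++ List.replicate (n - 2) 1)] else []) ++
  (if 13 ≤ n then [(8, [6, 6, 6] ++ List.replicate 10 3)] else []) ++
  (if 12 ≤ n then [(5, List.replicate 8 3 ++ List.replicate (n - 8) 1)] else []) ++
  (if 13 ≤ n then [(10, List.replicate 7 6 ++ List.replicate 6 3)] else [])).map
    fun l : ℕ × List ℕ => (l.1, padTo n l.2)

/-- The simple roots not orthogonal to the base point `(1, 0, …, 0)`. -/
def extraRoots (n : ℕ) : List (ℕ × List ℕ) := firstExtra n :: extraTail n

/-- The fundamental cone: the part of the chamber on the negative side of the simple roots not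
orthogonal to the base point. -/
def fundCone (n : ℕ) : Set (V n) :=
  {x | x ∈ chamber n ∧ ∀ e ∈ extraRoots n, form (nvec n e) x ≤ 0}

/-- The square of a vector of nonnegative square. -/
def sqNorm (e : ℕ × List ℕ) : ℕ := tdot e.2 e.2 - 3 * (e.1 * e.1)

/-- The nonincreasing lists of `m` natural numbers which are at most `mx` and have sum of
squares `s`. -/
def sqReps : ℕ → ℕ → ℕ → List (List ℕ)
  | 0, s, _ => if s = 0 then [[]] else []
  | m + 1, s, mx => (List.range (mx + 1)).flatMap fun k =>
      bif Nat.ble (k * k) s && Nat.ble s ((m + 1) * (k * k)) then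
        (sqReps m (s - k * k) k).map (k :: ·) else []

lemma tdot_self_le (t : List ℕ) (k : ℕ) (h : ∀ a ∈ t, a ≤ k) : tdot t t ≤ t.length * (k * k) := by
  induction t with
  | nil => simp [tdot]
  | cons a t ih =>
    have h1 := ih fun b hb => h b (List.mem_cons_of_mem _ hb)
    have h2 := h a List.mem_cons_self
    have h3 := Nat.mul_le_mul h2 h2
    simp only [tdot, List.length_cons]
    rw [add_mul, one_mul]
    omega

lemma mem_sqReps (t : List ℕ) (mx : ℕ) (hs : t.Pairwise (· ≥ ·)) (hmx : ∀ a ∈ t, a ≤ mx) :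
    t ∈ sqReps t.length (tdot t t) mx := by
  induction t generalizing mx with
  | nil => simp [sqReps, tdot]
  | cons a t ih =>
    rw [List.pairwise_cons] at hs
    have h1 := tdot_self_le t a hs.1
    rw [List.length_cons, sqReps, List.mem_flatMap]
    refine ⟨a, List.mem_range.mpr (Nat.lt_succ_of_le (hmx a List.mem_cons_self)), ?_⟩
    have h2 : (Nat.ble (a * a) (tdot (a :: t) (a :: t)) &&
        Nat.ble (tdot (a :: t) (a :: t)) ((t.length + 1) * (a * a))) = true := by
      rw [Bool.and_eq_true, Nat.ble_eq, Nat.ble_eq, tdot, add_mul, one_mul]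
      omega
    rw [h2, cond_true, List.mem_map]
    refine ⟨t, ?_, rfl⟩
    rw [tdot, Nat.add_sub_cancel_left]
    exact ih a hs.2 hs.1

lemma le_of_tdot_self_le (t : List ℕ) (k : ℕ) (h : tdot t t ≤ k * k) : ∀ a ∈ t, a ≤ k := by
  induction t with
  | nil => simp
  | cons b t ih =>
    intro a ha
    rw [tdot] at h
    rcases List.mem_cons.mp ha with rfl | ha
    · exact Nat.mul_self_le_mul_self_iff.mp (by omega)
    · exact ih (by omega) a ha

/-- The tails of the roots of square `ε` in the chamber with first coordinate `k`. -/
def sortedTails (n ε k : ℕ) : List (List ℕ) :=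
  bif Nat.beq ε 6 then
    bif Nat.beq ((k * k + 2) % 3) 0 then (sqReps n ((k * k + 2) / 3) k).map (List.map (3 * ·))
    else []
  else sqReps n (3 * (k * k) + ε) (3 * k)

lemma tdot_three_mul (t : List ℕ) :
    tdot (t.map (3 * ·)) (t.map (3 * ·)) = 9 * tdot t t := by
  induction t with
  | nil => simp [tdot]
  | cons a t ih => simp only [List.map_cons, tdot, ih]; ring

lemma mem_sortedTails {ε k : ℕ} (hk : 0 < k) {t : List ℕ} (hs : t.Pairwise (· ≥ ·))
    (hε : ε = 1 ∨ ε = 2 ∨ ε = 6 ∧ ∀ a ∈ t, 3 ∣ a) (ht : tdot t t = 3 * (k * k) + ε) :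
    t ∈ sortedTails t.length ε k := by
  have hkk : 1 ≤ k * k := Nat.mul_pos hk hk
  have aux : ε ≠ 6 → ε ≤ 6 → t ∈ sortedTails t.length ε k := fun h h' => by
    have hb : Nat.beq ε 6 = false := by rw [Bool.eq_false_iff, ne_eq, Nat.beq_eq]; exact h
    rw [sortedTails, hb, cond_false, ← ht]
    refine mem_sqReps t _ hs (le_of_tdot_self_le t _ ?_)
    rw [ht]
    have : 3 * k * (3 * k) = 9 * (k * k) := by ring
    omega
  rcases hε with rfl | rfl | ⟨rfl, h3⟩
  · exact aux (by norm_num) (by norm_num)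
  · exact aux (by norm_num) (by norm_num)
  · obtain ⟨u, hu⟩ : ∃ u : List ℕ, t = u.map (3 * ·) :=
      ⟨t.map (· / 3), by
        rw [List.map_map]
        exact ((List.map_congr_left fun a ha => Nat.mul_div_cancel' (h3 a ha)).trans
          (List.map_id t)).symm⟩
    have hsq : tdot t t = 9 * tdot u u := by rw [hu, tdot_three_mul]
    have hsu : u.Pairwise (· ≥ ·) := by
      rw [hu, List.pairwise_map] at hs
      exact hs.imp fun h => by simpa using h
    have hlen : t.length = u.length := by rw [hu, List.length_map]
    have hmod : Nat.beq ((k * k + 2) % 3) 0 = true := by rw [Nat.beq_eq]; omega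
    have hdiv : (k * k + 2) / 3 = tdot u u := by omega
    rw [sortedTails, show Nat.beq 6 6 = true from rfl, cond_true, hmod, cond_true, hdiv, hlen, hu]
    exact List.mem_map_of_mem (mem_sqReps u k hsu (le_of_tdot_self_le u k (by omega)))

/-- The simple roots in `extraRoots` are roots in the chamber.  The last condition ensures that a root
whose mirror is at most as far from the base point has first coordinate less than `13`. -/
def extraCheck (n : ℕ) : Bool :=
  (extraRoots n).all fun e => Nat.blt 0 e.1 && Nat.beq e.2.length n &&
    decide (e.2.Pairwise (· ≥ ·)) &&
    (Nat.beq (sqNorm e) 1 || Nat.beq (sqNorm e) 2 ||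
      (Nat.beq (sqNorm e) 6 && e.2.all fun a => Nat.beq (a % 3) 0)) &&
    Nat.blt (e.1 * e.1 * 6) (169 * sqNorm e)

/-- The order condition of Vinberg's algorithm: a root in the chamber whose mirror is at most as
far from the base point as the mirror of a simple root `e ∈ extraRoots n` either is `e`
or has nonpositive scalar product with `e`. -/
def orderCheck (n : ℕ) : Bool :=
  [1, 2, 6].all fun ε => (List.range 12).all fun k =>
    let E := (extraRoots n).filter fun e =>
      Nat.ble ((k + 1) * (k + 1) * sqNorm e) (e.1 * e.1 * ε)
    E.isEmpty || (sortedTails n ε (k + 1)).all fun t => E.all fun e =>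
      decide (e = (k + 1, t)) || Nat.ble (tdot e.2 t) (3 * (e.1 * (k + 1)))

section Order

variable {n : ℕ}

lemma extraCheck_spec (h : extraCheck n = true) {e : ℕ × List ℕ} (he : e ∈ extraRoots n) :
    0 < e.1 ∧ e.2.length = n ∧ e.2.Pairwise (· ≥ ·) ∧
      (sqNorm e = 1 ∨ sqNorm e = 2 ∨ sqNorm e = 6 ∧ ∀ a ∈ e.2, 3 ∣ a) ∧
      e.1 * e.1 * 6 < 169 * sqNorm e := by
  have := List.all_eq_true.mp h e he
  simp only [Bool.and_eq_true, Bool.or_eq_true, Nat.beq_eq, Nat.blt_eq, decide_eq_true_eq,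
    List.all_eq_true] at this
  obtain ⟨⟨⟨⟨h1, h2⟩, h3⟩, h4⟩, h5⟩ := this
  refine ⟨h1, h2, h3, ?_, h5⟩
  rcases h4 with (h4 | h4) | ⟨h4, h6⟩
  · exact Or.inl h4
  · exact Or.inr (Or.inl h4)
  · exact Or.inr (Or.inr ⟨h4, fun a ha => Nat.dvd_of_mod_eq_zero (h6 a ha)⟩)

lemma form_nvec_self (h : extraCheck n = true) {e : ℕ × List ℕ} (he : e ∈ extraRoots n) :
    form (nvec n e) (nvec n e) = sqNorm e := by
  obtain ⟨-, h2, -, h4, -⟩ := extraCheck_spec h he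
  have : 3 * (e.1 * e.1) ≤ tdot e.2 e.2 := by
    unfold sqNorm at h4; omega
  rw [form_nvec _ _ h2.le, sqNorm, Nat.cast_sub this]
  push_cast; ring

lemma nvec_mem_chamber {p : ℕ × List ℕ} (h : p.2.Pairwise (· ≥ ·)) : nvec n p ∈ chamber n := by
  refine ⟨fun i j hij => ?_, fun i => by simp [nvec]⟩
  simp only [nvec, Fin.cons_succ, Nat.cast_le]
  by_cases hj : (j : ℕ) < p.2.length
  · have hi : (i : ℕ) < p.2.length := lt_of_le_of_lt hij hj
    rw [List.getD_eq_getElem _ _ hj, List.getD_eq_getElem _ _ hi]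
    rcases (Fin.le_def.mp hij).lt_or_eq with hlt | heq
    · exact List.pairwise_iff_getElem.mp h _ _ hi hj hlt
    · simp [heq]
  · rw [List.getD_eq_default _ _ (not_lt.mp hj)]
    exact Nat.zero_le _

lemma isRoot_extra (h : extraCheck n = true) {e : ℕ × List ℕ} (he : e ∈ extraRoots n) :
    IsRoot (nvec n e) := by
  obtain ⟨-, h2, -, h4, -⟩ := extraCheck_spec h he
  refine isRoot_of_three_dvd (nvec_mem_lattice e) ?_ fun h6 i => ?_ <;>
    rw [form_nvec_self h he] at *
  · rcases h4 with h4 | h4 | ⟨h4, -⟩ <;> simp [h4]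
  · have h6' : sqNorm e = 6 := by exact_mod_cast h6
    have h3 : ∀ a ∈ e.2, 3 ∣ a := by
      rcases h4 with h4 | h4 | ⟨-, h4⟩
      · omega
      · omega
      · exact h4
    have hi : (i : ℕ) < e.2.length := h2.symm ▸ i.2
    obtain ⟨m, hm⟩ := h3 _ (List.getElem_mem hi)
    refine ⟨m, ?_⟩
    simp only [nvec, Fin.cons_succ]
    rw [List.getD_eq_getElem _ _ hi, hm]
    push_cast; rfl

/-- A root in the chamber with positive first coordinate has natural coordinates. -/
lemma IsRoot.eq_nvec {r : V n} (h : IsRoot r) (hr : r ∈ chamber n) (h0 : 0 < r 0) :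
    ∃ k t, 0 < k ∧ t.length = n ∧ t.Pairwise (· ≥ ·) ∧ r = nvec n (k, t) := by
  choose z hz using h.1
  have hz0 : 0 < z 0 := by rw [hz] at h0; exact_mod_cast h0
  have hzs : ∀ i : Fin n, 0 ≤ z i.succ := fun i => by
    have := hr.2 i
    rw [hz] at this
    exact_mod_cast this
  refine ⟨(z 0).toNat, List.ofFn fun i : Fin n => (z i.succ).toNat, by omega, by simp, ?_, ?_⟩
  · rw [List.pairwise_ofFn]
    intro i j hij
    have := hr.1 hij.le
    simp only [hz] at this
    exact Int.toNat_le_toNat (by exact_mod_cast this)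
  · funext i
    refine Fin.cases ?_ (fun j => ?_) i
    · simp only [nvec, Fin.cons_zero, hz]
      exact_mod_cast (Int.toNat_of_nonneg hz0.le).symm
    · simp only [nvec, Fin.cons_succ, hz]
      rw [List.getD_eq_getElem _ _ (by simp), List.getElem_ofFn]
      exact_mod_cast (Int.toNat_of_nonneg (hzs j)).symm

lemma order_of_orderCheck (h : extraCheck n = true) (ho : orderCheck n = true)
    {e : ℕ × List ℕ} (he : e ∈ extraRoots n) {r : V n} (hr : IsRoot r) (hrc : r ∈ chamber n)
    (h0 : 0 < r 0) (hd : r 0 ^ 2 * form (nvec n e) (nvec n e) ≤ (e.1 : ℝ) ^ 2 * form r r) :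
    r = nvec n e ∨ form (nvec n e) r ≤ 0 := by
  obtain ⟨k, t, hk, hlen, hs, rfl⟩ := hr.eq_nvec hrc h0
  obtain ⟨h1, h2, h3, h4, h5⟩ := extraCheck_spec h he
  obtain ⟨ε, hε, hε'⟩ : ∃ ε : ℕ, form (nvec n (k, t)) (nvec n (k, t)) = ε ∧
      (ε = 1 ∨ ε = 2 ∨ ε = 6) := by
    rcases hr.2.1 with h' | h' | h'
    · exact ⟨1, by rw [h']; norm_num, by simp⟩
    · exact ⟨2, by rw [h']; norm_num, by simp⟩
    · exact ⟨6, by rw [h']; norm_num, by simp⟩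
  rw [form_nvec_self h he, hε] at hd
  have hd' : k * k * sqNorm e ≤ e.1 * e.1 * ε := by
    simp only [nvec, Fin.cons_zero] at hd
    rw [sq, sq] at hd
    exact_mod_cast hd
  have hk13 : k < 13 := by
    by_contra hcon
    have h6 : 13 * 13 ≤ k * k := Nat.mul_le_mul (by omega) (by omega)
    have h7 := Nat.mul_le_mul_right (sqNorm e) h6
    have h8 : e.1 * e.1 * ε ≤ e.1 * e.1 * 6 := Nat.mul_le_mul_left _ (by omega)
    omega
  have htt : tdot t t = 3 * (k * k) + ε := by
    rw [form_nvec _ _ hlen.le] at hε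
    have : (tdot t t : ℝ) = ((3 * (k * k) + ε : ℕ) : ℝ) := by push_cast; simp only at hε; linarith
    exact_mod_cast this
  have hεt : ε = 1 ∨ ε = 2 ∨ ε = 6 ∧ ∀ a ∈ t, 3 ∣ a := by
    rcases hε' with rfl | rfl | rfl
    · simp
    · simp
    · refine Or.inr (Or.inr ⟨rfl, fun a ha => ?_⟩)
      obtain ⟨i, hi, rfl⟩ := List.getElem_of_mem ha
      obtain ⟨m, hm⟩ := hr.three_dvd (by rw [hε]; norm_num) ⟨i, hlen ▸ hi⟩
      simp only [nvec, Fin.cons_succ] at hm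
      rw [List.getD_eq_getElem _ _ hi] at hm
      have : (t[i] : ℤ) = 3 * m := by exact_mod_cast hm
      omega
  have hmem := mem_sortedTails hk hs hεt htt
  rw [hlen] at hmem
  unfold orderCheck at ho
  rw [List.all_eq_true] at ho
  have ho1 := ho ε (by rcases hε' with rfl | rfl | rfl <;> simp)
  rw [List.all_eq_true] at ho1
  have ho2 := ho1 (k - 1) (List.mem_range.mpr (by omega))
  simp only [Nat.sub_add_cancel hk] at ho2
  have heE : e ∈ (extraRoots n).filter fun e => Nat.ble (k * k * sqNorm e) (e.1 * e.1 * ε) :=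
    List.mem_filter.mpr ⟨he, Nat.ble_eq.mpr hd'⟩
  rw [Bool.or_eq_true] at ho2
  rcases ho2 with ho2 | ho2
  · rw [List.isEmpty_iff] at ho2
    rw [ho2] at heE
    simp at heE
  · have := List.all_eq_true.mp (List.all_eq_true.mp ho2 t hmem) e heE
    rw [Bool.or_eq_true, decide_eq_true_eq, Nat.ble_eq] at this
    rcases this with h' | h'
    · left; rw [h']
    · right
      rw [form_nvec _ _ h2.le, sub_nonpos]
      exact_mod_cast h'

/-- A root whose first coordinate is positive is nonpositive on the fundamental cone.  The proof is
by descent: a root in the chamber has positive scalar product with some simple root `e`, as the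
fundamental cone contains no vectors of positive square, and the reflection in `e` decreases the
first coordinate.  If that coordinate becomes negative, then the order condition shows that
the two halfspaces are nested. -/
theorem IsRoot.nonpos_of_pos (h : extraCheck n = true) (ho : orderCheck n = true)
    (hlight : fundCone n ⊆ fcone n) {r : V n} (hr : IsRoot r) (h0 : 0 < r 0) :
    ∀ x ∈ fundCone n, form r x ≤ 0 := by
  obtain ⟨k, hk⟩ : ∃ k : ℕ, r 0 = k := by
    obtain ⟨m, hm⟩ := hr.1 0
    refine ⟨m.toNat, ?_⟩
    rw [hm] at h0 ⊢
    have : 0 < m := by exact_mod_cast h0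
    exact_mod_cast (Int.toNat_of_nonneg this.le).symm
  induction k using Nat.strong_induction_on generalizing r with
  | _ k ih =>
    intro x hx
    obtain ⟨s, hs, hs0, hsc, hss, hle⟩ := hr.exists_sorted
    refine (hle x hx.1).trans ?_
    have hs0' : 0 < s 0 := hs0 ▸ h0
    have hnot : s ∉ fundCone n := fun hmem => absurd (hlight hmem).1 (not_le.mpr hs.pos)
    obtain ⟨e, he, hpos⟩ : ∃ e ∈ extraRoots n, 0 < form (nvec n e) s := by
      by_contra hcon
      push Not at hcon
      exact hnot ⟨hsc, hcon⟩
    obtain ⟨he1, -, hesort, -, -⟩ := extraCheck_spec h he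
    set E := nvec n e with hE
    have hEr : IsRoot E := isRoot_extra h he
    have hEc : E ∈ chamber n := nvec_mem_chamber hesort
    have hE0 : E 0 = e.1 := by simp [hE, nvec]
    have hE0pos : (0 : ℝ) < e.1 := by exact_mod_cast he1
    have hEx : form E x ≤ 0 := hx.2 e he
    set c := 2 * form E s / form E E with hc
    have hcpos : 0 < c := div_pos (by linarith) hEr.pos
    have hcE : c * form E E = 2 * form E s := div_mul_cancel₀ _ hEr.pos.ne'
    set u := refl E s with hu
    have hur : IsRoot u := hs.map hEr.refl_mem_Theta
    have hus : u = s - c • E := refl_apply E s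
    have huE : form E u = -form E s := by
      rw [hus, form_sub_right, form_smul_right]; linarith
    have hu0 : u 0 = s 0 - c * e.1 := by rw [hus, Pi.sub_apply, Pi.smul_apply, hE0, smul_eq_mul]
    have huu : form u u = form s s := form_refl hEr.pos s s
    have hgood : form u x ≤ 0 → form s x ≤ 0 := fun hux => by
      rw [hus, form_sub_left, form_smul_left] at hux
      have := mul_nonpos_of_nonneg_of_nonpos hcpos.le hEx
      linarith
    rcases lt_trichotomy (u 0) 0 with hneg | hzero | hpos'
    · -- the distance of the mirror of `s` from the base point is larger than that of `E`
      by_cases hsE : s = E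
      · rw [hsE]; exact hEx
      have hd1 : (e.1 : ℝ) ^ 2 * form s s < s 0 ^ 2 * form E E := by
        by_contra hcon
        rcases order_of_orderCheck h ho he hs hsc hs0' (not_lt.mp hcon) with h' | h'
        · exact hsE h'
        · exact absurd hpos (not_lt.mpr h')
      -- and the same holds for `-u`
      obtain ⟨w, hw, hw0, hwc, hww, hwle⟩ := hur.neg.exists_sorted
      have hw0' : 0 < w 0 := by rw [hw0]; simpa using hneg
      have hwE : 0 < form E w := by
        have := hwle E hEc
        rw [form_neg_left, form_comm, huE, neg_neg] at this
        rw [form_comm]; linarith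
      have huu' : form w w = form s s := by
        rw [hww, form_neg_left, form_neg_right, neg_neg, huu]
      have hd2 : (e.1 : ℝ) ^ 2 * form s s ≤ w 0 ^ 2 * form E E := by
        by_contra hcon
        rw [not_le, ← huu'] at hcon
        rcases order_of_orderCheck h ho he hw hwc hw0' hcon.le with h' | h'
        · rw [h', ← hE, hE0] at hcon; exact lt_irrefl _ hcon
        · exact absurd hwE (not_lt.mpr h')
      rw [hw0, Pi.neg_apply, hu0] at hd2
      set α := Real.sqrt (form s s) with hα
      set β := Real.sqrt (form E E) with hβ
      have hαpos : 0 < α := Real.sqrt_pos.mpr hs.pos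
      have hβpos : 0 < β := Real.sqrt_pos.mpr hEr.pos
      have hαs : form s s = α ^ 2 := (Real.sq_sqrt hs.pos.le).symm
      have hβs : form E E = β ^ 2 := (Real.sq_sqrt hEr.pos.le).symm
      rw [hαs, hβs, ← mul_pow, ← mul_pow] at hd1 hd2
      have h1 : e.1 * α < s 0 * β := lt_of_pow_lt_pow_left₀ 2 (by positivity) hd1
      have h2 : e.1 * α ≤ -(s 0 - c * e.1) * β :=
        le_of_sq_le_sq hd2 (mul_nonneg (by rw [hu0] at hneg; linarith) hβpos.le)
      have h3 : 2 * α < c * β := by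
        have : e.1 * (2 * α) < e.1 * (c * β) := by linarith
        exact lt_of_mul_lt_mul_left this hE0pos.le
      have h4 : α * β < form E s := by
        rw [hβs] at hcE
        have := mul_lt_mul_of_pos_right h3 hβpos
        nlinarith
      -- the halfspaces of `s` and `E` are nested
      have hv : β • s - α • E ∈ cone n := by
        refine ⟨?_, ?_⟩
        · simp only [form_sub_left, form_sub_right, form_smul_left, form_smul_right,
            form_comm s E, hαs, hβs]
          have := mul_lt_mul_of_pos_left h4 (mul_pos hαpos hβpos)
          nlinarith
        · simp only [Pi.sub_apply, Pi.smul_apply, smul_eq_mul, hE0]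
          linarith
      have h5 := form_nonpos (cone_subset_fcone hv) (hlight hx)
      rw [form_sub_left, form_smul_left, form_smul_left] at h5
      have h6 := mul_nonpos_of_nonneg_of_nonpos hαpos.le hEx
      by_contra hcon
      have := mul_pos hβpos (not_le.mp hcon)
      linarith
    · rcases hur.sign_of_zero hzero with h' | h'
      · exact hgood (h' x hx.1)
      · have := h' E hEc
        rw [form_comm, huE] at this
        linarith
    · obtain ⟨m, hm⟩ := hur.1 0
      have hmpos : 0 < m := by rw [hm] at hpos'; exact_mod_cast hpos'
      have hmk : (m.toNat : ℝ) = u 0 := by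
        rw [hm]; exact_mod_cast Int.toNat_of_nonneg hmpos.le
      have hlt : m.toNat < k := by
        have : (m.toNat : ℝ) < k := by
          rw [hmk, ← hk, ← hs0, hu0]
          have := mul_pos hcpos hE0pos
          linarith
        exact_mod_cast this
      exact hgood (ih _ hlt hur hpos' hmk.symm x hx)

/-- No root changes sign on the fundamental cone. -/
theorem IsRoot.sign (h : extraCheck n = true) (ho : orderCheck n = true)
    (hlight : fundCone n ⊆ fcone n) {r : V n} (hr : IsRoot r) :
    (∀ x ∈ fundCone n, form r x ≤ 0) ∨ ∀ x ∈ fundCone n, 0 ≤ form r x := by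
  rcases lt_trichotomy (r 0) 0 with h0 | h0 | h0
  · right
    intro x hx
    have := hr.neg.nonpos_of_pos h ho hlight (by simpa using h0) x hx
    rw [form_neg_left] at this
    linarith
  · rcases hr.sign_of_zero h0 with h' | h'
    · exact Or.inl fun x hx => h' x hx.1
    · exact Or.inr fun x hx => h' x hx.1
  · exact Or.inl (hr.nonpos_of_pos h ho hlight h0)

end Order

/-! ### The fundamental cone lies in the light cone -/

/-- The vector with the listed coordinates, padded with zeros. -/
def zvec (n : ℕ) (l : List ℤ) : V n := fun i => (l.getD i 0 : ℝ)

/-- The simple roots `-v_{i+1} + v_{i+2}` and `-v_n`, orthogonal to the base point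
`(1, 0, …, 0)`. -/
def tailRoot (n i : ℕ) : List ℤ := List.replicate (i + 1) 0 ++ if i + 1 < n then [-1, 1] else [-1]

/-- The vectors `(1, …, 1, 0, …, 0)`, which generate the part `x_0 ≥ x_1` of the chamber.  The mask says
that each of them lies on all of the `n + 1` bounding hyperplanes but one. -/
def gens0 (n : ℕ) : List Gen :=
  (List.range (n + 1)).map fun m =>
    ⟨2 ^ (n + 1) - (2 ^ m + 1), 1, List.replicate m 1 ++ List.replicate (n - m) 0⟩

/-- Generators of the fundamental cone. -/
def gens (n : ℕ) : List Gen := (extraTail n).foldl ddStep (gens0 n)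

/-- The generators of the fundamental cone lie in the light cone. -/
def lightCheck (n : ℕ) : Bool :=
  (gens n).all fun g => Nat.ble (tdot g.ray.2 g.ray.2) (3 * (g.ray.1 * g.ray.1))

section FundCone

variable {n : ℕ}

/-- The coordinates `x_1, …, x_n`, followed by zeros. -/
def tailSeq (x : V n) (k : ℕ) : ℝ := if h : k < n then x (Fin.succ ⟨k, h⟩) else 0

lemma tailSeq_of_ge (x : V n) {k : ℕ} (h : n ≤ k) : tailSeq x k = 0 := by
  simp [tailSeq, not_lt.mpr h]

lemma tailSeq_fin (x : V n) (i : Fin n) : tailSeq x i = x i.succ := by simp [tailSeq]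

lemma form_tailRoot (x : V n) {i : ℕ} (hi : i < n) :
    form (zvec n (tailRoot n i)) x = tailSeq x (i + 1) - tailSeq x i := by
  have h0 : zvec n (tailRoot n i) 0 = 0 := by simp [zvec, tailRoot]
  have hj : ∀ j : Fin n, zvec n (tailRoot n i) j.succ * x j.succ =
      (if i + 1 = (j : ℕ) then tailSeq x (i + 1) else 0) -
        if i = (j : ℕ) then tailSeq x i else 0 := by
    intro j
    have hval : zvec n (tailRoot n i) j.succ =
        (if i + 1 = (j : ℕ) then 1 else 0) - if i = (j : ℕ) then (1 : ℝ) else 0 := by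
      rcases lt_trichotomy (j : ℕ) i with h | h | h
      · rw [if_neg (by omega), if_neg (by omega)]
        simp [zvec, tailRoot, List.getD_eq_getElem?_getD, List.getElem?_append, h]
      · rw [if_neg (by omega), if_pos h.symm]
        by_cases h' : i + 1 < n <;>
          simp [zvec, tailRoot, List.getD_eq_getElem?_getD, h, h']
      · have h' : i + 1 < n := by omega
        rw [if_neg (show ¬ i = (j : ℕ) by omega)]
        obtain ⟨d, hd⟩ : ∃ d, (j : ℕ) = i + 1 + d := ⟨j - (i + 1), by omega⟩
        cases d with
        | zero =>
          rw [if_pos (by omega)]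
          simp [zvec, tailRoot, List.getD_eq_getElem?_getD, h', hd]
        | succ d =>
          rw [if_neg (by omega)]
          have h1 : i + 1 + (d + 1) - i = d + 2 := by omega
          have h2 : ¬ i + 1 + (d + 1) < i := by omega
          simp [zvec, tailRoot, List.getD_eq_getElem?_getD, List.getElem?_append, h', hd, h1, h2]
    rw [hval, ← tailSeq_fin x]
    by_cases h1 : i + 1 = (j : ℕ)
    · rw [if_pos h1, if_neg (by omega), if_pos h1, if_neg (by omega), h1]; ring
    · rw [if_neg h1, if_neg h1]
      by_cases h2 : i = (j : ℕ)
      · rw [if_pos h2, if_pos h2, h2]; ring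
      · rw [if_neg h2, if_neg h2]; ring
  have hsum : ∀ (k : ℕ) (c : ℝ), (∑ j : Fin n, if k = (j : ℕ) then c else 0) =
      if k < n then c else 0 := by
    intro k c
    by_cases hk : k < n
    · rw [if_pos hk, Finset.sum_eq_single ⟨k, hk⟩]
      · simp
      · intro b _ hb
        exact if_neg fun h => hb (Fin.ext h.symm)
      · simp
    · rw [if_neg hk]
      exact Finset.sum_eq_zero fun j _ => if_neg (by have := j.2; omega)
  simp only [form, h0, hj, Finset.sum_sub_distrib, hsum, if_pos hi]
  by_cases h1 : i + 1 < n
  · rw [if_pos h1]; ring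
  · rw [if_neg h1, tailSeq_of_ge x (not_lt.mp h1)]; ring

lemma mem_chamber_iff {x : V n} :
    x ∈ chamber n ↔ ∀ i < n, form (zvec n (tailRoot n i)) x ≤ 0 := by
  constructor
  · intro h i hi
    rw [form_tailRoot x hi, sub_nonpos]
    by_cases h1 : i + 1 < n
    · rw [tailSeq, dif_pos h1, tailSeq, dif_pos hi]
      exact h.1 (Fin.mk_le_mk.mpr (Nat.le_succ i))
    · rw [tailSeq_of_ge x (not_lt.mp h1), tailSeq, dif_pos hi]
      exact h.2 _
  · intro h
    have hanti : Antitone (tailSeq x) := antitone_nat_of_succ_le fun k => by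
      by_cases hk : k < n
      · have := h k hk
        rw [form_tailRoot x hk] at this
        linarith
      · rw [tailSeq_of_ge x (not_lt.mp hk), tailSeq_of_ge x (by omega)]
    refine ⟨fun i j hij => ?_, fun i => ?_⟩
    · simp only [← tailSeq_fin x]
      exact hanti hij
    · rw [← tailSeq_fin x, ← tailSeq_of_ge x le_rfl]
      exact hanti i.2.le

/-- The hyperplanes bounding the cone generated by `gens0 n`. -/
def walls0 (n : ℕ) : List (V n) :=
  nvec n (firstExtra n) :: (List.range n).map fun i => zvec n (tailRoot n i)

lemma form_firstExtra (hn : 0 < n) (x : V n) :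
    form (nvec n (firstExtra n)) x = 3 * (tailSeq x 0 - x 0) := by
  obtain ⟨m, rfl⟩ : ∃ m, n = m + 1 := ⟨n - 1, by omega⟩
  simp only [form, nvec, firstExtra, padTo, Fin.cons_zero, Fin.cons_succ]
  rw [Fin.sum_univ_succ, Finset.sum_eq_zero]
  · simp [tailSeq]; ring
  · intro i _
    simp [List.getD_eq_getElem?_getD]

lemma isDD_gens0 (hn : 0 < n) : IsDD (walls0 n) (gens0 n) := by
  set w : ℕ → ℕ × List ℕ := fun m => (1, List.replicate m 1 ++ List.replicate (n - m) 0) with hw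
  have hgen : ∀ g, g ∈ gens0 n ↔ ∃ m < n + 1, g = ⟨2 ^ (n + 1) - (2 ^ m + 1), w m⟩ := by
    intro g
    simp only [gens0, List.mem_map, List.mem_range, hw, eq_comm]
  have hseq : ∀ m ≤ n, ∀ k, tailSeq (nvec n (w m)) k = if k < m then 1 else 0 := by
    intro m hm k
    by_cases hk : k < n
    · rw [tailSeq, dif_pos hk]
      simp only [nvec, Fin.cons_succ, hw]
      by_cases hkm : k < m
      · simp [List.getD_eq_getElem?_getD, List.getElem?_append, hkm]
      · have : k - m < n - m := by omega
        simp [List.getD_eq_getElem?_getD, List.getElem?_append, hkm, this]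
    · rw [tailSeq_of_ge _ (not_lt.mp hk), if_neg (by omega)]
  have hform : ∀ m ≤ n, ∀ k a, (walls0 n)[k]? = some a →
      form a (nvec n (w m)) ≤ 0 ∧ k ≤ n ∧ (form a (nvec n (w m)) = 0 ↔ k ≠ m) := by
    intro m hm k a hk
    cases k with
    | zero =>
      obtain rfl : nvec n (firstExtra n) = a := by simpa [walls0] using hk
      rw [form_firstExtra hn, hseq m hm]
      have : nvec n (w m) 0 = 1 := by simp [nvec, hw]
      rw [this]
      by_cases h0 : 0 < m
      · rw [if_pos h0]
        exact ⟨by norm_num, by omega, by norm_num; omega⟩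
      · rw [if_neg h0]
        exact ⟨by norm_num, by omega, by norm_num; omega⟩
    | succ k =>
      have hkn : k < n := by
        by_contra hcon
        simp [walls0, hcon] at hk
      obtain rfl : zvec n (tailRoot n k) = a := by
        simpa [walls0, hkn] using hk
      rw [form_tailRoot _ hkn, hseq m hm, hseq m hm]
      rcases lt_trichotomy (k + 1) m with h | h | h
      · rw [if_pos h, if_pos (by omega)]
        exact ⟨by norm_num, by omega, by norm_num; omega⟩
      · rw [if_neg (by omega), if_pos (by omega)]
        exact ⟨by norm_num, by omega, by norm_num; omega⟩
      · rw [if_neg (by omega), if_neg (by omega)]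
        exact ⟨by norm_num, by omega, by norm_num; omega⟩
  have hpointed : ∀ x, (∀ a ∈ walls0 n, form a x = 0) → x = 0 := by
    intro x hx
    have ht : ∀ i < n, form (zvec n (tailRoot n i)) x = 0 := fun i hi =>
      hx _ (List.mem_cons_of_mem _ (List.mem_map.mpr ⟨i, List.mem_range.mpr hi, rfl⟩))
    have h1 : x ∈ chamber n := mem_chamber_iff.mpr fun i hi => (ht i hi).le
    have h2 : -x ∈ chamber n := mem_chamber_iff.mpr fun i hi => by
      rw [form_neg_right, ht i hi, neg_zero]
    have h3 : ∀ i : Fin n, x i.succ = 0 := fun i => by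
      have := h2.2 i
      rw [Pi.neg_apply] at this
      linarith [h1.2 i]
    have h4 := hx _ List.mem_cons_self
    rw [form_firstExtra hn, tailSeq, dif_pos hn, h3] at h4
    funext i
    refine Fin.cases ?_ h3 i
    change x 0 = 0
    linarith
  refine ⟨hpointed, ?_, ?_, ?_, ?_, ?_⟩
  · intro g hg a ha
    obtain ⟨m, hm, rfl⟩ := (hgen g).mp hg
    obtain ⟨k, hk, rfl⟩ := List.getElem_of_mem ha
    exact (hform m (by omega) k _ (List.getElem?_eq_getElem hk)).1
  · intro g hg
    obtain ⟨m, hm, rfl⟩ := (hgen g).mp hg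
    exact Nat.one_pos
  · intro g hg
    obtain ⟨m, hm, rfl⟩ := (hgen g).mp hg
    simp only [hw, List.length_append, List.length_replicate]
    omega
  · intro g hg k a hk
    obtain ⟨m, hm, rfl⟩ := (hgen g).mp hg
    obtain ⟨-, hkn, h⟩ := hform m (by omega) k a hk
    rw [h, Nat.testBit_two_pow_sub_succ (Nat.pow_lt_pow_right (by norm_num) hm),
      Nat.testBit_two_pow]
    simp only [Bool.and_eq_true, decide_eq_true_eq, Bool.not_eq_true', decide_eq_false_iff_not]
    constructor
    · rintro ⟨-, h'⟩ rfl; exact h' rfl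
    · intro h'; exact ⟨by omega, fun h'' => h' h''.symm⟩
  · intro x hx hx0
    obtain ⟨a, ha, hne⟩ : ∃ a ∈ walls0 n, form a x ≠ 0 := by
      by_contra hcon
      push Not at hcon
      exact hx0 (hpointed x hcon)
    obtain ⟨m, hm, rfl⟩ := List.getElem_of_mem ha
    have hmn := (hform 0 (Nat.zero_le n) m _ (List.getElem?_eq_getElem hm)).2.1
    refine ⟨_, (hgen _).mpr ⟨m, by omega, rfl⟩, fun b hb h0 => ?_⟩
    obtain ⟨k, hk, rfl⟩ := List.getElem_of_mem hb
    refine (hform m hmn k _ (List.getElem?_eq_getElem hk)).2.2.mpr ?_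
    rintro rfl
    exact hne h0

lemma IsDD.foldl {A : List (V n)} {G : List Gen} (h : IsDD A G) (ls : List (ℕ × List ℕ))
    (hls : ∀ l ∈ ls, l.2.length ≤ n) :
    IsDD ((ls.map (nvec n)).reverse ++ A) (ls.foldl ddStep G) := by
  induction ls generalizing A G with
  | nil => exact h
  | cons l ls ih =>
    have := ih (h.step (hls l List.mem_cons_self)) fun l' hl' => hls l' (List.mem_cons_of_mem _ hl')
    simpa using this

lemma exists_isDD_gens (hn : 0 < n) (h : extraCheck n = true) :
    ∃ A : List (V n), IsDD A (gens n) ∧ polyCone A = fundCone n := by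
  refine ⟨_, (isDD_gens0 hn).foldl (extraTail n) fun l hl =>
    (extraCheck_spec h (List.mem_cons_of_mem _ hl)).2.1.le, ?_⟩
  ext x
  simp only [polyCone, fundCone, walls0, extraRoots, mem_ofPred_eq, mem_chamber_iff,
    List.mem_append, List.mem_reverse, List.mem_map, List.mem_cons, List.mem_range]
  constructor
  · intro hx
    exact ⟨fun i hi => hx _ (Or.inr (Or.inr ⟨i, hi, rfl⟩)), fun e he => he.elim
      (fun he => hx _ (Or.inr (Or.inl (he ▸ rfl)))) fun he => hx _ (Or.inl ⟨e, he, rfl⟩)⟩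
  · rintro ⟨h1, h2⟩ a (⟨e, he, rfl⟩ | rfl | ⟨i, hi, rfl⟩)
    · exact h2 e (Or.inr he)
    · exact h2 _ (Or.inl rfl)
    · exact h1 i hi

lemma gen_mem_fcone (h : extraCheck n = true) (hl : lightCheck n = true) (hn : 0 < n) {g : Gen}
    (hg : g ∈ gens n) : nvec n g.ray ∈ fcone n := by
  obtain ⟨A, hA, -⟩ := exists_isDD_gens hn h
  have := List.all_eq_true.mp hl g hg
  rw [Nat.ble_eq] at this
  refine ⟨?_, by simp [nvec]⟩
  rw [form_nvec _ _ (hA.len g hg).le, sub_nonpos]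
  exact_mod_cast this

theorem fundCone_subset_fcone (hn : 0 < n) (h : extraCheck n = true) (hl : lightCheck n = true) :
    fundCone n ⊆ fcone n := by
  obtain ⟨A, hA, hAC⟩ := exists_isDD_gens hn h
  intro x hx
  rw [← hAC] at hx
  exact hA.induction (Q := (· ∈ fcone n)) ⟨by simp, le_rfl⟩ (fun x _ hQ g hg t ht =>
    add_mem_fcone hQ (smul_mem_fcone (gen_mem_fcone h hl hn hg) ht.le)) x hx

/-- The isotropic rays of the fundamental cone are among its generators. -/
theorem exists_gen_of_isotropic (hn : 0 < n) (h : extraCheck n = true) (hl : lightCheck n = true)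
    {q : V n} (hq : q ∈ fundCone n) (hq0 : q ≠ 0) (hqq : form q q = 0) :
    ∃ g ∈ gens n, tdot g.ray.2 g.ray.2 = 3 * (g.ray.1 * g.ray.1) ∧
      ∃ c : ℝ, 0 < c ∧ q = c • nvec n g.ray := by
  obtain ⟨A, hA, hAC⟩ := exists_isDD_gens hn h
  have hqA : q ∈ polyCone A := hAC ▸ hq
  have hqf := fundCone_subset_fcone hn h hl hq
  obtain ⟨g, hg, hc⟩ := hA.cover q hqA hq0
  have hgf := gen_mem_fcone h hl hn hg
  have hg0 := nvec_ne_zero (n := n) (hA.pos g hg)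
  obtain ⟨t, ht, hmem, -⟩ := exists_sub_smul_mem hA.pointed hqA (hA.mem g hg) hg0 hc
  have h1 := form_nonpos hqf (fundCone_subset_fcone hn h hl (hAC ▸ hmem))
  have h2 := form_nonpos hqf hgf
  rw [form_sub_right, form_smul_right, hqq] at h1
  have h3 : form q (nvec n g.ray) = 0 := by
    by_contra hne
    have := mul_neg_of_pos_of_neg ht (lt_of_le_of_ne h2 hne)
    linarith
  have hqpos := fcone_pos hqf hq0
  have hgpos := fcone_pos hgf hg0
  have h4 := eq_smul_of_form_eq_zero hqq hqpos.ne' h3 hgf.1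
  set c := nvec n g.ray 0 / q 0 with hcdef
  have hcpos : 0 < c := div_pos hgpos hqpos
  refine ⟨g, hg, ?_, c⁻¹, inv_pos.mpr hcpos, ?_⟩
  · have h5 : form (nvec n g.ray) (nvec n g.ray) = 0 := by
      rw [h4, form_smul_left, form_smul_right, hqq]; ring
    rw [form_nvec _ _ (hA.len g hg).le, sub_eq_zero] at h5
    exact_mod_cast h5
  · rw [h4, smul_smul, inv_mul_cancel₀ hcpos.ne', one_smul]

end FundCone

/-! ### Systems of simple roots -/

section SimpleSystem

variable {n : ℕ} {ι : Type*}

/-- The cone cut out by the halfspaces `(e i, ·) ≤ 0`. -/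
def wallCone (e : ι → V n) : Set (V n) := {x | ∀ i, form (e i) x ≤ 0}

/-- A system of simple roots `e` for `Θ_n`: roots with pairwise nonpositive scalar products, bounding
a cone which lies in the light cone and on which no root changes sign. -/
structure IsSimpleSystem (e : ι → V n) : Prop where
  root : ∀ i, IsRoot (e i)
  light : wallCone e ⊆ fcone n
  sign : ∀ r, IsRoot r → (∀ x ∈ wallCone e, form r x ≤ 0) ∨ ∀ x ∈ wallCone e, 0 ≤ form r x
  acute : ∀ i j, i ≠ j → form (e i) (e j) ≤ 0
  interior : ∃ ρ ∈ lattice n, ρ ∈ cone n ∧ ∀ i, form (e i) ρ < 0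

lemma map_mem_wallCone {e : ι → V n} {g : V n ≃ₗ[ℝ] V n} (hg : g ∈ Isom n) {x : V n} :
    x ∈ wallCone (fun i => g (e i)) ↔ g⁻¹ x ∈ wallCone e := by
  simp only [wallCone, mem_ofPred_eq, Isom_form_left hg]

lemma apply_inv_apply (g : V n ≃ₗ[ℝ] V n) (x : V n) : g (g⁻¹ x) = x := g.apply_symm_apply x

lemma inv_apply_apply (g : V n ≃ₗ[ℝ] V n) (x : V n) : g⁻¹ (g x) = x := g.symm_apply_apply x

lemma Isom_fcone {g : V n ≃ₗ[ℝ] V n} (hg : g ∈ Isom n) {x : V n} (hx : x ∈ fcone n) :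
    g x ∈ fcone n := by
  have hsq : form (g x) (g x) ≤ 0 := by rw [Isom_form hg]; exact hx.1
  by_contra hcon
  have hneg : (g x) 0 < 0 := by
    by_contra h; exact hcon ⟨hsq, not_lt.mp h⟩
  -- the image of a point of `ℭ` near `x` would not lie in `ℭ`
  have hb : (Pi.single 0 1 : V n) ∈ cone n := by
    refine ⟨?_, by simp⟩
    rw [form_single_zero]; simp
  have hgb := (hg.2 _).mpr hb
  have hmem : -g x ∈ fcone n := ⟨by rw [form_neg_left, form_neg_right, neg_neg]; exact hsq,
    by rw [Pi.neg_apply]; linarith⟩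
  have hx0 : x ≠ 0 := by rintro rfl; simp at hneg
  have h1 := form_neg_of_mem hb hx hx0
  have h2 := form_nonpos (cone_subset_fcone hgb) hmem
  rw [form_neg_right, Isom_form hg] at h2
  linarith

lemma IsSimpleSystem.map {e : ι → V n} (h : IsSimpleSystem e) {g : V n ≃ₗ[ℝ] V n}
    (hg : g ∈ Theta n) : IsSimpleSystem fun i => g (e i) := by
  refine ⟨fun i => (h.root i).map hg, fun x hx => ?_, fun r hr => ?_, fun i j hij => ?_, ?_⟩
  · rw [map_mem_wallCone hg.1] at hx
    have := Isom_fcone hg.1 (h.light hx)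
    rwa [apply_inv_apply] at this
  · have key : ∀ x, form (g⁻¹ r) (g⁻¹ x) = form r x := Isom_form (inv_mem hg.1) r
    rcases h.sign _ (hr.map (inv_mem hg)) with h' | h'
    · left; intro x hx
      rw [← key]; exact h' _ ((map_mem_wallCone hg.1).mp hx)
    · right; intro x hx
      rw [← key]; exact h' _ ((map_mem_wallCone hg.1).mp hx)
  · rw [Isom_form hg.1]; exact h.acute i j hij
  · obtain ⟨ρ, h1, h2, h3⟩ := h.interior
    exact ⟨g ρ, (hg.2 ρ).mpr h1, (hg.1.2 ρ).mpr h2, fun i => by rw [Isom_form hg.1]; exact h3 i⟩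

lemma add_mem_wallCone {e : ι → V n} {x y : V n} (hx : x ∈ wallCone e) (hy : y ∈ wallCone e) :
    x + y ∈ wallCone e := fun i => by
  rw [form_add_right]; linarith [hx i, hy i]

lemma smul_mem_wallCone {e : ι → V n} {x : V n} (hx : x ∈ wallCone e) {c : ℝ} (hc : 0 ≤ c) :
    c • x ∈ wallCone e := fun i => by
  rw [form_smul_right]; exact mul_nonpos_of_nonneg_of_nonpos hc (hx i)

/-- From a point `y` of the cone one can move a little in any direction parallel to the walls
through `y`. -/
lemma exists_small_mem_wallCone [Finite ι] {e : ι → V n} {y v : V n}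
    (h : ∀ i, form (e i) y < 0 ∨ form (e i) y = 0 ∧ form (e i) v = 0) {U : Set (V n)}
    (hU : IsOpen U) (hy : y ∈ U) :
    ∃ t : ℝ, 0 < t ∧ (y + t • v ∈ wallCone e ∧ y + t • v ∈ U) ∧
      y - t • v ∈ wallCone e ∧ y - t • v ∈ U := by
  have hev : ∀ᶠ t : ℝ in 𝓝 0, y + t • v ∈ wallCone e ∧ y + t • v ∈ U := by
    refine Filter.Eventually.and ?_ ?_
    · refine Filter.eventually_all.mpr fun i => ?_
      rcases h i with h' | ⟨h1, h2⟩
      · have hc : Continuous fun t : ℝ => form (e i) (y + t • v) := by fun_prop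
        have := hc.continuousAt (x := 0) |>.eventually_lt continuousAt_const (by simpa using h')
        exact this.mono fun t ht => le_of_lt ht
      · exact Filter.Eventually.of_forall fun t => by
          rw [form_add_right, form_smul_right, h1, h2]; simp
    · have hc : Continuous fun t : ℝ => y + t • v := by fun_prop
      exact hc.continuousAt.eventually_mem (hU.mem_nhds (by simpa using hy))
  obtain ⟨δ, hδ, hball⟩ := Metric.eventually_nhds_iff.mp hev
  refine ⟨δ / 2, half_pos hδ, hball (by simp [abs_of_pos hδ]; linarith), ?_⟩
  have := hball (y := -(δ / 2)) (by simp [abs_of_pos hδ]; linarith)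
  rwa [neg_smul, ← sub_eq_add_neg] at this

namespace IsSimpleSystem

variable {e : ι → V n}

lemma eq_zero_of_form_eq_zero (h : IsSimpleSystem e) {x : V n} (hx : ∀ i, form (e i) x = 0) :
    x = 0 := by
  have h1 := h.light (show x ∈ wallCone e from fun i => (hx i).le)
  have h2 := h.light (show -x ∈ wallCone e from fun i => by rw [form_neg_right, hx i, neg_zero])
  refine eq_zero_of_form_self_nonpos (le_antisymm ?_ h1.2) h1.1
  have := h2.2
  rw [Pi.neg_apply] at this
  linarith

lemma eq_of_form_eq (h : IsSimpleSystem e) {x y : V n} (hxy : ∀ i, form (e i) x = form (e i) y) :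
    x = y :=
  sub_eq_zero.mp <| h.eq_zero_of_form_eq_zero fun i => by rw [form_sub_right, hxy i, sub_self]

/-- Every wall of the cone contains a point lying on no other wall: the projection of an interior
point. -/
lemma exists_wall_point (h : IsSimpleSystem e) (i : ι) :
    ∃ y ∈ cone n, form (e i) y = 0 ∧ ∀ j, j ≠ i → form (e j) y < 0 := by
  obtain ⟨ρ, -, hρ, hneg⟩ := h.interior
  have hpos := (h.root i).pos
  set c := form (e i) ρ / form (e i) (e i) with hc
  have hcneg : c < 0 := div_neg_of_neg_of_pos (hneg i) hpos
  have hce : c * form (e i) (e i) = form (e i) ρ := div_mul_cancel₀ _ hpos.ne'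
  have hzero : form (e i) (ρ - c • e i) = 0 := by
    rw [form_sub_right, form_smul_right, hce, sub_self]
  have hlt : ∀ j, j ≠ i → form (e j) (ρ - c • e i) < 0 := fun j hj => by
    rw [form_sub_right, form_smul_right]
    have := mul_nonneg_of_nonpos_of_nonpos hcneg.le (h.acute j i hj)
    linarith [hneg j]
  refine ⟨ρ - c • e i, ⟨?_, ?_⟩, hzero, hlt⟩
  · rw [form_sub_left, form_smul_left, hzero, form_sub_right, form_smul_right,
      form_comm ρ (e i)]
    have := mul_pos_of_neg_of_neg hcneg (hneg i)
    linarith [hρ.1]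
  · have hf := h.light (show ρ - c • e i ∈ wallCone e from fun j => by
      by_cases hj : j = i
      · subst hj; exact hzero.le
      · exact (hlt j hj).le)
    refine fcone_pos hf fun h0 => ?_
    have hρe : ρ = c • e i := sub_eq_zero.mp h0
    have := hρ.1
    rw [hρe, form_smul_left, form_smul_right] at this
    nlinarith [mul_self_nonneg c]

/-- A functional which is nonpositive on the cone and vanishes at an inner point of a wall is
proportional to the root of that wall. -/
lemma eq_smul_of_wall_point [Finite ι] (h : IsSimpleSystem e) {i : ι} {y r : V n}
    (hy0 : form (e i) y = 0) (hy : ∀ j, j ≠ i → form (e j) y < 0)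
    (hr : ∀ x ∈ wallCone e, form r x ≤ 0) (hry : form r y = 0) : ∃ c : ℝ, r = c • e i := by
  have hpos := (h.root i).pos
  have hperp : ∀ v, form (e i) v = 0 → form r v = 0 := fun v hv => by
    obtain ⟨t, ht, ⟨h1, -⟩, h2, -⟩ := exists_small_mem_wallCone (e := e) (y := y) (v := v)
      (fun j => by
        by_cases hj : j = i
        · subst hj; exact Or.inr ⟨hy0, hv⟩
        · exact Or.inl (hy j hj)) isOpen_univ (mem_univ _)
    have h1 := hr _ h1
    have h2 := hr _ h2
    rw [form_add_right, form_smul_right, hry] at h1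
    rw [form_sub_right, form_smul_right, hry] at h2
    have : t * form r v = 0 := by linarith
    exact (mul_eq_zero.mp this).resolve_left ht.ne'
  refine ⟨form r (e i) / form (e i) (e i), sub_eq_zero.mp (form_nondegenerate fun y => ?_)⟩
  have := hperp (y - (form (e i) y / form (e i) (e i)) • e i) (by
    rw [form_sub_right, form_smul_right, div_mul_cancel₀ _ hpos.ne', sub_self])
  rw [form_sub_right, form_smul_right] at this
  rw [form_sub_left, form_smul_left, ← this]
  ring

/-- The subgroup generated by the reflections in the simple roots. -/
def _root_.HypRefl.simpleGroup (e : ι → V n) : Subgroup (V n ≃ₗ[ℝ] V n) :=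
  Subgroup.closure (range fun i => refl (e i))

lemma simpleGroup_le_Gam (h : IsSimpleSystem e) : simpleGroup e ≤ Gam n :=
  (Subgroup.closure_le _).mpr <| by rintro _ ⟨i, rfl⟩; exact (h.root i).refl_mem_Gam

lemma refl_mem_simpleGroup (i : ι) : refl (e i) ∈ simpleGroup e :=
  Subgroup.subset_closure ⟨i, rfl⟩

/-- Integral vectors of the light cone with bounded scalar product with a given vector of `ℭ` are
finite in number. -/
lemma _root_.HypRefl.finite_lattice_bounded {x : V n} (hx : x ∈ cone n) (B : ℝ) :
    {u : V n | u ∈ lattice n ∧ u ∈ fcone n ∧ -form x u ≤ B}.Finite := by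
  have hx1 := hx.1
  rw [form_self] at hx1
  set S := ∑ i : Fin n, x i.succ ^ 2 with hS
  have hS0 : 0 ≤ S := Finset.sum_nonneg fun i _ => sq_nonneg _
  set a := Real.sqrt (3 * S) with ha
  have ha0 : 0 ≤ a := Real.sqrt_nonneg _
  have ha2 : a ^ 2 = 3 * S := Real.sq_sqrt (by linarith)
  have hδ : 0 < 3 * x 0 - a := by
    have : a < 3 * x 0 := abs_lt_of_sq_lt_sq' (by rw [ha2]; nlinarith) (by linarith [hx.2]) |>.2
    linarith
  set N : ℤ := ⌈2 * (|B| / (3 * x 0 - a))⌉ with hN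
  have hfin : ((fun z : Fin (n + 1) → ℤ => (fun i => (z i : ℝ) : V n)) ''
      Set.Icc (fun _ => -N) fun _ => N).Finite := (Set.finite_Icc _ _).image _
  refine hfin.subset ?_
  rintro u ⟨hul, huf, hB⟩
  choose z hz using hul
  have hu0 := huf.2
  have hu1 := huf.1
  rw [form_self] at hu1
  have hT0 : 0 ≤ ∑ i : Fin n, u i.succ ^ 2 := Finset.sum_nonneg fun i _ => sq_nonneg _
  have hc := cauchy_tail x u
  have hle : ∑ i : Fin n, x i.succ * u i.succ ≤ a * u 0 := by
    refine (abs_le_of_sq_le_sq' ?_ (mul_nonneg ha0 hu0)).2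
    calc _ ≤ S * ∑ i : Fin n, u i.succ ^ 2 := hc
      _ ≤ S * (3 * u 0 ^ 2) := mul_le_mul_of_nonneg_left (by linarith) hS0
      _ = (a * u 0) ^ 2 := by rw [mul_pow, ha2]; ring
  have hform : (3 * x 0 - a) * u 0 ≤ |B| := by
    have : -form x u = 3 * (x 0 * u 0) - ∑ i : Fin n, x i.succ * u i.succ := by
      unfold form; ring
    rw [this] at hB
    have := le_abs_self B
    linarith
  have hu0B : u 0 ≤ |B| / (3 * x 0 - a) := by
    rw [le_div_iff₀ hδ]; linarith
  have hbound : ∀ i, |u i| ≤ 2 * (|B| / (3 * x 0 - a)) := fun i => by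
    refine Fin.cases ?_ (fun j => ?_) i
    · rw [abs_of_nonneg hu0]; linarith
    · have h1 : u j.succ ^ 2 ≤ ∑ i : Fin n, u i.succ ^ 2 :=
        Finset.single_le_sum (f := fun i : Fin n => u i.succ ^ 2) (fun i _ => sq_nonneg _)
          (Finset.mem_univ j)
      have h2 : |u j.succ| ≤ 2 * u 0 := by
        refine abs_le_of_sq_le_sq ?_ (by linarith)
        nlinarith [sq_nonneg (u 0)]
      linarith
  refine ⟨z, ?_, (funext hz).symm⟩
  have hboundz : ∀ i, |z i| ≤ N := fun i => by
    have h1 : ((|z i| : ℤ) : ℝ) ≤ N := by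
      rw [Int.cast_abs, ← hz]
      exact (hbound i).trans (Int.le_ceil _)
    exact_mod_cast h1
  exact ⟨fun i => (abs_le.mp (hboundz i)).1, fun i => (abs_le.mp (hboundz i)).2⟩

/-- The translates of the cone under the group generated by the simple reflections cover `ℭ`: of
the images of a point, the one closest to a fixed integral point `ρ` in the interior of the
cone lies in the cone. -/
theorem exists_mem_wallCone (h : IsSimpleSystem e) {x : V n} (hx : x ∈ cone n) :
    ∃ w ∈ simpleGroup e, w x ∈ wallCone e := by
  obtain ⟨ρ, hρl, hρ, hneg⟩ := h.interior
  have hW : simpleGroup e ≤ Theta n := h.simpleGroup_le_Gam.trans Gam_le_Theta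
  set T : Set (V n) := {u | (∃ w ∈ simpleGroup e, u = w ρ) ∧ -form x u ≤ -form x ρ} with hT
  have hfin : T.Finite := (finite_lattice_bounded hx (-form x ρ)).subset <| by
    rintro _ ⟨⟨w, hw, rfl⟩, hle⟩
    exact ⟨((hW hw).2 ρ).mpr hρl, cone_subset_fcone (((hW hw).1.2 ρ).mpr hρ), hle⟩
  obtain ⟨u, ⟨⟨w, hw, rfl⟩, hle⟩, hmin⟩ := T.exists_min_image (fun u => -form x u) hfin
    ⟨ρ, ⟨1, one_mem _, rfl⟩, le_rfl⟩
  refine ⟨w⁻¹, inv_mem hw, fun i => ?_⟩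
  by_contra hcon
  rw [not_le] at hcon
  have hpos := (h.root i).pos
  have hi := refl_mem_simpleGroup (e := e) i
  have hval : form x ((w * refl (e i)) ρ) = form x (w ρ) -
      2 * form (e i) ρ / form (e i) (e i) * form (e i) (w⁻¹ x) := by
    rw [LinearEquiv.mul_apply, refl_apply, map_sub, map_smul, form_sub_right, form_smul_right,
      form_comm x (w (e i)), Isom_form_left (hW hw).1]
  have hc : 2 * form (e i) ρ / form (e i) (e i) < 0 :=
    div_neg_of_neg_of_pos (by linarith [hneg i]) hpos
  have hlt := mul_neg_of_neg_of_pos hc hcon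
  have := hmin ((w * refl (e i)) ρ) ⟨⟨_, mul_mem hw hi, rfl⟩, by rw [hval]; linarith⟩
  rw [hval] at this
  linarith

/-- The reflection in a simple root permutes the positive roots not proportional to it. -/
lemma refl_nonpos [Finite ι] (h : IsSimpleSystem e) {r : V n} (hr : IsRoot r)
    (hneg : ∀ x ∈ wallCone e, form r x ≤ 0) (i : ι) (hne : ∀ c : ℝ, r ≠ c • e i) :
    ∀ x ∈ wallCone e, form (refl (e i) r) x ≤ 0 := by
  obtain ⟨y, -, hy0, hy⟩ := h.exists_wall_point i
  have hymem : y ∈ wallCone e := fun j => by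
    by_cases hj : j = i
    · subst hj; exact hy0.le
    · exact (hy j hj).le
  have hlt : form r y < 0 := lt_of_le_of_ne (hneg y hymem) fun h0 => by
    obtain ⟨c, hc⟩ := h.eq_smul_of_wall_point hy0 hy hneg h0
    exact hne c hc
  have hfix : refl (e i) y = y := by rw [refl_apply, hy0]; simp
  rcases h.sign _ (hr.map (h.root i).refl_mem_Theta) with h' | h'
  · exact h'
  · have := h' y hymem
    rw [form_refl_left (h.root i).pos, hfix] at this
    linarith

lemma exists_form_pos (h : IsSimpleSystem e) {r : V n} (hr : IsRoot r) :
    ∃ i, 0 < form (e i) r := by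
  by_contra hcon
  push Not at hcon
  exact absurd (h.light (show r ∈ wallCone e from hcon)).1 (not_le.mpr hr.pos)

/-- Every reflection in a root belongs to the group generated by the simple reflections. -/
lemma refl_mem_simpleGroup_of_root [Finite ι] (h : IsSimpleSystem e) {r : V n} (hr : IsRoot r) :
    refl r ∈ simpleGroup e := by
  obtain ⟨ρ, hρl, hρ, hint⟩ := h.interior
  have hρmem : ρ ∈ wallCone e := fun i => (hint i).le
  have key : ∀ k : ℕ, ∀ r, IsRoot r → (∀ x ∈ wallCone e, form r x ≤ 0) → -form r ρ = k →
      refl r ∈ simpleGroup e := by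
    intro k
    induction k using Nat.strong_induction_on with
    | _ k ih =>
      intro r hr hneg hk
      obtain ⟨i, hi⟩ := h.exists_form_pos hr
      have hpos := (h.root i).pos
      by_cases hprop : ∃ c : ℝ, r = c • e i
      · obtain ⟨c, rfl⟩ := hprop
        rw [refl_smul (by rintro rfl; simp at hi)]
        exact refl_mem_simpleGroup i
      push Not at hprop
      have hneg' := h.refl_nonpos hr hneg i hprop
      have hr' := hr.map (h.root i).refl_mem_Theta
      obtain ⟨m, hm⟩ := form_mem_int hr'.1 hρl
      have hm0 : m ≤ 0 := by
        have := hneg' ρ hρmem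
        rw [hm] at this
        exact_mod_cast this
      have hmk : -form (refl (e i) r) ρ = ((-m).toNat : ℕ) := by
        rw [hm]
        have : ((-m).toNat : ℤ) = -m := Int.toNat_of_nonneg (by omega)
        have : (((-m).toNat : ℤ) : ℝ) = ((-m : ℤ) : ℝ) := by rw [this]
        push_cast at this
        linarith
      have hlt : (-m).toNat < k := by
        have : ((-m).toNat : ℝ) < k := by
          rw [← hmk, ← hk, refl_apply, form_sub_left, form_smul_left]
          have := mul_neg_of_pos_of_neg (div_pos (mul_pos two_pos hi) hpos) (hint i)
          linarith
        exact_mod_cast this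
      have := ih _ hlt _ hr' hneg' hmk
      rw [← refl_conj (refl_mem_Isom hpos)] at this
      have hS := refl_mem_simpleGroup (e := e) i
      have h2 := mul_mem (mul_mem (inv_mem hS) this) hS
      simpa [mul_assoc] using h2
  have hnat : ∀ r, IsRoot r → (∀ x ∈ wallCone e, form r x ≤ 0) → refl r ∈ simpleGroup e := by
    intro r hr hneg
    obtain ⟨m, hm⟩ := form_mem_int hr.1 hρl
    have hm0 : m ≤ 0 := by
      have := hneg ρ hρmem
      rw [hm] at this
      exact_mod_cast this
    refine key (-m).toNat r hr hneg ?_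
    rw [hm]
    have : (((-m).toNat : ℤ) : ℝ) = ((-m : ℤ) : ℝ) := by rw [Int.toNat_of_nonneg (by omega)]
    push_cast at this
    linarith
  rcases h.sign r hr with h' | h'
  · exact hnat r hr h'
  · have := hnat (-r) hr.neg fun x hx => by rw [form_neg_left]; linarith [h' x hx]
    rwa [← neg_one_smul ℝ, refl_smul (by norm_num)] at this

theorem Gam_eq_simpleGroup [Finite ι] (h : IsSimpleSystem e) : Gam n = simpleGroup e := by
  refine le_antisymm ((Subgroup.closure_le _).mpr ?_) h.simpleGroup_le_Gam
  rintro g ⟨hg, r, hr⟩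
  obtain ⟨z, hz, c, hc, rfl⟩ := exists_root_of_reflection hg hr
  rw [SetLike.mem_coe, hr.eq_refl, refl_smul hc]
  exact h.refl_mem_simpleGroup_of_root hz

/-- The product of the simple reflections with the listed indices. -/
noncomputable def _root_.HypRefl.word (e : ι → V n) (l : List ι) : V n ≃ₗ[ℝ] V n :=
  (l.map fun i => refl (e i)).prod

lemma word_mem (h : IsSimpleSystem e) (l : List ι) : word e l ∈ Theta n := by
  refine Subgroup.list_prod_mem _ fun g hg => ?_
  obtain ⟨i, -, rfl⟩ := List.mem_map.mp hg
  exact (h.root i).refl_mem_Theta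

lemma exists_word {w : V n ≃ₗ[ℝ] V n} (hw : w ∈ simpleGroup e) : ∃ l, w = word e l := by
  induction hw using Subgroup.closure_induction with
  | mem x hx =>
    obtain ⟨i, rfl⟩ := hx
    exact ⟨[i], by simp [word]⟩
  | one => exact ⟨[], by simp [word]⟩
  | mul x y _ _ hx hy =>
    obtain ⟨l, rfl⟩ := hx
    obtain ⟨m, rfl⟩ := hy
    exact ⟨l ++ m, by simp [word]⟩
  | inv x _ hx =>
    obtain ⟨l, rfl⟩ := hx
    refine ⟨l.reverse, ?_⟩
    rw [word, word, List.prod_inv_reverse, List.map_map, List.map_reverse]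
    congr 2

/-- If a product of simple reflections makes a positive root negative, then one of its factors
does, and at that moment the root is proportional to the simple root. -/
lemma exists_factor [Finite ι] (h : IsSimpleSystem e) {r : V n} (hr : IsRoot r)
    (hneg : ∀ x ∈ wallCone e, form r x ≤ 0) (l : List ι)
    (hl : ¬ ∀ x ∈ wallCone e, form (word e l r) x ≤ 0) :
    ∃ l₁ j l₂, l = l₁ ++ j :: l₂ ∧ ∃ c : ℝ, word e l₂ r = c • e j := by
  induction l with
  | nil => exact absurd (by simpa [word] using hneg) hl
  | cons j l ih =>
    by_cases h' : ∀ x ∈ wallCone e, form (word e l r) x ≤ 0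
    · refine ⟨[], j, l, rfl, ?_⟩
      by_contra hcon
      push Not at hcon
      refine hl ?_
      have := h.refl_nonpos (hr.map (h.word_mem l)) h' j hcon
      simpa [word] using this
    · obtain ⟨l₁, j', l₂, rfl, hc⟩ := ih h'
      exact ⟨j :: l₁, j', l₂, rfl, hc⟩

/-- A product of simple reflections which preserves the cone is the identity: by the deletion
argument, a nonempty product of this kind is not of minimal length. -/
lemma word_eq_one [Finite ι] (h : IsSimpleSystem e) (l : List ι)
    (hl : ∀ x ∈ wallCone e, (word e l)⁻¹ x ∈ wallCone e) : word e l = 1 := by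
  obtain ⟨N, hN⟩ : ∃ N, l.length = N := ⟨_, rfl⟩
  induction N using Nat.strong_induction_on generalizing l with
  | _ N ih =>
    rcases List.eq_nil_or_concat' l with rfl | ⟨l', k, rfl⟩
    · simp [word]
    have hw : word e (l' ++ [k]) = word e l' * refl (e k) := by simp [word]
    have hI := (h.word_mem (l' ++ [k])).1
    -- the product without its last factor makes the root `e k` negative
    have hflip : ¬ ∀ x ∈ wallCone e, form (word e l' (e k)) x ≤ 0 := fun hcon => by
      obtain ⟨ρ, -, -, hint⟩ := h.interior
      have hval : ∀ x, form (word e l' (e k)) x = -form (word e (l' ++ [k]) (e k)) x := fun x => by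
        rw [hw, LinearEquiv.mul_apply, refl_self (h.root k).pos, map_neg, form_neg_left, neg_neg]
      have hzero : ∀ x ∈ wallCone e, form (word e l' (e k)) x = 0 := fun x hx => by
        refine le_antisymm (hcon x hx) ?_
        rw [hval, Isom_form_left hI]
        have := hl x hx k
        linarith
      have hperp : ∀ v, form (word e l' (e k)) v = 0 := fun v => by
        obtain ⟨t, ht, ⟨h1, -⟩, -⟩ := exists_small_mem_wallCone (e := e) (y := ρ) (v := v)
          (fun i => Or.inl (hint i)) isOpen_univ (mem_univ _)
        have h1 := hzero _ h1
        rw [form_add_right, form_smul_right, hzero ρ fun i => (hint i).le, zero_add] at h1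
        exact (mul_eq_zero.mp h1).resolve_left ht.ne'
      have := ((h.root k).map (h.word_mem l')).pos
      rw [form_nondegenerate hperp] at this
      simp at this
    obtain ⟨l₁, j, l₂, rfl, c, hc⟩ := h.exists_factor (h.root k)
      (fun x hx => hx k) l' hflip
    have hc0 : c ≠ 0 := by
      rintro rfl
      have := ((h.root k).map (h.word_mem l₂)).pos
      rw [hc] at this
      simp at this
    have hconj : refl (e j) = word e l₂ * refl (e k) * (word e l₂)⁻¹ := by
      rw [refl_conj (h.word_mem l₂).1, hc, refl_smul hc0]
    have hshort : word e (l₁ ++ j :: l₂ ++ [k]) = word e (l₁ ++ l₂) := by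
      have h1 : word e (l₁ ++ j :: l₂ ++ [k]) =
          word e l₁ * (refl (e j) * (word e l₂ * refl (e k))) := by simp [word]
      have h2 : word e (l₁ ++ l₂) = word e l₁ * word e l₂ := by simp [word]
      rw [h1, h2, hconj]
      congr 1
      rw [mul_assoc, inv_mul_cancel_left, mul_assoc, refl_mul_self, mul_one]
    rw [hshort] at hl ⊢
    refine ih (l₁ ++ l₂).length ?_ _ hl rfl
    simp only [List.length_append, List.length_cons, List.length_nil] at hN ⊢
    omega

/-- The group `Γ` acts simply transitively on its cells: an element mapping the cone into itself
is the identity. -/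
theorem eq_one_of_mem_Gam [Finite ι] (h : IsSimpleSystem e) {g : V n ≃ₗ[ℝ] V n} (hg : g ∈ Gam n)
    (hC : ∀ x ∈ wallCone e, g⁻¹ x ∈ wallCone e) : g = 1 := by
  rw [h.Gam_eq_simpleGroup] at hg
  obtain ⟨l, rfl⟩ := exists_word hg
  exact h.word_eq_one l hC

end IsSimpleSystem

end SimpleSystem

/-! ### Cells -/

section Cells

variable {n : ℕ} {ι : Type*}

/-- The points of `ℍⁿ` strictly inside the cone cut out by the halfspaces `(e i, ·) ≤ 0`. -/
def openCell (e : ι → V n) : Set (V n) := {x | x ∈ hyp n ∧ ∀ i, form (e i) x < 0}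

lemma toHyp_mem_wallCone {e : ι → V n} {x : V n} (hx : x ∈ wallCone e) : toHyp x ∈ wallCone e :=
  smul_mem_wallCone hx (inv_nonneg.mpr (Real.sqrt_nonneg _))

lemma toHyp_mem_openCell {e : ι → V n} {x : V n} (hx : x ∈ cone n) (h : ∀ i, form (e i) x < 0) :
    toHyp x ∈ openCell e :=
  ⟨toHyp_mem hx, fun i => by
    rw [toHyp, form_smul_right]
    exact mul_neg_of_pos_of_neg (inv_pos.mpr (sqrt_pos_of_mem_cone hx)) (h i)⟩

lemma isPreconnected_openCell (e : ι → V n) : IsPreconnected (openCell e) := by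
  set K : Set (V n) := {x | x ∈ cone n ∧ ∀ i, form (e i) x < 0} with hK
  have hconv : Convex ℝ K := by
    rw [convex_iff_forall_pos]
    intro x hx y hy a b ha hb _
    refine ⟨add_mem_cone (smul_mem_cone hx.1 ha) (cone_subset_fcone (smul_mem_cone hy.1 hb)),
      fun i => ?_⟩
    rw [form_add_right, form_smul_right, form_smul_right]
    have h1 := mul_neg_of_pos_of_neg ha (hx.2 i)
    have h2 := mul_neg_of_pos_of_neg hb (hy.2 i)
    linarith
  have himg : toHyp '' K = openCell e := by
    ext x
    constructor
    · rintro ⟨y, hy, rfl⟩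
      exact toHyp_mem_openCell hy.1 hy.2
    · intro hx
      exact ⟨x, ⟨hx.1.1, hx.2⟩, toHyp_of_mem_hyp hx.1⟩
  rw [← himg]
  exact hconv.isPreconnected.image _ (continuousOn_toHyp.mono fun x hx => hx.1)

lemma isClosed_wallCone (e : ι → V n) : IsClosed (wallCone e) := by
  have : wallCone e = ⋂ i, {x | form (e i) x ≤ 0} := by ext x; simp [wallCone]
  rw [this]
  exact isClosed_iInter fun i => isClosed_le (by fun_prop) continuous_const

lemma isClosed_hyp : IsClosed (hyp n) := by
  have : hyp n = {x | form x x = -1} ∩ {x | 0 ≤ x 0} := by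
    ext x
    constructor
    · exact fun h => ⟨h.2, h.1.2.le⟩
    · rintro ⟨h1, h2⟩
      have h1' : form x x = -1 := h1
      have hx : x ∈ fcone n := ⟨by rw [h1']; norm_num, h2⟩
      refine ⟨⟨by rw [h1']; norm_num, fcone_pos hx ?_⟩, h1⟩
      rintro rfl
      simp at h1'
  rw [this]
  exact (isClosed_eq (by fun_prop) continuous_const).inter
    (isClosed_le continuous_const (by fun_prop))

namespace IsSimpleSystem

variable {e : ι → V n}

lemma openCell_subset_mirrorComplement [Finite ι] (h : IsSimpleSystem e) :
    openCell e ⊆ mirrorComplement n := by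
  intro x hx
  refine ⟨hx.1, fun g hg r hr h0 => ?_⟩
  obtain ⟨z, hz, c, hc, rfl⟩ := exists_root_of_reflection (Gam_le_Theta hg) hr
  have hzx : form z x = 0 := by
    rw [form_smul_left] at h0
    exact (mul_eq_zero.mp h0).resolve_left hc
  have hperp : ∀ v, form z v = 0 := fun v => by
    obtain ⟨t, ht, ⟨h1, -⟩, h2, -⟩ := exists_small_mem_wallCone (e := e) (y := x) (v := v)
      (fun i => Or.inl (hx.2 i)) isOpen_univ (mem_univ _)
    have : t * form z v = 0 := by
      rcases h.sign z hz with h' | h'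
      all_goals
        have h1 := h' _ h1
        have h2 := h' _ h2
        rw [form_add_right, form_smul_right, hzx] at h1
        rw [form_sub_right, form_smul_right, hzx] at h2
        linarith
    exact (mul_eq_zero.mp this).resolve_left ht.ne'
  have := hz.pos
  rw [form_nondegenerate hperp] at this
  simp at this

lemma form_ne_zero (h : IsSimpleSystem e) {x : V n} (hx : x ∈ mirrorComplement n) (i : ι) :
    form (e i) x ≠ 0 :=
  hx.2 _ (h.root i).refl_mem_Gam _ (isReflectionIn_refl (h.root i).pos)

lemma component_eq [Finite ι] (h : IsSimpleSystem e) {x : V n} (hx : x ∈ openCell e) :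
    connectedComponentIn (mirrorComplement n) x = openCell e := by
  have hxm := h.openCell_subset_mirrorComplement hx
  have hxC := mem_connectedComponentIn hxm
  refine Subset.antisymm (fun y hy => ?_)
    ((isPreconnected_openCell e).subset_connectedComponentIn hx h.openCell_subset_mirrorComplement)
  have hym := connectedComponentIn_subset _ _ hy
  refine ⟨hym.1, fun i => ?_⟩
  by_contra hcon
  have hcont : Continuous fun v : V n => form (e i) v := by fun_prop
  obtain ⟨z, hz, hz0⟩ := isPreconnected_connectedComponentIn.intermediate_value hxC hy
    hcont.continuousOn ⟨(hx.2 i).le, not_lt.mp hcon⟩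
  exact h.form_ne_zero (connectedComponentIn_subset _ _ hz) i hz0

lemma tendsto_add_smul (x ρ : V n) :
    Tendsto (fun t : ℝ => x + t • ρ) (𝓝[>] 0) (𝓝 x) := by
  have hc : Continuous fun t : ℝ => x + t • ρ := by fun_prop
  have := hc.tendsto 0
  simp only [zero_smul, add_zero] at this
  exact this.mono_left nhdsWithin_le_nhds

lemma closure_openCell (h : IsSimpleSystem e) : closure (openCell e) = wallCone e ∩ hyp n := by
  obtain ⟨ρ, -, hρ, hint⟩ := h.interior
  refine Subset.antisymm (closure_minimal (fun x hx => ⟨fun i => (hx.2 i).le, hx.1⟩)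
    ((isClosed_wallCone e).inter isClosed_hyp)) ?_
  rintro x ⟨hxC, hx⟩
  have hct : ContinuousAt (toHyp : V n → V n) x :=
    continuousOn_toHyp.continuousAt (isOpen_cone.mem_nhds hx.1)
  have ht : Tendsto (fun t : ℝ => toHyp (x + t • ρ)) (𝓝[>] 0) (𝓝 x) := by
    have := hct.tendsto.comp (tendsto_add_smul x ρ)
    rwa [toHyp_of_mem_hyp hx] at this
  refine mem_closure_of_tendsto ht ?_
  filter_upwards [self_mem_nhdsWithin] with t ht
  have ht : 0 < t := ht
  refine toHyp_mem_openCell (add_mem_cone hx.1 (cone_subset_fcone (smul_mem_cone hρ ht)))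
    fun i => ?_
  rw [form_add_right, form_smul_right]
  have := mul_neg_of_pos_of_neg ht (hint i)
  linarith [hxC i]

lemma closure_component [Finite ι] (h : IsSimpleSystem e) {x : V n} (hx : x ∈ openCell e) :
    closure (connectedComponentIn (mirrorComplement n) x) = wallCone e ∩ hyp n := by
  rw [h.component_eq hx, h.closure_openCell]

/-- Every `Γ`-cell is the image of the cell of a given system of simple roots under an element
of `Γ`. -/
theorem exists_of_isCell [Finite ι] (h : IsSimpleSystem e) {P : Set (V n)} (hP : IsCell n P) :
    ∃ g ∈ Gam n, P = wallCone (fun i => g (e i)) ∩ hyp n := by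
  obtain ⟨x, hx, rfl⟩ := hP
  obtain ⟨w, hw, hwx⟩ := h.exists_mem_wallCone hx.1.1
  have hwG := inv_mem (h.simpleGroup_le_Gam hw)
  have h' := h.map (Gam_le_Theta hwG)
  refine ⟨w⁻¹, hwG, h'.closure_component ⟨hx.1, fun i => ?_⟩⟩
  refine lt_of_le_of_ne ?_ (h'.form_ne_zero hx i)
  rw [Isom_form_left (Gam_le_Theta hwG).1, inv_inv]
  exact hwx i

lemma form_nonpos_of_cell (h : IsSimpleSystem e) {r : V n}
    (hr : ∀ x ∈ wallCone e ∩ hyp n, form r x ≤ 0) : ∀ x ∈ wallCone e, form r x ≤ 0 := by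
  obtain ⟨ρ, -, hρ, hint⟩ := h.interior
  intro x hx
  have hcont : Continuous fun v : V n => form r v := by fun_prop
  refine le_of_tendsto (hcont.continuousAt.tendsto.comp (tendsto_add_smul x ρ)) ?_
  filter_upwards [self_mem_nhdsWithin] with t ht
  have ht : 0 < t := ht
  have hmem : x + t • ρ ∈ cone n := by
    rw [add_comm]; exact add_mem_cone (smul_mem_cone hρ ht) (h.light hx)
  have hw : x + t • ρ ∈ wallCone e :=
    add_mem_wallCone hx (smul_mem_wallCone (fun i => (hint i).le) ht.le)
  have := hr _ ⟨toHyp_mem_wallCone hw, toHyp_mem hmem⟩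
  rw [toHyp, form_smul_right] at this
  by_contra hcon
  exact absurd this (not_le.mpr (mul_pos (inv_pos.mpr (sqrt_pos_of_mem_cone hmem))
    (not_le.mp hcon)))

lemma Sym_mem_wallCone (h : IsSimpleSystem e) {g : V n ≃ₗ[ℝ] V n}
    (hg : g ∈ Sym (wallCone e ∩ hyp n)) {x : V n} (hx : x ∈ wallCone e) : g x ∈ wallCone e := by
  intro i
  have key : ∀ y, form (g⁻¹ (e i)) y = form (e i) (g y) := fun y => by
    rw [Isom_form_left (inv_mem hg.1), inv_inv]
  rw [← key]
  exact h.form_nonpos_of_cell (fun y hy => by rw [key]; exact ((hg.2 y).mpr hy).1 i) x hx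

lemma eq_one_of_mem_Gam_of_mem_Sym [Finite ι] (h : IsSimpleSystem e) {g : V n ≃ₗ[ℝ] V n}
    (hg : g ∈ Gam n) (hS : g ∈ Sym (wallCone e ∩ hyp n)) : g = 1 :=
  h.eq_one_of_mem_Gam hg fun _ hx => h.Sym_mem_wallCone (inv_mem hS) hx

/-- Every element of `Θ_n` can be multiplied by an element of `Γ` so as to preserve the cell. -/
lemma exists_mul_mem_Sym [Finite ι] (h : IsSimpleSystem e) {g : V n ≃ₗ[ℝ] V n}
    (hg : g ∈ Theta n) : ∃ w ∈ Gam n, w * g ∈ Sym (wallCone e ∩ hyp n) := by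
  obtain ⟨ρ, -, hρ, hint⟩ := h.interior
  set x := toHyp ρ with hxdef
  have hx : x ∈ openCell e := toHyp_mem_openCell hρ hint
  obtain ⟨w, hw, hwx⟩ := h.exists_mem_wallCone ((hg.1.2 x).mpr hx.1.1)
  have hwG := h.simpleGroup_le_Gam hw
  have hu := mul_mem (Gam_le_Theta hwG) hg
  set u := w * g with hudef
  have h' := h.map hu
  have hux : u x ∈ openCell fun i => u (e i) :=
    ⟨(Isom_hyp hu.1 x).mpr hx.1, fun i => by rw [Isom_form hu.1]; exact hx.2 i⟩
  have hux' : u x ∈ openCell e := ⟨hux.1, fun i => lt_of_le_of_ne (hwx i)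
    (h.form_ne_zero (h'.openCell_subset_mirrorComplement hux) i)⟩
  have heq : wallCone (fun i => u (e i)) ∩ hyp n = wallCone e ∩ hyp n := by
    rw [← h'.closure_component hux, ← h.closure_component hux']
  refine ⟨w, hwG, hu.1, fun v => ?_⟩
  conv_lhs => rw [← heq]
  rw [mem_inter_iff, mem_inter_iff, map_mem_wallCone hu.1, inv_apply_apply, Isom_hyp hu.1]

theorem isSemidirect [Finite ι] (h : IsSimpleSystem e)
    (hS : Sym (wallCone e ∩ hyp n) ≤ Theta n) :
    IsSemidirect (Theta n) (Gam n) (Sym (wallCone e ∩ hyp n)) := by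
  refine ⟨Gam_le_Theta, hS, ⟨fun a ha g => ?_⟩, ?_⟩
  · exact Gam_conj g.2 ha
  · refine Subgroup.isComplement'_of_disjoint_and_mul_eq_univ ?_ ?_
    · rw [Subgroup.disjoint_def]
      intro a h1 h2
      exact Subtype.ext (h.eq_one_of_mem_Gam_of_mem_Sym h1 h2)
    · refine eq_univ_of_forall fun a => ?_
      obtain ⟨w, hw, hwa⟩ := h.exists_mul_mem_Sym a.2
      refine Set.mem_mul.mpr ⟨⟨w⁻¹, Gam_le_Theta (inv_mem hw)⟩, inv_mem hw,
        ⟨w * a, mul_mem (Gam_le_Theta hw) a.2⟩, hwa, ?_⟩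
      ext1
      simp

theorem eq_Sym_of_isSemidirect [Finite ι] (h : IsSimpleSystem e)
    (hS : Sym (wallCone e ∩ hyp n) ≤ Theta n) {H : Subgroup (V n ≃ₗ[ℝ] V n)}
    (hH : H ≤ Sym (wallCone e ∩ hyp n)) (hsd : IsSemidirect (Theta n) (Gam n) H) :
    H = Sym (wallCone e ∩ hyp n) := by
  refine le_antisymm hH fun g hg => ?_
  obtain ⟨-, -, -, hc⟩ := hsd
  obtain ⟨⟨a, b⟩, hab⟩ := hc.2 ⟨g, hS hg⟩
  have hab' : (a : Theta n).1 * (b : Theta n).1 = g := congrArg Subtype.val hab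
  have hb : (b : Theta n).1 ∈ H := b.2
  have ha : (a : Theta n).1 ∈ Gam n := a.2
  have : (a : Theta n).1 ∈ Sym (wallCone e ∩ hyp n) := by
    rw [eq_mul_inv_of_mul_eq hab']
    exact mul_mem hg (inv_mem (hH hb))
  rw [h.eq_one_of_mem_Gam_of_mem_Sym ha this, one_mul] at hab'
  exact hab' ▸ hb

/-! ### Faces and ideal vertices -/

/-- The unit vectors on the rays of the simple roots. -/
noncomputable def _root_.HypRefl.unitRoot (e : ι → V n) (i : ι) : V n :=
  (Real.sqrt (form (e i) (e i)))⁻¹ • e i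

lemma sqrt_pos (h : IsSimpleSystem e) (i : ι) : 0 < Real.sqrt (form (e i) (e i)) :=
  Real.sqrt_pos.mpr (h.root i).pos

lemma form_unitRoot_eq_zero (h : IsSimpleSystem e) (i : ι) (v : V n) :
    form (unitRoot e i) v = 0 ↔ form (e i) v = 0 := by
  rw [unitRoot, form_smul_left, mul_eq_zero, or_iff_right (inv_pos.mpr (h.sqrt_pos i)).ne']

lemma form_unitRoot_self (h : IsSimpleSystem e) (i : ι) :
    form (unitRoot e i) (unitRoot e i) = 1 := by
  have h1 := (h.sqrt_pos i).ne'
  rw [unitRoot, form_smul_left, form_smul_right]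
  field_simp
  exact (Real.sq_sqrt (h.root i).pos.le).symm

lemma unitRoot_injective (h : IsSimpleSystem e) : Function.Injective (unitRoot e) := by
  intro i j hij
  by_contra hne
  have h1 := h.form_unitRoot_self i
  have h2 : form (unitRoot e i) (unitRoot e j) ≤ 0 := by
    rw [unitRoot, unitRoot, form_smul_left, form_smul_right]
    exact mul_nonpos_of_nonneg_of_nonpos (inv_pos.mpr (h.sqrt_pos i)).le
      (mul_nonpos_of_nonneg_of_nonpos (inv_pos.mpr (h.sqrt_pos j)).le (h.acute i j hne))
  rw [← hij, h1] at h2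
  linarith

/-- The faces of codimension one of the cell are its intersections with the mirrors of the simple
roots. -/
theorem faceNormals_eq [Finite ι] (h : IsSimpleSystem e) :
    faceNormals (wallCone e ∩ hyp n) = range (unitRoot e) := by
  have := Fintype.ofFinite ι
  obtain ⟨ρ, -, hρ, hint⟩ := h.interior
  refine Subset.antisymm ?_ ?_
  · rintro f ⟨hf1, hf2, hf3⟩
    have hfC := h.form_nonpos_of_cell hf2
    by_cases hex : ∃ i, ∀ y ∈ wallCone e ∩ hyp n, form f y = 0 → form (e i) y = 0
    · obtain ⟨i, hi⟩ := hex
      have hspan : ∀ v, form f v = 0 → form (e i) v = 0 := fun v hv => by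
        have hle : Submodule.span ℝ {y | y ∈ wallCone e ∩ hyp n ∧ form f y = 0} ≤
            LinearMap.ker (formL (e i)) :=
          Submodule.span_le.mpr fun y hy => LinearMap.mem_ker.mpr (hi y hy.1 hy.2)
        exact LinearMap.mem_ker.mp (hle (hf3 v hv))
      set c := form (e i) f with hc
      have hec : e i = c • f := sub_eq_zero.mp <| form_nondegenerate fun y => by
        have := hspan (y - form f y • f) (by
          rw [form_sub_right, form_smul_right, hf1, mul_one, sub_self])
        rw [form_sub_right, form_smul_right] at this
        rw [form_sub_left, form_smul_left, ← this]
        ring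
      have hcpos : 0 < c := by
        have h1 := hint i
        rw [hec, form_smul_left] at h1
        have h2 := hfC ρ fun i => (hint i).le
        by_contra hcon
        have := mul_nonneg_of_nonpos_of_nonpos (not_lt.mp hcon) h2
        linarith
      refine ⟨i, ?_⟩
      have hsq : form (e i) (e i) = c * c := by
        rw [hec, form_smul_left, form_smul_right, hf1, mul_one]
      rw [unitRoot, hsq, Real.sqrt_mul_self hcpos.le]
      conv_lhs => rw [hec]
      rw [smul_smul, inv_mul_cancel₀ hcpos.ne', one_smul]
    · -- otherwise an inner point of the cone lies on the hyperplane orthogonal to `f`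
      exfalso
      push Not at hex
      choose y hyP hy0 hy using hex
      have hsum : ∀ i, form (e i) (∑ j, y j) < 0 := fun i => by
        rw [form_sum_right]
        exact Finset.sum_neg' (fun j _ => (hyP j).1 i)
          ⟨i, Finset.mem_univ i, lt_of_le_of_ne ((hyP i).1 i) (hy i)⟩
      have hsum0 : form f (∑ j, y j) = 0 := by
        rw [form_sum_right]; exact Finset.sum_eq_zero fun j _ => hy0 j
      obtain ⟨t, ht, ⟨h1, -⟩, -⟩ := exists_small_mem_wallCone (e := e) (y := ∑ j, y j) (v := f)
        (fun i => Or.inl (hsum i)) isOpen_univ (mem_univ _)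
      have := hfC _ h1
      rw [form_add_right, form_smul_right, hsum0, hf1] at this
      linarith
  · rintro _ ⟨i, rfl⟩
    refine ⟨h.form_unitRoot_self i, fun y hy => ?_, fun v hv => ?_⟩
    · rw [unitRoot, form_smul_left]
      exact mul_nonpos_of_nonneg_of_nonpos (inv_pos.mpr (h.sqrt_pos i)).le (hy.1 i)
    · rw [h.form_unitRoot_eq_zero] at hv
      obtain ⟨y, hyc, hy0, hy⟩ := h.exists_wall_point i
      obtain ⟨t, ht, ⟨h1, h2⟩, h3, h4⟩ := exists_small_mem_wallCone (e := e) (y := y) (v := v)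
        (fun j => by
          by_cases hj : j = i
          · subst hj; exact Or.inr ⟨hy0, hv⟩
          · exact Or.inl (hy j hj)) isOpen_cone hyc
      set S := {y | y ∈ wallCone e ∩ hyp n ∧ form (unitRoot e i) y = 0} with hS
      have key : ∀ x ∈ wallCone e, x ∈ cone n → form (e i) x = 0 →
          x ∈ Submodule.span ℝ S := by
        intro x hx hxc hx0
        have hmem : toHyp x ∈ S := by
          refine ⟨⟨toHyp_mem_wallCone hx, toHyp_mem hxc⟩, ?_⟩
          rw [h.form_unitRoot_eq_zero, toHyp, form_smul_right, hx0, mul_zero]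
        have := Submodule.smul_mem _ (Real.sqrt (-form x x)) (Submodule.subset_span hmem)
        rwa [toHyp, smul_smul, mul_inv_cancel₀ (sqrt_pos_of_mem_cone hxc).ne', one_smul] at this
      have h5 := key _ h1 h2 (by rw [form_add_right, form_smul_right, hy0, hv]; ring)
      have h6 := key _ h3 h4 (by rw [form_sub_right, form_smul_right, hy0, hv]; ring)
      have h7 := Submodule.smul_mem _ (2 * t)⁻¹ (Submodule.sub_mem _ h5 h6)
      have h8 : (2 * t)⁻¹ • (y + t • v - (y - t • v)) = v := by
        rw [add_sub_sub_cancel, ← two_smul ℝ, smul_smul, smul_smul, mul_assoc,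
          inv_mul_cancel₀ (mul_ne_zero two_ne_zero ht.ne'), one_smul]
      rwa [h8] at h7

/-- The ideal vertices of the cell are the isotropic rays of the cone: that an isotropic ray is a
vertex is automatic, as the cone lies in the light cone. -/
theorem idealVertices_eq [Finite ι] (h : IsSimpleSystem e) :
    idealVertices (wallCone e ∩ hyp n) = {q | q ∈ boundary n ∧ q ∈ wallCone e} := by
  obtain ⟨ρ, -, hρ, hint⟩ := h.interior
  ext q
  constructor
  · rintro ⟨hq, hcl, -⟩
    refine ⟨hq, closure_minimal ?_ (isClosed_wallCone e) hcl⟩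
    rintro _ ⟨c, hc, y, hy, rfl⟩
    exact smul_mem_wallCone hy.1 hc.le
  · rintro ⟨hq, hqC⟩
    have hqf : q ∈ fcone n := ⟨hq.1.le, by rw [hq.2]; norm_num⟩
    refine ⟨hq, ?_, fun v hv => ?_⟩
    · refine mem_closure_of_tendsto (tendsto_add_smul q ρ) ?_
      filter_upwards [self_mem_nhdsWithin] with t ht
      have ht : 0 < t := ht
      have hmem : q + t • ρ ∈ cone n := by
        rw [add_comm]; exact add_mem_cone (smul_mem_cone hρ ht) hqf
      have hw : q + t • ρ ∈ wallCone e :=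
        add_mem_wallCone hqC (smul_mem_wallCone (fun i => (hint i).le) ht.le)
      have hs := sqrt_pos_of_mem_cone hmem
      refine ⟨_, hs, toHyp (q + t • ρ), ⟨toHyp_mem_wallCone hw, toHyp_mem hmem⟩, ?_⟩
      rw [toHyp, smul_smul, mul_inv_cancel₀ hs.ne', one_smul]
    · obtain ⟨t, ht, ⟨h1, -⟩, h2, -⟩ := exists_small_mem_wallCone (e := e) (y := q) (v := v)
        (fun i => by
          rcases (hqC i).lt_or_eq with h' | h'
          · exact Or.inl h'
          · refine Or.inr ⟨h', ?_⟩
            rw [← h.form_unitRoot_eq_zero i]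
            refine hv _ ?_ ((h.form_unitRoot_eq_zero i q).mpr h')
            rw [h.faceNormals_eq]
            exact mem_range_self i) isOpen_univ (mem_univ _)
      have h1 := h.light h1
      have h2 := h.light h2
      have h3 := form_nonpos hqf h1
      have h4 := form_nonpos hqf h2
      rw [form_add_right, form_smul_right, hq.1] at h3
      rw [form_sub_right, form_smul_right, hq.1] at h4
      have h5 : form q v = 0 := (mul_eq_zero.mp (by linarith : t * form q v = 0)).resolve_left ht.ne'
      have h6 := h1.1
      simp only [form_add_left, form_add_right, form_smul_left, form_smul_right, hq.1,
        form_comm v q, h5] at h6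
      refine ⟨_, eq_smul_of_form_eq_zero hq.1 (by rw [hq.2]; norm_num) h5 ?_⟩
      by_contra hcon
      have := mul_pos ht (mul_pos ht (not_le.mp hcon))
      linarith

end IsSimpleSystem

end Cells

/-! ### Symmetries of a cell -/

section Symmetries

variable {n : ℕ} {ι : Type*}

/-- The permutations of the simple roots which preserve the types of all edges of the Coxeter
scheme. -/
def typeAut (e : ι → V n) : Subgroup (Equiv.Perm ι) where
  carrier := {s | ∀ i j : ι, ∀ k : Edge,
    HasEdge (unitRoot e (s i)) (unitRoot e (s j)) k ↔ HasEdge (unitRoot e i) (unitRoot e j) k}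
  mul_mem' := by
    intro s t hs ht i j k
    rw [Equiv.Perm.mul_apply, Equiv.Perm.mul_apply, hs, ht]
  one_mem' := fun _ _ _ => Iff.rfl
  inv_mem' := by
    intro s hs i j k
    have key : ∀ i, s (s⁻¹ i) = i := fun i => s.apply_symm_apply i
    rw [← hs, key, key]

/-- Every type-preserving permutation of the simple roots is induced by an element of `Θ_n`. -/
def Realizable (e : ι → V n) : Prop :=
  ∀ s ∈ typeAut e, ∃ g ∈ Theta n, ∀ i, g (e i) = e (s i)

lemma hasEdge_congr {a b a' b' : V n} (h : form a b = form a' b') (k : Edge) :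
    HasEdge a b k ↔ HasEdge a' b' k := by
  cases k <;> simp only [HasEdge, h]

lemma unitRoot_map {g : V n ≃ₗ[ℝ] V n} (hg : g ∈ Isom n) (e : ι → V n) (i : ι) :
    unitRoot (fun i => g (e i)) i = g (unitRoot e i) := by
  rw [unitRoot, unitRoot, map_smul, Isom_form hg]

lemma typeAut_map {g : V n ≃ₗ[ℝ] V n} (hg : g ∈ Isom n) (e : ι → V n) :
    typeAut (fun i => g (e i)) = typeAut e := by
  have key : ∀ i j k, HasEdge (unitRoot (fun i => g (e i)) i) (unitRoot (fun i => g (e i)) j) k ↔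
      HasEdge (unitRoot e i) (unitRoot e j) k := fun i j k => by
    rw [unitRoot_map hg, unitRoot_map hg]
    exact hasEdge_congr (Isom_form hg _ _) k
  ext s
  change (∀ _ _ _, _ ↔ _) ↔ ∀ _ _ _, _ ↔ _
  simp only [key]

lemma Realizable.map {g : V n ≃ₗ[ℝ] V n} (hg : g ∈ Theta n) {e : ι → V n} (h : Realizable e) :
    Realizable fun i => g (e i) := by
  intro s hs
  rw [typeAut_map hg.1] at hs
  obtain ⟨a, ha, hae⟩ := h s hs
  refine ⟨g * a * g⁻¹, mul_mem (mul_mem hg ha) (inv_mem hg), fun i => ?_⟩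
  rw [LinearEquiv.mul_apply, LinearEquiv.mul_apply, inv_apply_apply, hae]

/-- The vectors `U k` represent the isotropic rays of the cone cut out by `e`, each ray once. -/
structure IsRaySystem {κ : Type*} (e : ι → V n) (U : κ → V n) : Prop where
  mem : ∀ k, U k ∈ wallCone e
  pos : ∀ k, 0 < U k 0
  isotropic : ∀ k, form (U k) (U k) = 0
  complete : ∀ q ∈ wallCone e, form q q = 0 → q ≠ 0 → ∃ k, ∃ c : ℝ, 0 < c ∧ q = c • U k
  distinct : ∀ k k', ∀ c : ℝ, U k = c • U k' → k = k'

lemma IsRaySystem.map {κ : Type*} {e : ι → V n} {U : κ → V n} (h : IsRaySystem e U)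
    {g : V n ≃ₗ[ℝ] V n} (hg : g ∈ Isom n) :
    IsRaySystem (fun i => g (e i)) fun k => g (U k) := by
  refine ⟨fun k => ?_, fun k => ?_, fun k => ?_, fun q hq hqq hq0 => ?_, fun k k' c hc => ?_⟩
  · rw [map_mem_wallCone hg, inv_apply_apply]; exact h.mem k
  · refine fcone_pos (Isom_fcone hg ⟨(h.isotropic k).le, (h.pos k).le⟩) fun h0 => ?_
    have := h.pos k
    rw [LinearEquiv.map_eq_zero_iff] at h0
    rw [h0] at this
    exact lt_irrefl _ this
  · rw [Isom_form hg]; exact h.isotropic k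
  · rw [map_mem_wallCone hg] at hq
    obtain ⟨k, c, hc, hqc⟩ := h.complete _ hq (by rw [Isom_form (inv_mem hg)]; exact hqq)
      (by rwa [Ne, LinearEquiv.map_eq_zero_iff])
    exact ⟨k, c, hc, by rw [← map_smul, ← hqc, apply_inv_apply]⟩
  · rw [← map_smul] at hc
    exact h.distinct k k' c (g.injective hc)

/-- A permutation of generators of the lattice which preserves their scalar products extends to an
integral automorphism of the form. -/
lemma IsSimpleSystem.exists_extension {e : ι → V n} (h : IsSimpleSystem e)
    (hgen : ∀ v ∈ lattice n, v ∈ AddSubgroup.closure (range e)) (s : Equiv.Perm ι)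
    (hs : ∀ i j, form (e (s i)) (e (s j)) = form (e i) (e j)) :
    ∃ g ∈ Theta n, ∀ i, g (e i) = e (s i) := by
  have hspan : ∀ x : V n, x ∈ Submodule.span ℝ (range e) := by
    intro x
    have hx : x = ∑ i, x i • (Pi.single i 1 : V n) := by
      funext j
      simp [Finset.sum_apply, Pi.single_apply]
    rw [hx]
    refine Submodule.sum_mem _ fun i _ => Submodule.smul_mem _ _ ?_
    have hle : AddSubgroup.closure (range e) ≤ (Submodule.span ℝ (range e)).toAddSubgroup :=
      (AddSubgroup.closure_le _).mpr Submodule.subset_span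
    exact hle (hgen _ (single_mem_lattice i))
  -- both for `s` and for its inverse
  have key : ∀ s : Equiv.Perm ι, (∀ i j, form (e (s i)) (e (s j)) = form (e i) (e j)) →
      ∃ g : V n →ₗ[ℝ] V n, (∀ i, g (e i) = e (s i)) ∧ (∀ x y, form (g x) (g y) = form x y) ∧
        (∀ v ∈ lattice n, g v ∈ lattice n) ∧ ∀ v ∈ cone n, g v ∈ cone n := by
    intro s hs
    have huniq : ∀ y y', (∀ i, form (e (s i)) y = form (e (s i)) y') → y = y' := fun y y' hy =>
      h.eq_of_form_eq fun i => by simpa using hy (s.symm i)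
    have hex : ∀ x, ∃ y, ∀ i, form (e (s i)) y = form (e i) x := by
      intro x
      induction hspan x using Submodule.span_induction with
      | mem x hx =>
        obtain ⟨j, rfl⟩ := hx
        exact ⟨e (s j), fun i => hs i j⟩
      | zero => exact ⟨0, fun i => by simp⟩
      | add x y _ _ hx hy =>
        obtain ⟨x', hx⟩ := hx
        obtain ⟨y', hy⟩ := hy
        exact ⟨x' + y', fun i => by rw [form_add_right, form_add_right, hx, hy]⟩
      | smul c x _ hx =>
        obtain ⟨x', hx⟩ := hx
        exact ⟨c • x', fun i => by rw [form_smul_right, form_smul_right, hx]⟩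
    choose f hf using hex
    let g : V n →ₗ[ℝ] V n :=
      { toFun := f
        map_add' := fun x y => huniq _ _ fun i => by
          rw [hf, form_add_right, form_add_right, hf, hf]
        map_smul' := fun c x => huniq _ _ fun i => by
          rw [hf, RingHom.id_apply, form_smul_right, form_smul_right, hf] }
    have hg : ∀ x i, form (e (s i)) (g x) = form (e i) x := hf
    have hge : ∀ i, g (e i) = e (s i) := fun i => huniq _ _ fun j => by rw [hg, hs]
    have hform : ∀ x y, form (g x) (g y) = form x y := by
      intro x y
      induction hspan x using Submodule.span_induction with
      | mem x hx =>
        obtain ⟨j, rfl⟩ := hx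
        rw [hge, hg]
      | zero => simp
      | add x x' _ _ hx hx' => rw [map_add, form_add_left, form_add_left, hx, hx']
      | smul c x _ hx => rw [map_smul, form_smul_left, form_smul_left, hx]
    refine ⟨g, hge, hform, fun v hv => ?_, fun v hv => ?_⟩
    · induction hgen v hv using AddSubgroup.closure_induction with
      | mem x hx =>
        obtain ⟨j, rfl⟩ := hx
        rw [hge]; exact (h.root _).1
      | zero => rw [map_zero]; exact fun i => ⟨0, by simp⟩
      | add x y hx hy ihx ihy =>
        have hl : ∀ z ∈ AddSubgroup.closure (range e), z ∈ lattice n := fun z hz => by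
          induction hz using AddSubgroup.closure_induction with
          | mem x hx =>
            obtain ⟨j, rfl⟩ := hx
            exact (h.root _).1
          | zero => exact fun i => ⟨0, by simp⟩
          | add x y _ _ hx hy => exact lattice_add hx hy
          | neg x _ hx => exact lattice_neg hx
        rw [map_add]; exact lattice_add (ihx (hl x hx)) (ihy (hl y hy))
      | neg x hx ihx =>
        rw [map_neg]; refine lattice_neg (ihx ?_)
        have := lattice_neg hv
        rwa [neg_neg] at this
    · obtain ⟨ρ, -, hρ, hint⟩ := h.interior
      have hgρ : g ρ ∈ fcone n := h.light fun i => by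
        have := hg ρ (s.symm i)
        rw [Equiv.apply_symm_apply] at this
        rw [this]; exact (hint _).le
      refine mem_cone_of_form_neg hgρ (by rw [hform]; exact hv.1) ?_
      rw [hform]
      exact form_neg_of_mem hv (cone_subset_fcone hρ) (cone_ne_zero hρ)
  obtain ⟨g, hge, hgf, hgl, hgc⟩ := key s hs
  obtain ⟨g', hge', hgf', hgl', hgc'⟩ := key s⁻¹ fun i j => by
    rw [← hs, show s (s⁻¹ i) = i from s.apply_symm_apply i,
      show s (s⁻¹ j) = j from s.apply_symm_apply j]
  have hcomp : ∀ (a b : V n →ₗ[ℝ] V n), (∀ i, a (b (e i)) = e i) → ∀ x, a (b x) = x := by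
    intro a b hab x
    induction hspan x using Submodule.span_induction with
    | mem x hx =>
      obtain ⟨j, rfl⟩ := hx
      exact hab j
    | zero => simp
    | add x y _ _ hx hy => rw [map_add, map_add, hx, hy]
    | smul c x _ hx => rw [map_smul, map_smul, hx]
  have h1 := hcomp g g' fun i => by
    rw [hge', hge, show s (s⁻¹ i) = i from s.apply_symm_apply i]
  have h2 := hcomp g' g fun i => by
    rw [hge, hge', show s⁻¹ (s i) = i from s.symm_apply_apply i]
  let G : V n ≃ₗ[ℝ] V n := LinearEquiv.ofLinearMap g g' (LinearMap.ext h1) (LinearMap.ext h2)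
  refine ⟨G, ⟨⟨hgf, fun v => ⟨fun hv => ?_, hgc v⟩⟩, fun v => ⟨fun hv => ?_, hgl v⟩⟩, hge⟩
  · have := hgc' _ hv
    rwa [show g' (G v) = v from h2 v] at this
  · have := hgl' _ hv
    rwa [show g' (G v) = v from h2 v] at this

namespace IsSimpleSystem

variable {e : ι → V n}

/-- The scheme of the cell has the simple roots as its vertices. -/
noncomputable def faceEquiv [Finite ι] (h : IsSimpleSystem e) :
    ι ≃ faceNormals (wallCone e ∩ hyp n) :=
  (Equiv.ofInjective _ h.unitRoot_injective).trans (Equiv.setCongr h.faceNormals_eq.symm)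

lemma faceEquiv_apply [Finite ι] (h : IsSimpleSystem e) (i : ι) :
    (h.faceEquiv i : V n) = unitRoot e i := rfl

/-- The symmetries of the scheme are the type-preserving permutations of the simple roots. -/
noncomputable def schemeEquiv [Finite ι] (h : IsSimpleSystem e) :
    typeAut e ≃* SchemeSym (wallCone e ∩ hyp n) :=
  (h.faceEquiv.permCongrHom.subgroupMap (typeAut e)).trans <| MulEquiv.subgroupCongr <| by
    have key : ∀ (s : Equiv.Perm ι) (i : ι),
        (h.faceEquiv.permCongrHom s (h.faceEquiv i) : V n) = unitRoot e (s i) := fun s i => by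
      rw [Equiv.permCongrHom_coe, Equiv.permCongr_apply, Equiv.symm_apply_apply, faceEquiv_apply]
    ext t
    constructor
    · rintro ⟨s, hs, rfl⟩
      intro a b k
      obtain ⟨i, rfl⟩ := h.faceEquiv.surjective a
      obtain ⟨j, rfl⟩ := h.faceEquiv.surjective b
      have := hs i j k
      rw [← key, ← key, ← faceEquiv_apply h, ← faceEquiv_apply h] at this
      exact this
    · intro ht
      refine ⟨h.faceEquiv.permCongrHom.symm t, fun i j k => ?_, MulEquiv.apply_symm_apply _ t⟩
      rw [← key, ← key, MulEquiv.apply_symm_apply, ← faceEquiv_apply h, ← faceEquiv_apply h]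
      exact ht _ _ k

lemma ext_of_unitRoot (h : IsSimpleSystem e) {g g' : V n ≃ₗ[ℝ] V n} (hg : g ∈ Isom n)
    (hg' : g' ∈ Isom n) (hgg : ∀ i, g (unitRoot e i) = g' (unitRoot e i)) : g = g' := by
  have hee : ∀ i, g (e i) = g' (e i) := fun i => by
    have := hgg i
    rw [unitRoot, map_smul, map_smul] at this
    exact smul_right_injective _ (inv_pos.mpr (h.sqrt_pos i)).ne' this
  have hinv : ∀ x, g⁻¹ (g' x) = x := fun x => h.eq_of_form_eq fun i => by
    rw [← Isom_form_left hg, hee, Isom_form hg']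
  ext1 x
  have := congrArg g (hinv x)
  rw [apply_inv_apply] at this
  exact this.symm

/-- A motion preserving the cell permutes the simple roots up to positive factors. -/
lemma exists_perm_unitRoot [Finite ι] (h : IsSimpleSystem e) {g : V n ≃ₗ[ℝ] V n}
    (hg : g ∈ Sym (wallCone e ∩ hyp n)) :
    ∃ s ∈ typeAut e, ∀ i, g (unitRoot e i) = unitRoot e (s i) := by
  have hmem : ∀ i, g (unitRoot e i) ∈ range (unitRoot e) := by
    intro i
    have hi : unitRoot e i ∈ faceNormals (wallCone e ∩ hyp n) :=
      h.faceNormals_eq ▸ mem_range_self i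
    rw [← h.faceNormals_eq]
    obtain ⟨h1, h2, h3⟩ := hi
    have hginv := inv_mem hg
    refine ⟨by rw [Isom_form hg.1]; exact h1, fun y hy => ?_, fun v hv => ?_⟩
    · rw [Isom_form_left hg.1]
      exact h2 _ ((hginv.2 y).mpr hy)
    · rw [Isom_form_left hg.1] at hv
      have := Submodule.mem_map_of_mem (f := (g : V n →ₗ[ℝ] V n)) (h3 _ hv)
      rw [Submodule.map_span, LinearEquiv.coe_coe, apply_inv_apply] at this
      refine Submodule.span_mono ?_ this
      rintro _ ⟨y, ⟨hy1, hy2⟩, rfl⟩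
      exact ⟨(hg.2 y).mpr hy1, (Isom_form hg.1 _ _).trans hy2⟩
  choose f hf using hmem
  have hinj : Function.Injective f := fun i j hij => by
    apply h.unitRoot_injective
    apply g.injective
    rw [← hf, ← hf, hij]
  refine ⟨Equiv.ofBijective f (Finite.injective_iff_bijective.mp hinj), fun i j k => ?_,
    fun i => (hf i).symm⟩
  rw [Equiv.ofBijective_apply, Equiv.ofBijective_apply, hf, hf]
  exact hasEdge_congr (Isom_form hg.1 _ _) k

lemma mem_Sym_of_perm {g : V n ≃ₗ[ℝ] V n} (hg : g ∈ Isom n) {s : Equiv.Perm ι}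
    (hgs : ∀ i, g (e i) = e (s i)) : g ∈ Sym (wallCone e ∩ hyp n) := by
  refine ⟨hg, fun v => ?_⟩
  rw [mem_inter_iff, mem_inter_iff, Isom_hyp hg]
  refine and_congr_left fun _ => ⟨fun hv i => ?_, fun hv i => ?_⟩
  · rw [← Isom_form hg, hgs]; exact hv _
  · obtain ⟨j, rfl⟩ := s.surjective i
    rw [← hgs, Isom_form hg]; exact hv _

lemma unitRoot_perm {g : V n ≃ₗ[ℝ] V n} (hg : g ∈ Isom n) {s : Equiv.Perm ι}
    (hgs : ∀ i, g (e i) = e (s i)) (i : ι) : g (unitRoot e i) = unitRoot e (s i) := by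
  rw [unitRoot, unitRoot, map_smul, hgs, ← hgs, Isom_form hg]

lemma exists_perm [Finite ι] (h : IsSimpleSystem e) (hR : Realizable e) {g : V n ≃ₗ[ℝ] V n}
    (hg : g ∈ Sym (wallCone e ∩ hyp n)) :
    g ∈ Theta n ∧ ∃ s ∈ typeAut e, ∀ i, g (e i) = e (s i) := by
  obtain ⟨s, hs, hgs⟩ := h.exists_perm_unitRoot hg
  obtain ⟨g', hg', hgs'⟩ := hR s hs
  have : g = g' := h.ext_of_unitRoot hg.1 hg'.1 fun i => by
    rw [hgs, unitRoot_perm hg'.1 hgs']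
  exact ⟨this ▸ hg', s, hs, this ▸ hgs'⟩

lemma Sym_le_Theta [Finite ι] (h : IsSimpleSystem e) (hR : Realizable e) :
    Sym (wallCone e ∩ hyp n) ≤ Theta n := fun _ hg => (h.exists_perm hR hg).1

/-- The symmetries of the cell are the symmetries of its scheme. -/
theorem exists_symEquiv [Finite ι] (h : IsSimpleSystem e) (hR : Realizable e) :
    Nonempty (Sym (wallCone e ∩ hyp n) ≃* typeAut e) := by
  choose f hf hfe using hR
  have hext : ∀ g g' : V n ≃ₗ[ℝ] V n, g ∈ Isom n → g' ∈ Isom n → (∀ i, g (e i) = g' (e i)) →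
      g = g' := fun g g' hg hg' hgg => h.ext_of_unitRoot hg hg' fun i => by
    rw [unitRoot, map_smul, map_smul, hgg]
  let φ : typeAut e →* Sym (wallCone e ∩ hyp n) :=
    { toFun := fun s => ⟨f s.1 s.2, mem_Sym_of_perm (hf _ _).1 (hfe s.1 s.2)⟩
      map_one' := Subtype.ext <| hext _ _ (hf _ _).1 (one_mem _) fun i => by rw [hfe]; rfl
      map_mul' := fun s t => Subtype.ext <| hext _ _ (hf _ _).1
        (mul_mem (hf s.1 s.2).1 (hf t.1 t.2).1) fun i => by
          rw [hfe]
          change e (s.1 (t.1 i)) = f s.1 s.2 (f t.1 t.2 (e i))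
          rw [hfe, hfe] }
  refine ⟨(MulEquiv.ofBijective φ ⟨fun s t hst => ?_, fun g => ?_⟩).symm⟩
  · have hst' : f s.1 s.2 = f t.1 t.2 := congrArg Subtype.val hst
    refine Subtype.ext (Equiv.ext fun i => h.unitRoot_injective ?_)
    rw [← unitRoot_perm (hf _ _).1 (hfe s.1 s.2), ← unitRoot_perm (hf _ _).1 (hfe t.1 t.2), hst']
  · obtain ⟨s, hs, hgs⟩ := h.exists_perm_unitRoot g.2
    refine ⟨⟨s, hs⟩, Subtype.ext (h.ext_of_unitRoot (hf _ _).1 g.2.1 fun i => ?_)⟩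
    change f s hs (unitRoot e i) = _
    rw [unitRoot_perm (hf s hs).1 (hfe s hs), hgs]

/-- The ideal vertices of the cell correspond to the isotropic rays of its cone. -/
noncomputable def idealEquiv [Finite ι] {κ : Type*} {U : κ → V n} (h : IsSimpleSystem e)
    (hU : IsRaySystem e U) : κ ≃ idealVertices (wallCone e ∩ hyp n) :=
  Equiv.ofBijective
    (fun k => ⟨(U k 0)⁻¹ • U k, by
      rw [h.idealVertices_eq]
      refine ⟨⟨by rw [form_smul_left, form_smul_right, hU.isotropic]; ring, ?_⟩,
        smul_mem_wallCone (hU.mem k) (inv_nonneg.mpr (hU.pos k).le)⟩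
      rw [Pi.smul_apply, smul_eq_mul, inv_mul_cancel₀ (hU.pos k).ne']⟩)
    (by
      constructor
      · intro k k' hkk
        have hkk' : (U k 0)⁻¹ • U k = (U k' 0)⁻¹ • U k' := congrArg Subtype.val hkk
        refine hU.distinct k k' (U k 0 * (U k' 0)⁻¹) ?_
        rw [mul_smul, ← hkk', smul_smul, mul_inv_cancel₀ (hU.pos k).ne', one_smul]
      · rintro ⟨q, hq⟩
        have hq' := hq
        rw [h.idealVertices_eq] at hq'
        obtain ⟨⟨hqq, hq1⟩, hqC⟩ := hq'
        obtain ⟨k, c, hc, rfl⟩ := hU.complete q hqC hqq (by rintro rfl; simp at hq1)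
        refine ⟨k, Subtype.ext ?_⟩
        rw [Pi.smul_apply, smul_eq_mul] at hq1
        change (U k 0)⁻¹ • U k = c • U k
        rw [eq_inv_of_mul_eq_one_left hq1])

lemma idealEquiv_apply [Finite ι] {κ : Type*} {U : κ → V n} (h : IsSimpleSystem e)
    (hU : IsRaySystem e U) (k : κ) : (h.idealEquiv hU k : V n) = (U k 0)⁻¹ • U k := rfl

theorem ncard_idealVertices [Finite ι] {κ : Type*} {U : κ → V n} (h : IsSimpleSystem e)
    (hU : IsRaySystem e U) : (idealVertices (wallCone e ∩ hyp n)).ncard = Nat.card κ :=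
  (Nat.card_congr (h.idealEquiv hU)).symm

theorem groupedInto [Finite ι] {p m : ℕ} {U : (Fin p × Bool) ⊕ Fin m → V n}
    (h : IsSimpleSystem e) (hR : Realizable e) (hU : IsRaySystem e U)
    (hpair : ∀ i, ∃ s ∈ typeAut e, ∀ j,
      form (e (s j)) (U (Sum.inl (i, true))) = form (e j) (U (Sum.inl (i, false))))
    (hsingle : ∀ i, ∀ s ∈ typeAut e, ∀ j,
      form (e (s j)) (U (Sum.inr i)) = form (e j) (U (Sum.inr i))) :
    GroupedInto (wallCone e ∩ hyp n) p m := by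
  have hact : ∀ (g : V n ≃ₗ[ℝ] V n), g ∈ Isom n → ∀ s : Equiv.Perm ι, (∀ i, g (e i) = e (s i)) →
      ∀ x y, (∀ j, form (e (s j)) y = form (e j) x) → g x = y := by
    intro g hg s hgs x y hxy
    refine h.eq_of_form_eq fun i => ?_
    obtain ⟨j, rfl⟩ := s.surjective i
    rw [hxy, ← hgs, Isom_form hg]
  refine ⟨h.idealEquiv hU, fun i => ?_, fun i q hq hsym => ?_⟩
  · obtain ⟨s, hs, hsU⟩ := hpair i
    obtain ⟨g, hg, hgs⟩ := hR s hs
    have hgU := hact g hg.1 s hgs _ _ hsU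
    have h0 := hU.pos (Sum.inl (i, false))
    have h1 := hU.pos (Sum.inl (i, true))
    refine ⟨g, mem_Sym_of_perm hg.1 hgs, _, mul_pos (inv_pos.mpr h0) h1, ?_⟩
    rw [idealEquiv_apply, idealEquiv_apply, map_smul, hgU, smul_smul, mul_assoc,
      mul_inv_cancel₀ h1.ne', mul_one]
  · obtain ⟨g, hg, c, hc, hgq⟩ := hsym
    obtain ⟨-, s, hs, hgs⟩ := h.exists_perm hR hg
    have hgU := hact g hg.1 s hgs _ _ (hsingle i s hs)
    have h0 := (hU.pos (Sum.inr i)).ne'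
    rw [idealEquiv_apply, map_smul, hgU] at hgq
    have hq1 : q 0 = 1 := by
      rw [h.idealVertices_eq] at hq
      exact hq.1.2
    have hc1 : c = 1 := by
      have := congrFun hgq 0
      rw [Pi.smul_apply, Pi.smul_apply, smul_eq_mul, smul_eq_mul, inv_mul_cancel₀ h0, hq1,
        mul_one] at this
      exact this.symm
    rw [idealEquiv_apply, hgq, hc1, one_smul]

end IsSimpleSystem

end Symmetries

/-! ### The simple roots as integer vectors -/

/-- The scalar product of two lists of integers. -/
def ldot : List ℤ → List ℤ → ℤ
  | a :: as, b :: bs => a * b + ldot as bs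
  | _, _ => 0

/-- The scalar product of the vectors of `E^{(n,1)}` with the listed coordinates. -/
def zdot (l l' : List ℤ) : ℤ := ldot l.tail l'.tail - 3 * (l.headD 0 * l'.headD 0)

/-- The list of the coordinates of a vector with natural coordinates. -/
def intCoords (p : ℕ × List ℕ) : List ℤ := (p.1 : ℤ) :: p.2.map Nat.cast

/-- The simple roots. -/
def simpleRoots (n : ℕ) : List (List ℤ) :=
  (List.range n).map (tailRoot n) ++ (extraRoots n).map intCoords

/-- A vector on the negative side of all simple roots.  For `n ≤ 13` the first coordinate `20` is large
enough for the roots in `extraRoots n`. -/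
def innerPoint (n : ℕ) : ℕ × List ℕ := (20, (List.range n).map (n - ·))

/-- The simple root with index `i`. -/
def simpleRoot (n i : ℕ) : List ℤ := (simpleRoots n).getD i []

/-- The number of simple roots. -/
abbrev rootCount (n : ℕ) : ℕ := (simpleRoots n).length

/-- The simple roots as vectors of `E^{(n,1)}`. -/
def simpleVec (n : ℕ) (i : Fin (rootCount n)) : V n := zvec n (simpleRoot n i)

/-- The type of the edge between the simple roots `x` and `y`: the number `4 cos² α` if they form the
angle `α`, and `5` if they diverge.  The value `9` for a positive scalar product occurs
only if `x = y`. -/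
def edgeCode (x y : List ℤ) : ℕ :=
  if 0 < zdot x y then 9
  else if zdot x x * zdot y y < zdot x y * zdot x y then 5
  else (4 * (zdot x y * zdot x y) / (zdot x x * zdot y y)).toNat

/-- The simple roots have the expected lengths, angles, and position relative to the inner point. -/
def RootCheck (n : ℕ) : Prop :=
  (∀ l ∈ simpleRoots n, l.length ≤ n + 1 ∧ zdot l (intCoords (innerPoint n)) < 0) ∧
  (∀ i ∈ List.range n, zdot (tailRoot n i) (tailRoot n i) = 1 ∨
    zdot (tailRoot n i) (tailRoot n i) = 2) ∧
  zdot (intCoords (innerPoint n)) (intCoords (innerPoint n)) < 0 ∧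
  ∀ i ∈ List.range (rootCount n), ∀ j ∈ List.range (rootCount n), i ≠ j →
    zdot (simpleRoot n i) (simpleRoot n j) ≤ 0 ∧
    (zdot (simpleRoot n i) (simpleRoot n i) * zdot (simpleRoot n j) (simpleRoot n j) <
        zdot (simpleRoot n i) (simpleRoot n j) * zdot (simpleRoot n i) (simpleRoot n j) ∨
      4 * (zdot (simpleRoot n i) (simpleRoot n j) * zdot (simpleRoot n i) (simpleRoot n j)) =
        edgeCode (simpleRoot n i) (simpleRoot n j) *
          (zdot (simpleRoot n i) (simpleRoot n i) * zdot (simpleRoot n j) (simpleRoot n j)))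

instance (n : ℕ) : Decidable (RootCheck n) := inferInstanceAs (Decidable (_ ∧ _ ∧ _ ∧ _))

section SimpleRoots

variable {n : ℕ}

lemma sum_getD_mul_int (n : ℕ) (as bs : List ℤ) (h : as.length ≤ n) :
    ∑ i : Fin n, (as.getD i 0 : ℝ) * (bs.getD i 0 : ℝ) = ldot as bs := by
  induction n generalizing as bs with
  | zero =>
    obtain rfl : as = [] := List.length_eq_zero_iff.mp (by omega)
    simp [ldot]
  | succ n ih =>
    rw [Fin.sum_univ_succ]
    cases as with
    | nil => simp [ldot]
    | cons a as =>
      cases bs with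
      | nil => simp [ldot]
      | cons b bs =>
        have := ih as bs (by simpa using h)
        simp only [Fin.val_succ, Fin.val_zero, List.getD_cons_zero, List.getD_cons_succ, ldot]
        rw [this]; push_cast; ring

lemma getD_tail (l : List ℤ) (i : ℕ) : l.tail.getD i 0 = l.getD (i + 1) 0 := by
  cases l <;> simp

lemma headD_eq_getD (l : List ℤ) : l.headD 0 = l.getD 0 0 := by
  cases l <;> simp

lemma form_zvec {l l' : List ℤ} (h : l.length ≤ n + 1) :
    form (zvec n l) (zvec n l') = zdot l l' := by
  have := sum_getD_mul_int n l.tail l'.tail (by rw [List.length_tail]; omega)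
  rw [zdot, Int.cast_sub, ← this, headD_eq_getD, headD_eq_getD]
  simp only [form, zvec, getD_tail, Fin.val_succ, Fin.val_zero]
  push_cast; ring

lemma zvec_intCoords (p : ℕ × List ℕ) : zvec n (intCoords p) = nvec n p := by
  funext i
  refine Fin.cases (by simp [zvec, intCoords, nvec]) (fun j => ?_) i
  simp only [zvec, intCoords, nvec, Fin.cons_succ, Fin.val_succ, List.getD_cons_succ]
  rw [show (0 : ℤ) = ((0 : ℕ) : ℤ) from rfl, List.getD_map]
  simp

lemma zvec_mem_lattice (l : List ℤ) : zvec n l ∈ lattice n := fun i => ⟨l.getD i 0, rfl⟩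

lemma forall_simpleRoot {Q : List ℤ → Prop} :
    (∀ i : Fin (rootCount n), Q (simpleRoot n i)) ↔ ∀ l ∈ simpleRoots n, Q l := by
  constructor
  · intro h l hl
    obtain ⟨i, hi, rfl⟩ := List.getElem_of_mem hl
    have := h ⟨i, hi⟩
    rwa [simpleRoot, List.getD_eq_getElem _ _ hi] at this
  · intro h i
    rw [simpleRoot, List.getD_eq_getElem _ _ i.2]
    exact h _ (List.getElem_mem i.2)

lemma forall_mem_simpleRoots {Q : V n → Prop} : (∀ l ∈ simpleRoots n, Q (zvec n l)) ↔
    (∀ i < n, Q (zvec n (tailRoot n i))) ∧ ∀ e ∈ extraRoots n, Q (nvec n e) := by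
  simp only [simpleRoots, List.mem_append, List.mem_map, List.mem_range]
  constructor
  · refine fun h => ⟨fun i hi => h _ (Or.inl ⟨i, hi, rfl⟩), fun e he => ?_⟩
    rw [← zvec_intCoords]
    exact h _ (Or.inr ⟨e, he, rfl⟩)
  · rintro ⟨h1, h2⟩ _ (⟨i, hi, rfl⟩ | ⟨e, he, rfl⟩)
    · exact h1 i hi
    · rw [zvec_intCoords]; exact h2 e he

lemma wallCone_simpleVec : wallCone (simpleVec n) = fundCone n := by
  ext x
  refine (forall_simpleRoot (Q := fun l => form (zvec n l) x ≤ 0)).trans ?_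
  refine (forall_mem_simpleRoots (Q := fun v => form v x ≤ 0)).trans ?_
  rw [← mem_chamber_iff]
  rfl

lemma form_simpleVec (h : RootCheck n) (i : Fin (rootCount n)) (l : List ℤ) :
    form (simpleVec n i) (zvec n l) = zdot (simpleRoot n i) l :=
  form_zvec (forall_simpleRoot.mpr (fun l hl => (h.1 l hl).1) i)

theorem isSimpleSystem (hn : 0 < n) (h : extraCheck n = true) (ho : orderCheck n = true)
    (hl : lightCheck n = true) (hr : RootCheck n) : IsSimpleSystem (simpleVec n) := by
  have hlight := fundCone_subset_fcone hn h hl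
  refine ⟨?_, ?_, ?_, fun i j hij => ?_, ?_⟩
  · refine forall_simpleRoot.mpr (forall_mem_simpleRoots.mpr ⟨fun i hi => ?_, fun e he =>
      isRoot_extra h he⟩)
    have hlen := (hr.1 (tailRoot n i)
      (List.mem_append_left _ (List.mem_map_of_mem (List.mem_range.mpr hi)))).1
    have := hr.2.1 i (List.mem_range.mpr hi)
    refine isRoot_of_three_dvd (zvec_mem_lattice _) ?_ ?_ <;> rw [form_zvec hlen]
    · exact this.imp (fun h => by rw [h]; norm_num) fun h => Or.inl (by rw [h]; norm_num)
    · rcases this with h | h <;> rw [h] <;> norm_num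
  · rw [wallCone_simpleVec]; exact hlight
  · rw [wallCone_simpleVec]; exact fun r hr => hr.sign h ho hlight
  · rw [simpleVec, simpleVec, ← simpleVec, form_simpleVec hr]
    exact_mod_cast (hr.2.2.2 i (List.mem_range.mpr i.2) j (List.mem_range.mpr j.2)
      fun h => hij (Fin.ext h)).1
  · refine ⟨_, nvec_mem_lattice (innerPoint n), ⟨?_, by simp [nvec, innerPoint]⟩, fun i => ?_⟩
    · rw [← zvec_intCoords, form_zvec (by simp [intCoords, innerPoint])]
      exact_mod_cast hr.2.2.1
    · rw [← zvec_intCoords, form_simpleVec hr]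
      exact_mod_cast forall_simpleRoot.mpr (fun l hl => (hr.1 l hl).2) i

/-- The basis vector with tail index `k`; zero beyond the last one. -/
def tailUnit (n k : ℕ) : V n := if h : k < n then Pi.single (Fin.succ ⟨k, h⟩) 1 else 0

lemma form_tailUnit (k : ℕ) (x : V n) : form x (tailUnit n k) = tailSeq x k := by
  by_cases h : k < n
  · rw [tailUnit, dif_pos h, tailSeq, dif_pos h, form_single_succ]
  · rw [tailUnit, dif_neg h, tailSeq, dif_neg h, form_zero_right]

/-- The simple roots generate the lattice. -/
lemma mem_closure_simpleVec (hn : 0 < n) {v : V n} (hv : v ∈ lattice n) :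
    v ∈ AddSubgroup.closure (range (simpleVec n)) := by
  set H := AddSubgroup.closure (range (simpleVec n)) with hH
  have hroot : ∀ i : Fin (rootCount n), zvec n (simpleRoot n i) ∈ H := fun i =>
    AddSubgroup.subset_closure (mem_range_self i)
  obtain ⟨h1, h2⟩ := (forall_mem_simpleRoots (Q := (· ∈ H))).mp
    ((forall_simpleRoot (Q := fun l => zvec n l ∈ H)).mp hroot)
  have htail : ∀ d k, n ≤ k + d → tailUnit n k ∈ H := by
    intro d
    induction d with
    | zero =>
      intro k hk
      rw [tailUnit, dif_neg (by omega)]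
      exact zero_mem H
    | succ d ih =>
      intro k hk
      by_cases hkn : k < n
      · have : tailUnit n k = tailUnit n (k + 1) - zvec n (tailRoot n k) := by
          rw [← sub_eq_zero]
          refine form_nondegenerate fun x => ?_
          rw [form_comm, form_sub_right, form_sub_right, form_tailUnit, form_tailUnit,
            form_comm x (zvec _ _), form_tailRoot x hkn]
          ring
        rw [this]
        exact sub_mem (ih _ (by omega)) (h1 k hkn)
      · rw [tailUnit, dif_neg hkn]
        exact zero_mem H
  have hzero : (Pi.single 0 1 : V n) ∈ H := by
    have : (Pi.single 0 1 : V n) = nvec n (firstExtra n) - (3 : ℤ) • tailUnit n 0 := by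
      rw [← sub_eq_zero]
      refine form_nondegenerate fun x => ?_
      rw [← Int.cast_smul_eq_zsmul ℝ, form_comm, form_sub_right, form_sub_right, form_smul_right,
        form_tailUnit, form_comm x (nvec _ _), form_firstExtra hn, form_single_zero]
      push_cast; ring
    rw [this]
    exact sub_mem (h2 _ List.mem_cons_self) (zsmul_mem (htail n 0 (by omega)) 3)
  have hsingle : ∀ i, (Pi.single i 1 : V n) ∈ H := fun i => by
    refine Fin.cases hzero (fun j => ?_) i
    have := htail n j (by omega)
    rwa [tailUnit, dif_pos j.2] at this
  choose m hm using hv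
  have hsum : v = ∑ i, m i • (Pi.single i 1 : V n) := by
    funext j
    simp [Finset.sum_apply, Pi.single_apply, hm]
  rw [hsum]
  exact sum_mem fun i _ => zsmul_mem (hsingle i) _

end SimpleRoots

/-! ### Automorphisms of a scheme -/

/-- Prescribing the value `j` at `k`, in addition to the values listed in `s` (the last one first)
at the arguments below `k`, is compatible with preserving the function `c`. -/
def compatible (c : ℕ → ℕ → ℕ) (j k : ℕ) : ℕ → List ℕ → Bool
  | i + 1, a :: s => Nat.beq (c a j) (c i k) && compatible c j k i s
  | _, _ => true

/-- The lists `[f (k - 1), …, f 0]` for the maps `f` with values below `m` which preserve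
the function `c`. -/
def partialAuts (c : ℕ → ℕ → ℕ) (m : ℕ) : ℕ → List (List ℕ)
  | 0 => [[]]
  | k + 1 => (partialAuts c m k).flatMap fun s =>
      ((List.range m).filter fun j => compatible c j k k s).map (· :: s)

lemma compatible_of_forall {c : ℕ → ℕ → ℕ} {j k : ℕ} {f : ℕ → ℕ} :
    ∀ i, (∀ i' < i, c (f i') j = c i' k) → compatible c j k i ((List.range i).map f).reverse := by
  intro i
  induction i with
  | zero => intro _; rfl
  | succ i ih =>
    intro h
    rw [List.range_succ, List.map_append, List.map_singleton, List.reverse_append,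
      List.reverse_singleton, List.singleton_append, compatible, Bool.and_eq_true, Nat.beq_eq]
    exact ⟨h i (Nat.lt_succ_self i), ih fun i' hi' => h i' (Nat.lt_succ_of_lt hi')⟩

/-- The search finds all maps preserving `c`; its results need not extend to permutations. -/
lemma mem_partialAuts {c : ℕ → ℕ → ℕ} {m : ℕ} {f : ℕ → ℕ} (hf : ∀ i < m, f i < m)
    (hc : ∀ i < m, ∀ j < m, c (f i) (f j) = c i j) :
    ∀ k ≤ m, ((List.range k).map f).reverse ∈ partialAuts c m k := by
  intro k
  induction k with
  | zero => intro _; simp [partialAuts]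
  | succ k ih =>
    intro hk
    rw [partialAuts, List.mem_flatMap]
    refine ⟨_, ih (by omega), ?_⟩
    rw [List.mem_map]
    refine ⟨f k, List.mem_filter.mpr ⟨List.mem_range.mpr (hf k (by omega)),
      compatible_of_forall k fun i hi => hc i (by omega) k (by omega)⟩, ?_⟩
    rw [List.range_succ, List.map_append, List.map_singleton, List.reverse_append,
      List.reverse_singleton, List.singleton_append]

/-- The matrix of the types of the edges between the simple roots. -/
def codeTable (n : ℕ) : List (List ℕ) :=
  (simpleRoots n).map fun x => (simpleRoots n).map fun y => edgeCode x y

/-- The symmetries of the scheme of the simple roots, as lists of values. -/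
def schemeAuts (n : ℕ) : List (List ℕ) :=
  (partialAuts (fun i j => ((codeTable n).getD i []).getD j 0) (rootCount n)
    (rootCount n)).map List.reverse

/-- The scheme has exactly `N` symmetries; they are involutions preserving the scalar products of the
simple roots. -/
def AutCheck (n N : ℕ) : Prop :=
  (schemeAuts n).length = N ∧ (schemeAuts n).Nodup ∧ ∀ s ∈ schemeAuts n,
    s.length = rootCount n ∧
    (∀ i ∈ List.range (rootCount n), s.getD i 0 < rootCount n ∧ s.getD (s.getD i 0) 0 = i) ∧
    ∀ i ∈ List.range (rootCount n), ∀ j ∈ List.range (rootCount n),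
      zdot (simpleRoot n (s.getD i 0)) (simpleRoot n (s.getD j 0)) =
        zdot (simpleRoot n i) (simpleRoot n j)

instance (n N : ℕ) : Decidable (AutCheck n N) := inferInstanceAs (Decidable (_ ∧ _ ∧ _))

/-- The type of an edge with the given code. -/
def edgeOfCode : ℕ → Edge
  | 0 => Edge.angle 2
  | 1 => Edge.angle 3
  | 2 => Edge.angle 4
  | 3 => Edge.angle 6
  | 4 => Edge.cusp
  | _ => Edge.dashed

/-- The number `c` is the code of the scalar product `t ≤ 0` of two unit vectors. -/
def CodeSpec (t : ℝ) (c : ℕ) : Prop := t ≤ 0 ∧ (c ≤ 4 ∧ 4 * t ^ 2 = c ∨ c = 5 ∧ 1 < t ^ 2)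

section Codes

variable {n : ℕ}

lemma CodeSpec.eq {t : ℝ} {c c' : ℕ} (h : CodeSpec t c) (h' : CodeSpec t c') : c = c' := by
  obtain ⟨-, ⟨h1, h2⟩ | ⟨h1, h2⟩⟩ := h <;> obtain ⟨-, ⟨h3, h4⟩ | ⟨h3, h4⟩⟩ := h'
  · exact_mod_cast h2.symm.trans h4
  · have : (c : ℝ) ≤ 4 := by exact_mod_cast h1
    linarith
  · have : (c' : ℝ) ≤ 4 := by exact_mod_cast h3
    linarith
  · rw [h1, h3]

lemma cos_pi_div_values : Real.cos (Real.pi / (2 : ℕ)) = 0 ∧ Real.cos (Real.pi / (3 : ℕ)) = 1 / 2 ∧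
    Real.cos (Real.pi / (4 : ℕ)) = √2 / 2 ∧ Real.cos (Real.pi / (6 : ℕ)) = √3 / 2 := by
  push_cast
  exact ⟨Real.cos_pi_div_two, Real.cos_pi_div_three, Real.cos_pi_div_four, Real.cos_pi_div_six⟩

/-- Two hyperplanes are joined by an edge of the type with the code `c` if and only if `c` is the
code of their scalar product. -/
lemma hasEdge_edgeOfCode {a b : V n} {c : ℕ} (hc : c ≤ 5) :
    HasEdge a b (edgeOfCode c) ↔ CodeSpec (form a b) c := by
  obtain ⟨c2, c3, c4, c6⟩ := cos_pi_div_values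
  set t := form a b with ht
  have s2 : √2 ^ 2 = (2 : ℝ) := Real.sq_sqrt (by norm_num)
  have s3 : √3 ^ 2 = (3 : ℝ) := Real.sq_sqrt (by norm_num)
  have p2 : 0 ≤ √(2 : ℝ) := Real.sqrt_nonneg _
  have p3 : 0 ≤ √(3 : ℝ) := Real.sqrt_nonneg _
  have key : ∀ v : ℝ, 0 ≤ v → ∀ k : ℕ, k ≤ 4 → 4 * v ^ 2 = k → (t = -v ↔ CodeSpec t k) := by
    intro v hv k hk hvk
    constructor
    · intro h
      rw [h]
      exact ⟨by linarith, Or.inl ⟨hk, by rw [neg_sq, hvk]⟩⟩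
    · rintro ⟨h0, ⟨-, h⟩ | ⟨h, -⟩⟩
      · have : (-t) ^ 2 = v ^ 2 := by rw [neg_sq]; linarith
        have := (sq_eq_sq₀ (by linarith) hv).mp this
        linarith
      · omega
  interval_cases c
  · simp only [edgeOfCode, HasEdge, c2, le_refl, true_and]
    exact key 0 le_rfl 0 (by norm_num) (by norm_num)
  · simp only [edgeOfCode, HasEdge, c3, Nat.reduceLeDiff, true_and]
    exact key _ (by norm_num) 1 (by norm_num) (by norm_num)
  · simp only [edgeOfCode, HasEdge, c4, Nat.reduceLeDiff, true_and]
    exact key _ (by positivity) 2 (by norm_num) (by rw [div_pow, s2]; norm_num)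
  · simp only [edgeOfCode, HasEdge, c6, Nat.reduceLeDiff, true_and]
    exact key _ (by positivity) 3 (by norm_num) (by rw [div_pow, s3]; norm_num)
  · simp only [edgeOfCode, HasEdge]
    exact key 1 (by norm_num) 4 (by norm_num) (by norm_num)
  · simp only [edgeOfCode, HasEdge, CodeSpec]
    constructor
    · intro h
      exact ⟨by linarith, Or.inr ⟨trivial, by nlinarith⟩⟩
    · rintro ⟨h0, ⟨h, -⟩ | ⟨-, h⟩⟩
      · omega
      · nlinarith

/-- The division in `edgeCode` is exact, by `RootCheck`, so that the code determines the scalar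
product of the unit vectors unless the mirrors diverge. -/
lemma codeSpec_edgeCode (h : IsSimpleSystem (simpleVec n)) (hr : RootCheck n)
    {i j : Fin (rootCount n)} (hij : i ≠ j) :
    CodeSpec (form (unitRoot (simpleVec n) i) (unitRoot (simpleVec n) j))
      (edgeCode (simpleRoot n i) (simpleRoot n j)) ∧
    edgeCode (simpleRoot n i) (simpleRoot n j) ≤ 5 := by
  obtain ⟨hp, hcode⟩ := hr.2.2.2 i (List.mem_range.mpr i.2) j (List.mem_range.mpr j.2)
    fun h => hij (Fin.ext h)
  have hi := h.root i |>.pos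
  have hj := h.root j |>.pos
  have si := Real.sq_sqrt hi.le
  have sj := Real.sq_sqrt hj.le
  have pi := h.sqrt_pos i
  have pj := h.sqrt_pos j
  have hii := form_simpleVec hr i (simpleRoot n i)
  have hjj := form_simpleVec hr j (simpleRoot n j)
  have hij := form_simpleVec hr i (simpleRoot n j)
  have hN : 0 < zdot (simpleRoot n i) (simpleRoot n i) *
      zdot (simpleRoot n j) (simpleRoot n j) := by
    have : (0 : ℝ) < zdot (simpleRoot n i) (simpleRoot n i) := hii ▸ hi
    have : (0 : ℝ) < zdot (simpleRoot n j) (simpleRoot n j) := hjj ▸ hj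
    have : (0 : ℝ) < zdot (simpleRoot n i) (simpleRoot n i) *
      zdot (simpleRoot n j) (simpleRoot n j) := by positivity
    exact_mod_cast this
  have ht : form (unitRoot (simpleVec n) i) (unitRoot (simpleVec n) j) =
      zdot (simpleRoot n i) (simpleRoot n j) /
        (√(form (simpleVec n i) (simpleVec n i)) * √(form (simpleVec n j) (simpleVec n j))) := by
    rw [unitRoot, unitRoot, form_smul_left, form_smul_right,
      show form (simpleVec n i) (simpleVec n j) = _ from hij]
    field_simp
  have ht2 : form (unitRoot (simpleVec n) i) (unitRoot (simpleVec n) j) ^ 2 =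
      ((zdot (simpleRoot n i) (simpleRoot n j) * zdot (simpleRoot n i) (simpleRoot n j) : ℤ) : ℝ) /
        ((zdot (simpleRoot n i) (simpleRoot n i) *
          zdot (simpleRoot n j) (simpleRoot n j) : ℤ) : ℝ) := by
    rw [ht, div_pow, mul_pow, si, sj, show form (simpleVec n i) (simpleVec n i) = _ from hii,
      show form (simpleVec n j) (simpleVec n j) = _ from hjj]
    push_cast; ring
  have hNr : (0 : ℝ) < ((zdot (simpleRoot n i) (simpleRoot n i) *
          zdot (simpleRoot n j) (simpleRoot n j) : ℤ) : ℝ) := by exact_mod_cast hN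
  have ht0 : form (unitRoot (simpleVec n) i) (unitRoot (simpleVec n) j) ≤ 0 := by
    rw [ht]
    exact div_nonpos_of_nonpos_of_nonneg (by exact_mod_cast hp) (mul_pos pi pj).le
  by_cases hd : zdot (simpleRoot n i) (simpleRoot n i) * zdot (simpleRoot n j) (simpleRoot n j) <
      zdot (simpleRoot n i) (simpleRoot n j) * zdot (simpleRoot n i) (simpleRoot n j)
  · have h5 : edgeCode (simpleRoot n i) (simpleRoot n j) = 5 := by
      rw [edgeCode, if_neg (not_lt.mpr hp), if_pos hd]
    rw [h5]
    refine ⟨⟨ht0, Or.inr ⟨rfl, ?_⟩⟩, le_rfl⟩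
    rw [ht2, one_lt_div hNr]
    exact_mod_cast hd
  · have hc := hcode.resolve_left hd
    have h4 : edgeCode (simpleRoot n i) (simpleRoot n j) ≤ 4 := by
      have h1 : (edgeCode (simpleRoot n i) (simpleRoot n j) : ℤ) *
          (zdot (simpleRoot n i) (simpleRoot n i) * zdot (simpleRoot n j) (simpleRoot n j)) ≤
          4 * (zdot (simpleRoot n i) (simpleRoot n i) *
            zdot (simpleRoot n j) (simpleRoot n j)) := by
        rw [← hc]
        exact mul_le_mul_of_nonneg_left (not_lt.mp hd) (by norm_num)
      exact_mod_cast le_of_mul_le_mul_right h1 hN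
    refine ⟨⟨ht0, Or.inl ⟨h4, ?_⟩⟩, h4.trans (by norm_num)⟩
    rw [ht2, ← mul_div_assoc, div_eq_iff hNr.ne']
    exact_mod_cast hc

lemma edgeCode_self (h : IsSimpleSystem (simpleVec n)) (hr : RootCheck n)
    (i : Fin (rootCount n)) : edgeCode (simpleRoot n i) (simpleRoot n i) = 9 := by
  have hi := (h.root i).pos
  have hii : form (simpleVec n i) (simpleVec n i) = _ := form_simpleVec hr i (simpleRoot n i)
  rw [hii] at hi
  rw [edgeCode, if_pos (by exact_mod_cast hi)]

lemma edgeCode_typeAut (h : IsSimpleSystem (simpleVec n)) (hr : RootCheck n)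
    {s : Equiv.Perm (Fin (rootCount n))} (hs : s ∈ typeAut (simpleVec n))
    (i j : Fin (rootCount n)) :
    edgeCode (simpleRoot n (s i)) (simpleRoot n (s j)) =
      edgeCode (simpleRoot n i) (simpleRoot n j) := by
  rcases eq_or_ne i j with rfl | hij
  · rw [edgeCode_self h hr, edgeCode_self h hr]
  · obtain ⟨h1, h2⟩ := codeSpec_edgeCode h hr hij
    obtain ⟨h3, -⟩ := codeSpec_edgeCode h hr (s.injective.ne hij)
    rw [← hasEdge_edgeOfCode h2, ← hs, hasEdge_edgeOfCode h2] at h1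
    exact h3.eq h1

/-- The list of the values of a permutation. -/
def valueList {m : ℕ} (s : Equiv.Perm (Fin m)) : List ℕ :=
  (List.range m).map fun i => if h : i < m then (s ⟨i, h⟩ : ℕ) else 0

lemma valueList_getD {m : ℕ} (s : Equiv.Perm (Fin m)) (i : Fin m) :
    (valueList s).getD i 0 = s i := by
  rw [valueList, List.getD_eq_getElem _ _ (by simp), List.getElem_map, List.getElem_range,
    dif_pos i.2]

lemma valueList_injective {m : ℕ} :
    Function.Injective (valueList : Equiv.Perm (Fin m) → List ℕ) := fun s t hst =>
  Equiv.ext fun i => Fin.ext (by rw [← valueList_getD, hst, valueList_getD])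

lemma valueList_mem (h : IsSimpleSystem (simpleVec n)) (hr : RootCheck n)
    {s : Equiv.Perm (Fin (rootCount n))} (hs : s ∈ typeAut (simpleVec n)) :
    valueList s ∈ schemeAuts n := by
  have htable : ∀ i j : Fin (rootCount n), ((codeTable n).getD i []).getD j 0 =
      edgeCode (simpleRoot n i) (simpleRoot n j) := by
    intro i j
    simp only [codeTable, simpleRoot]
    rw [List.getD_eq_getElem (List.map _ _) [] (by simp), List.getElem_map,
      List.getD_eq_getElem (List.map _ _) 0 (by simp), List.getElem_map,
      List.getD_eq_getElem _ _ i.2, List.getD_eq_getElem _ _ j.2]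
  refine List.mem_map.mpr ⟨_, mem_partialAuts
    (f := fun i => if h : i < rootCount n then (s ⟨i, h⟩ : ℕ) else 0)
    (fun i hi => ?_) (fun i hi j hj => ?_) _ le_rfl, List.reverse_reverse _⟩
  · rw [dif_pos hi]; exact (s ⟨i, hi⟩).2
  · rw [dif_pos hi, dif_pos hj, htable, edgeCode_typeAut h hr hs]
    exact (htable ⟨i, hi⟩ ⟨j, hj⟩).symm

/-- Every listed symmetry is a permutation preserving the scalar products. -/
lemma exists_perm_of_mem {N : ℕ} (ha : AutCheck n N) (hr : RootCheck n) {l : List ℕ}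
    (hl : l ∈ schemeAuts n) : ∃ s ∈ typeAut (simpleVec n), valueList s = l ∧ s * s = 1 ∧
      ∀ i j, form (simpleVec n (s i)) (simpleVec n (s j)) =
        form (simpleVec n i) (simpleVec n j) := by
  obtain ⟨hlen, hinv, hform⟩ := ha.2.2 l hl
  let f : Fin (rootCount n) → Fin (rootCount n) := fun i =>
    ⟨l.getD i 0, (hinv i (List.mem_range.mpr i.2)).1⟩
  have hf : Function.Involutive f := fun i => Fin.ext (hinv i (List.mem_range.mpr i.2)).2
  have hgram : ∀ i j, form (simpleVec n (f i)) (simpleVec n (f j)) =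
      form (simpleVec n i) (simpleVec n j) := fun i j => by
    have h1 := form_simpleVec hr (f i) (simpleRoot n (f j))
    have h2 := form_simpleVec hr i (simpleRoot n j)
    rw [hform i (List.mem_range.mpr i.2) j (List.mem_range.mpr j.2), ← h2] at h1
    exact h1
  refine ⟨hf.toPerm f, fun i j k => hasEdge_congr ?_ k, ?_, Equiv.ext fun i => hf i, hgram⟩
  · simp only [unitRoot, form_smul_left, form_smul_right, Function.Involutive.coe_toPerm, hgram]
  · refine List.ext_getElem (by simp [valueList, hlen]) fun i h1 h2 => ?_
    have hi : i < rootCount n := hlen ▸ h2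
    have := valueList_getD (hf.toPerm f) ⟨i, hi⟩
    rw [List.getD_eq_getElem _ _ h1] at this
    rw [this]
    exact List.getD_eq_getElem _ _ h2

lemma typeAut_spec {N : ℕ} (h : IsSimpleSystem (simpleVec n)) (ha : AutCheck n N)
    (hr : RootCheck n) {s : Equiv.Perm (Fin (rootCount n))} (hs : s ∈ typeAut (simpleVec n)) :
    s * s = 1 ∧ ∀ i j, form (simpleVec n (s i)) (simpleVec n (s j)) =
      form (simpleVec n i) (simpleVec n j) := by
  obtain ⟨t, -, ht, ht'⟩ := exists_perm_of_mem ha hr (valueList_mem h hr hs)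
  rw [← valueList_injective ht]
  exact ht'

theorem realizable_simpleVec {N : ℕ} (hn : 0 < n) (h : IsSimpleSystem (simpleVec n))
    (ha : AutCheck n N) (hr : RootCheck n) : Realizable (simpleVec n) := fun s hs =>
  h.exists_extension (fun _ hv => mem_closure_simpleVec hn hv) s (typeAut_spec h ha hr hs).2

theorem card_typeAut {N : ℕ} (h : IsSimpleSystem (simpleVec n)) (ha : AutCheck n N)
    (hr : RootCheck n) : Nat.card (typeAut (simpleVec n)) = N := by
  have hinj : Function.Injective fun s : typeAut (simpleVec n) => valueList s.1 := fun s t hst =>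
    Subtype.ext (valueList_injective hst)
  have hrange : range (fun s : typeAut (simpleVec n) => valueList s.1) =
      ((schemeAuts n).toFinset : Set (List ℕ)) := by
    ext l
    rw [List.coe_toFinset]
    constructor
    · rintro ⟨s, rfl⟩
      exact valueList_mem h hr s.2
    · intro hl
      obtain ⟨s, hs, hsl, -⟩ := exists_perm_of_mem ha hr hl
      exact ⟨⟨s, hs⟩, hsl⟩
  rw [Nat.card_congr (Equiv.ofInjective _ hinj), hrange, Nat.card_coe_set_eq,
    Set.ncard_coe_finset, List.toFinset_card_of_nodup ha.2.1, ha.1]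

end Codes

/-! ### Isotropic rays -/

/-- Pairs of isotropic generators of the fundamental cone which are exchanged by a symmetry. -/
def rayPairs (n : ℕ) : List ((ℕ × List ℕ) × (ℕ × List ℕ)) :=
  ((if 10 ≤ n then [((1, [1, 1, 1]), (5, List.replicate 7 3 ++ [2, 2, 2]))] else []) ++
  (if 11 ≤ n ∧ n ≤ 12 then
    [((5, List.replicate 8 3 ++ [1, 1, 1]), (3, [3, 3] ++ List.replicate 9 1))] else []) ++
  (if 13 ≤ n then
    [((2, 2 :: List.replicate 8 1), (6, [4, 4, 4, 3, 3, 3, 3] ++ List.replicate 6 2)),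
    ((5, List.replicate 7 3 ++ [2, 2, 1, 1, 1, 1]), (3, [3, 2, 2] ++ List.replicate 10 1)),
    ((5, List.replicate 8 3 ++ [1, 1, 1]), (10, List.replicate 5 6 ++ [5, 5, 5, 3, 3, 3, 3, 3])),
    ((3, [3, 3] ++ List.replicate 9 1), (8, [6, 6, 4, 4, 4] ++ List.replicate 8 3)),
    ((8, [6, 5, 5, 5] ++ List.replicate 9 3),
      (10, List.replicate 6 6 ++ [4, 4, 4, 3, 3, 3, 3]))] else [])).map
    fun p : (ℕ × List ℕ) × (ℕ × List ℕ) => ((p.1.1, padTo n p.1.2), (p.2.1, padTo n p.2.2))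

/-- The isotropic generators of the fundamental cone which are fixed by all symmetries. -/
def raySingles (n : ℕ) : List (ℕ × List ℕ) :=
  ((if n = 9 then [(1, [1, 1, 1])] else []) ++
  (if n ≤ 12 then [(2, 2 :: List.replicate 8 1)] else []) ++
  (if 12 ≤ n then [(2, List.replicate 12 1)] else [])).map
    fun p : ℕ × List ℕ => (p.1, padTo n p.2)

/-- The indices of the isotropic rays. -/
abbrev RayIndex (n : ℕ) : Type := (Fin (rayPairs n).length × Bool) ⊕ Fin (raySingles n).length

/-- The isotropic generators of the fundamental cone. -/
def isoRay (n : ℕ) : RayIndex n → ℕ × List ℕ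
  | Sum.inl (i, b) => bif b then (rayPairs n)[i].2 else (rayPairs n)[i].1
  | Sum.inr j => (raySingles n)[j]

/-- The vectors with the coordinates `p` and `q`, whose first coordinates are supposed to be positive,
are proportional: multiplication by the first coordinate of the other makes them equal. -/
def Proportional (p q : ℕ × List ℕ) : Prop := p.2.map (q.1 * ·) = q.2.map (p.1 * ·)

instance (p q : ℕ × List ℕ) : Decidable (Proportional p q) := inferInstanceAs (Decidable (_ = _))

/-- The listed rays are the isotropic generators of the fundamental cone, up to factors; and the
symmetries act on them as claimed. -/
def RayCheck (n : ℕ) : Prop :=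
  (∀ k : RayIndex n, (isoRay n k).2.length = n ∧ 0 < (isoRay n k).1 ∧
    tdot (isoRay n k).2 (isoRay n k).2 = 3 * ((isoRay n k).1 * (isoRay n k).1) ∧
    ∀ l ∈ simpleRoots n, zdot l (intCoords (isoRay n k)) ≤ 0) ∧
  (∀ k k' : RayIndex n, Proportional (isoRay n k) (isoRay n k') → k = k') ∧
  (∀ g ∈ gens n, tdot g.ray.2 g.ray.2 = 3 * (g.ray.1 * g.ray.1) →
    ∃ k : RayIndex n, Proportional g.ray (isoRay n k)) ∧
  (∀ i : Fin (rayPairs n).length, ∃ s ∈ schemeAuts n, ∀ j ∈ List.range (rootCount n),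
    zdot (simpleRoot n (s.getD j 0)) (intCoords (isoRay n (Sum.inl (i, true)))) =
      zdot (simpleRoot n j) (intCoords (isoRay n (Sum.inl (i, false))))) ∧
  ∀ i : Fin (raySingles n).length, ∀ s ∈ schemeAuts n, ∀ j ∈ List.range (rootCount n),
    zdot (simpleRoot n (s.getD j 0)) (intCoords (isoRay n (Sum.inr i))) =
      zdot (simpleRoot n j) (intCoords (isoRay n (Sum.inr i)))

instance (n : ℕ) : Decidable (RayCheck n) := inferInstanceAs (Decidable (_ ∧ _ ∧ _ ∧ _ ∧ _))

section Rays

variable {n : ℕ}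

lemma Proportional.smul_eq {p q : ℕ × List ℕ} (h : Proportional p q) :
    (q.1 : ℝ) • nvec n p = (p.1 : ℝ) • nvec n q := by
  funext i
  refine Fin.cases ?_ (fun j => ?_) i
  · simp only [nvec, Pi.smul_apply, Fin.cons_zero, smul_eq_mul]; ring
  · have := congrArg (fun l => l.getD j 0) h
    rw [← Nat.mul_zero q.1, List.getD_map, Nat.mul_zero, ← Nat.mul_zero p.1, List.getD_map,
      Nat.mul_zero] at this
    simp only [nvec, Pi.smul_apply, Fin.cons_succ, smul_eq_mul]
    exact_mod_cast this

lemma proportional_of_eq_smul {p q : ℕ × List ℕ} (hp : p.2.length = n) (hq : q.2.length = n)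
    {c : ℝ} (h : nvec n p = c • nvec n q) : Proportional p q := by
  refine List.ext_getElem (by simp [hp, hq]) fun i h1 h2 => ?_
  rw [List.length_map] at h1 h2
  have h0 := congrFun h 0
  have hi := congrFun h (Fin.succ ⟨i, hp ▸ h1⟩)
  simp only [nvec, Pi.smul_apply, Fin.cons_succ, Fin.cons_zero, smul_eq_mul,
    List.getD_eq_getElem _ _ h1, List.getD_eq_getElem _ _ h2] at h0 hi
  rw [List.getElem_map, List.getElem_map]
  have : (q.1 : ℝ) * p.2[i] = p.1 * q.2[i] := by rw [h0, hi]; ring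
  exact_mod_cast this

lemma isRaySystem (hn : 0 < n) (h : extraCheck n = true) (hl : lightCheck n = true)
    (hr : RootCheck n) (hc : RayCheck n) :
    IsRaySystem (simpleVec n) fun k => nvec n (isoRay n k) := by
  obtain ⟨h1, h2, h3, -, -⟩ := hc
  refine ⟨fun k i => ?_, fun k => ?_, fun k => ?_, fun q hq hqq hq0 => ?_, fun k k' c hkk => ?_⟩
  · rw [← zvec_intCoords, form_simpleVec hr]
    exact_mod_cast forall_simpleRoot.mpr (h1 k).2.2.2 i
  · simpa [nvec] using (h1 k).2.1
  · rw [form_nvec _ _ (h1 k).1.le, (h1 k).2.2.1]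
    push_cast; ring
  · rw [wallCone_simpleVec] at hq
    obtain ⟨g, hg, hgg, c, hc, rfl⟩ := exists_gen_of_isotropic hn h hl hq hq0 hqq
    obtain ⟨k, hk⟩ := h3 g hg hgg
    obtain ⟨A, hA, -⟩ := exists_isDD_gens hn h
    have hgpos : (0 : ℝ) < g.ray.1 := by exact_mod_cast hA.pos g hg
    have hkpos : (0 : ℝ) < (isoRay n k).1 := by exact_mod_cast (h1 k).2.1
    refine ⟨k, c * ((isoRay n k).1 : ℝ)⁻¹ * g.ray.1, by positivity, ?_⟩
    rw [mul_smul, ← hk.smul_eq, smul_smul, mul_assoc, inv_mul_cancel₀ hkpos.ne', mul_one]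
  · exact h2 k k' (proportional_of_eq_smul (h1 k).1 (h1 k').1 hkk)

/-- The ideal vertices of a translate of the cell of the simple roots correspond to the listed rays. -/
theorem groupedInto_of_check {N : ℕ} (hn : 0 < n) (h : extraCheck n = true)
    (hl : lightCheck n = true) (hr : RootCheck n) (ha : AutCheck n N) (hc : RayCheck n)
    (hS : IsSimpleSystem (simpleVec n)) {g : V n ≃ₗ[ℝ] V n} (hg : g ∈ Theta n) :
    (idealVertices (wallCone (fun i => g (simpleVec n i)) ∩ hyp n)).ncard =
      (rayPairs n).length * 2 + (raySingles n).length ∧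
    GroupedInto (wallCone (fun i => g (simpleVec n i)) ∩ hyp n) (rayPairs n).length
      (raySingles n).length := by
  have hU := (isRaySystem hn h hl hr hc).map hg.1
  refine ⟨?_, ?_⟩
  · rw [(hS.map hg).ncard_idealVertices hU, Nat.card_eq_fintype_card]
    simp
  obtain ⟨-, -, -, hpair, hsingle⟩ := hc
  have hform : ∀ (s : Equiv.Perm (Fin (rootCount n))) (k k' : RayIndex n),
      (∀ j ∈ List.range (rootCount n),
        zdot (simpleRoot n ((valueList s).getD j 0)) (intCoords (isoRay n k')) =
          zdot (simpleRoot n j) (intCoords (isoRay n k))) → ∀ j,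
      form (g (simpleVec n (s j))) (g (nvec n (isoRay n k'))) =
        form (g (simpleVec n j)) (g (nvec n (isoRay n k))) := by
    intro s k k' hz j
    have := hz j (List.mem_range.mpr j.2)
    rw [valueList_getD] at this
    rw [Isom_form hg.1, Isom_form hg.1, ← zvec_intCoords, ← zvec_intCoords, form_simpleVec hr,
      form_simpleVec hr, this]
  refine (hS.map hg).groupedInto ((realizable_simpleVec hn hS ha hr).map hg) hU (fun i => ?_)
    fun i s hs => ?_
  · obtain ⟨l, hl, hz⟩ := hpair i
    obtain ⟨s, hs, rfl, -⟩ := exists_perm_of_mem ha hr hl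
    exact ⟨s, by rwa [typeAut_map hg.1], hform s _ _ hz⟩
  · rw [typeAut_map hg.1] at hs
    exact hform s _ _ (hsingle i _ (valueList_mem hS hr hs))

end Rays

/-! ### Groups of order two and four -/

lemma nonempty_mulEquiv_C2 {G : Type*} [Group G] (h : Nat.card G = 2) : Nonempty (G ≃* C2) := by
  have : Fact (Nat.Prime 2) := ⟨Nat.prime_two⟩
  refine ⟨mulEquivOfPrimeCardEq (p := 2) h ?_⟩
  simp [C2]

lemma isKleinFour_of_card {G : Type*} [Group G] (h : Nat.card G = 4) (hG : ∀ a : G, a * a = 1) :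
    IsKleinFour G := by
  refine ⟨h, ?_⟩
  have h1 : Monoid.exponent G ∣ 2 := Monoid.exponent_dvd_of_forall_pow_eq_one fun a => by
    rw [pow_two, hG]
  rcases (Nat.dvd_prime Nat.prime_two).mp h1 with h2 | h2
  · have := Monoid.exp_eq_one_iff.mp h2
    rw [Nat.card_of_subsingleton (1 : G)] at h
    omega
  · exact h2

lemma nonempty_mulEquiv_C2_prod {G : Type*} [Group G] [IsKleinFour G] :
    Nonempty (G ≃* C2 × C2) := by
  have : IsKleinFour (C2 × C2) := isKleinFour_of_card (by simp [C2]) (by decide)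
  exact IsKleinFour.nonempty_mulEquiv

lemma exists_generators {G : Type*} [Group G] (f : G ≃* C2 × C2) :
    ∃ a b : G, orderOf a = 2 ∧ orderOf b = 2 ∧ a * b = b * a ∧ Subgroup.closure {a, b} = ⊤ := by
  let a : C2 × C2 := (Multiplicative.ofAdd 1, 1)
  let b : C2 × C2 := (1, Multiplicative.ofAdd 1)
  have ho : ∀ x : C2 × C2, x * x = 1 → x ≠ 1 → orderOf x = 2 := fun x h1 h2 =>
    orderOf_eq_prime (by rw [pow_two, h1]) h2
  refine ⟨f.symm a, f.symm b, ?_, ?_, ?_, ?_⟩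
  · rw [MulEquiv.orderOf_eq]; exact ho a (by decide) (by decide)
  · rw [MulEquiv.orderOf_eq]; exact ho b (by decide) (by decide)
  · rw [← map_mul, ← map_mul]; exact congrArg _ (by decide)
  · rw [eq_top_iff]
    intro x _
    have ha : f.symm a ∈ Subgroup.closure {f.symm a, f.symm b} :=
      Subgroup.subset_closure (Or.inl rfl)
    have hb : f.symm b ∈ Subgroup.closure {f.symm a, f.symm b} :=
      Subgroup.subset_closure (Or.inr rfl)
    have hall : ∀ y : C2 × C2, y = 1 ∨ y = a ∨ y = b ∨ y = a * b := by decide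
    rw [← f.symm_apply_apply x]
    rcases hall (f x) with h | h | h | h <;> rw [h]
    · rw [map_one]; exact one_mem _
    · exact ha
    · exact hb
    · rw [map_mul]; exact mul_mem ha hb

/-! ### The computations -/

/-- The order of the symmetry group of the scheme. -/
def autCount (n : ℕ) : ℕ := if n ≤ 9 then 1 else if n ≤ 12 then 2 else 4

/-- The conditions on the simple roots and their scheme which are verified by computation. -/
def CellCheck (n : ℕ) : Prop :=
  extraCheck n = true ∧ orderCheck n = true ∧ lightCheck n = true ∧ RootCheck n ∧
    AutCheck n (autCount n)

instance (n : ℕ) : Decidable (CellCheck n) := inferInstanceAs (Decidable (_ ∧ _ ∧ _ ∧ _ ∧ _))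

set_option maxRecDepth 100000 in
lemma cellCheck_le_eleven : ∀ n ∈ List.range' 2 10, CellCheck n := by decide +kernel

set_option maxRecDepth 100000 in
lemma cellCheck_twelve : CellCheck 12 := by decide +kernel

set_option maxRecDepth 100000 in
lemma cellCheck_thirteen : CellCheck 13 := by decide +kernel

lemma cellCheck {n : ℕ} (hn : 2 ≤ n) (hn' : n ≤ 13) : CellCheck n := by
  rcases (show n ≤ 11 ∨ n = 12 ∨ n = 13 by omega) with h | rfl | rfl
  · exact cellCheck_le_eleven n (List.mem_range'_1.mpr ⟨hn, by omega⟩)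
  · exact cellCheck_twelve
  · exact cellCheck_thirteen

set_option maxRecDepth 100000 in
lemma rayCheck_le_twelve : ∀ n ∈ List.range' 9 4, RayCheck n := by decide +kernel

set_option maxRecDepth 100000 in
lemma rayCheck_thirteen : RayCheck 13 := by decide +kernel

lemma rayCheck {n : ℕ} (hn : 9 ≤ n) (hn' : n ≤ 13) : RayCheck n := by
  rcases (show n ≤ 12 ∨ n = 13 by omega) with h | rfl
  · exact rayCheck_le_twelve n (List.mem_range'_1.mpr ⟨hn, by omega⟩)
  · exact rayCheck_thirteen

end HypRefl

open HypRefl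

theorem mainTheorem3 (n : ℕ) (hn : 2 ≤ n) (hn' : n ≤ 13)
    (P : Set (HypRefl.V n)) (hP : HypRefl.IsCell n P) :
    (n ≤ 9 → HypRefl.Sym P = ⊥) ∧
    (10 ≤ n → n ≤ 12 → Nonempty (HypRefl.Sym P ≃* HypRefl.C2)) ∧
    (n = 9 → (HypRefl.idealVertices P).ncard = 2 ∧ HypRefl.GroupedInto P 0 2) ∧
    (n = 10 → (HypRefl.idealVertices P).ncard = 3 ∧ HypRefl.GroupedInto P 1 1) ∧
    (n = 11 → (HypRefl.idealVertices P).ncard = 5 ∧ HypRefl.GroupedInto P 2 1) ∧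
    (n = 12 → (HypRefl.idealVertices P).ncard = 6 ∧ HypRefl.GroupedInto P 2 2) ∧
    (n = 13 → (HypRefl.idealVertices P).ncard = 13 ∧ HypRefl.GroupedInto P 6 1 ∧
      Nonempty (HypRefl.SchemeSym P ≃* HypRefl.C2 × HypRefl.C2) ∧
      (∃ a b : HypRefl.SchemeSym P, orderOf a = 2 ∧ orderOf b = 2 ∧ a * b = b * a ∧
        Subgroup.closure {a, b} = ⊤) ∧
      Nonempty (HypRefl.Sym P ≃* HypRefl.C2 × HypRefl.C2)) ∧
    HypRefl.IsSemidirect (HypRefl.Theta n) (HypRefl.Gam n) (HypRefl.Sym P) ∧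
    (∀ H : Subgroup (HypRefl.V n ≃ₗ[ℝ] HypRefl.V n), H ≤ HypRefl.Sym P →
      HypRefl.IsSemidirect (HypRefl.Theta n) (HypRefl.Gam n) H → H = HypRefl.Sym P) := by
  obtain ⟨h, ho, hl, hr, ha⟩ := cellCheck hn hn'
  have hpos : 0 < n := by omega
  have hS := isSimpleSystem hpos h ho hl hr
  obtain ⟨g, hg, rfl⟩ := hS.exists_of_isCell hP
  have hgT := Gam_le_Theta hg
  have hS' := hS.map hgT
  have hR := (realizable_simpleVec hpos hS ha hr).map hgT
  have hSym := hS'.Sym_le_Theta hR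
  obtain ⟨φ⟩ := hS'.exists_symEquiv hR
  have hcard : Nat.card (typeAut fun i => g (simpleVec n i)) = autCount n := by
    rw [typeAut_map hgT.1]; exact card_typeAut hS ha hr
  have hinv : ∀ s : typeAut fun i => g (simpleVec n i), s * s = 1 := fun s =>
    Subtype.ext (typeAut_spec hS ha hr (by rw [← typeAut_map hgT.1]; exact s.2)).1
  have hideal := fun h9 : 9 ≤ n =>
    groupedInto_of_check hpos h hl hr ha (rayCheck h9 hn') hS hgT
  refine ⟨fun h9 => ?_, fun h10 h12 => ?_, ?_, ?_, ?_, ?_, ?_, hS'.isSemidirect hSym,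
    fun H hH hsd => hS'.eq_Sym_of_isSemidirect hSym hH hsd⟩
  · rw [← Subgroup.card_eq_one, Nat.card_congr φ.toEquiv, hcard, autCount, if_pos h9]
  · refine nonempty_mulEquiv_C2 ?_
    rw [Nat.card_congr φ.toEquiv, hcard, autCount, if_neg (by omega), if_pos h12]
  · rintro rfl; exact hideal (by norm_num)
  · rintro rfl; exact hideal (by norm_num)
  · rintro rfl; exact hideal (by norm_num)
  · rintro rfl; exact hideal (by norm_num)
  · rintro rfl
    have := isKleinFour_of_card hcard hinv
    obtain ⟨ψ⟩ := nonempty_mulEquiv_C2_prod (G := typeAut fun i => g (simpleVec 13 i))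
    obtain ⟨h1, h2⟩ := hideal (by norm_num)
    exact ⟨h1, h2, ⟨hS'.schemeEquiv.symm.trans ψ⟩,
      exists_generators (hS'.schemeEquiv.symm.trans ψ), ⟨φ.trans ψ⟩⟩
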